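/- **Model.** A system has $m$ identical servers and an infinite buffer ($B=\infty$) and starts empty at time $0$. The input $\mathcal I$ consists of $n\in\{0,1,2,\dots\}\cup\{\infty\}$ packets; packet $i$ is generated at time $s_i$ and arrives at time $a_i$, where $0\le s_1\le s_2\le\cdots$ and $s_i\le a_i$; the arrival order need not be the generation order. Only finitely many packets arrive in each bounded time interval. Each server serves at most one packet at a time and each packet is served by at most one server at a time. Preemption is allowed at any time; a preempted packet returns to the buffer. Each service started on a server has its own service time; all these service times are i.i.d. exponential with rate $\mu>0$. A service that is not preempted ends, with the delivery of its packet, when its service time has elapsed. A *causal policy* decides which packets the servers serve as a (measurable) function of the history and current state of the system and possibly of a random seed independent of the service times; it does not see the service times of unfinished services. Almost surely it makes finitely many decisions in bounded time. $\Pi$ is the set of causal policies. A policy is *work-conserving* if, almost surely, no server is ever idle while a packet is waiting. A *prmp-LGFS* (preemptive last-generated-first-served) policy acts only at arrivals and deliveries, is work-conserving, always keeps in service packets such that no waiting packet has a larger generation time than a packet in service (ties broken arbitrarily), and interrupts an ongoing service only to replace the packet by one with a strictly larger generation time. For $\pi\in\Pi$ let $c_i\in[0,\infty]$ be the delivery time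 of packet $i$, $\gamma_\pi(t)=\#\{i:c_i\le t\}$ the number of packets delivered by time $t$, $N_\pi(t)=\#\{i:a_i\le t<c_i\}$ the number of packets in the system, and $A(t)=\#\{i:a_i\le t\}$. For processes, $X\le_{\rm st}Y$ means $\mathbb P((X(t_1),\dots,X(t_r))\in U)\le\mathbb P((Y(t_1),\dots,Y(t_r))\in U)$ for all $t_1<\dots<t_r$ and all upper sets $U$. The throughput on $[0,T]$ is $\mathbb E[\gamma_\pi(T)]/T$. The mean delay on $[0,T]$ is $D_\pi(T)=\frac1{A(T)}\mathbb E\sum_{i:a_i\le T}(\min(c_i,T)-a_i)$ (and $0$ if $A(T)=0$). A policy $\pi^*\in\Pi$ is *throughput-optimal* if for all $\pi\in\Pi$: $\gamma_\pi\le_{\rm st}\gamma_{\pi^*}$, its throughput on $[0,T]$ is at least that of $\pi$ for every $T>0$, and so are the $\liminf$ and $\limsup$ of its throughput as $T\to\infty$. It is *mean-delay-optimal* if for all $\pi\in\Pi$: $N_{\pi^*}\le_{\rm st}N_\pi$; $D_{\pi^*}(T)\le D_\pi(T)$ for every $T\geq 0$; the $\liminf$ and $\limsup$ of $D_{\pi^*}(T)$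 as $T\to\infty$ are at most those of $D_\pi(T)$; and $\sum_i\mathbb E[c_i-a_i]$ is at most its value under $\pi$, hence, for finite $n\ge1$, so is the mean delay per packet $\frac1n\sum_{i=1}^n\mathbb E[c_i-a_i]$. **Theorem 2.** For every such input $\mathcal I$ (with $B=\infty$), prmp-LGFS policies exist, and each of them belongs to $\Pi$, is work-conserving, and is throughput-optimal and mean-delay-optimal among all policies in $\Pi$. Moreover, for any two work-conserving policies $\pi,\pi'\in\Pi$ the processes $\{(N_\pi(t),\gamma_\pi(t)),t\ge0\}$ and $\{(N_{\pi'}(t),\gamma_{\pi'}(t)),t\ge0\}$ have the same distribution, and every work-conserving policy in $\Pi$ is throughput-optimal and mean-delay-optimal. -/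

import Mathlib

open MeasureTheory ProbabilityTheory Filter Topology
open scoped NNReal ENNReal

/-- The discrete σ-algebra on `Option ℕ` (a packet index, or `none`). -/
instance instMeasurableSpaceOptionNat : MeasurableSpace (Option ℕ) := ⊤

namespace UpdateSystem

/-- The input of the system with an infinite buffer: the number `n` of packets (possibly infinite),
the generation times and the arrival times of the packets `0, 1, …` below `n` (the values at
indices `≥ n` are never used). Finitely many packets arrive in every bounded time interval. -/
structure Input where
  n : ℕ∞
  gen : ℕ → ℝ≥0
  arr : ℕ → ℝ≥0
  gen_mono : ∀ i j : ℕ, i ≤ j → (j : ℕ∞) < n → gen i ≤ gen j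
  gen_le_arr : ∀ i : ℕ, (i : ℕ∞) < n → gen i ≤ arr i
  finite_arrivals : ∀ T : ℝ≥0, {i : ℕ | (i : ℕ∞) < n ∧ arr i ≤ T}.Finite

/-- What can be seen at a decision epoch: the time of the epoch; for each server, the packet whose
service it completes at this epoch (`none` if there is no completion); and, for each server, the
packet that it was serving just before and that is still unfinished (`none` if there is none). -/
abbrev Obs (m : ℕ) : Type := ℝ≥0∞ × (Fin m → Option ℕ) × (Fin m → Option ℕ)

variable {m : ℕ}

def Obs.time (o : Obs m) : ℝ≥0∞ := o.1
def Obs.delivered (o : Obs m) : Fin m → Option ℕ := o.2.1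
def Obs.serving (o : Obs m) : Fin m → Option ℕ := o.2.2

/-- The history at epoch `k`: the observations of epochs `0, …, k`. -/
abbrev Hist (m k : ℕ) : Type := Fin (k + 1) → Obs m

/-- The current observation. -/
def Hist.now {k : ℕ} (h : Hist m k) : Obs m := h (Fin.last k)

/-- The packets that have arrived and have not been delivered, according to a history. -/
def Input.inSystem (I : Input) {k : ℕ} (h : Hist m k) : Set ℕ :=
  {i | (i : ℕ∞) < I.n ∧ (I.arr i : ℝ≥0∞) ≤ h.now.time ∧ ∀ l j, (h l).delivered j ≠ some i}

/-- A causal scheduling policy for the input `I` and `m` servers. At every decision epoch it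
chooses, from the history and a randomization seed in `Ξ`, the packet that each server serves from
now on (`none`: the server idles), and a delay after which it wants to decide again if nothing
happens before. The decision epochs are time `0`, the arrival times, the service completions and
the review times chosen in this way; so preemption is possible at any time. Only packets that are in
the system can be served, and no packet is served by two servers at once. (An epoch at time `⊤`
stands for "no further epoch".) -/
structure Policy (I : Input) (m : ℕ) (Ξ : Type*) [MeasurableSpace Ξ] where
  assign : (k : ℕ) → Ξ → Hist m k → Fin m → Option ℕ
  review : (k : ℕ) → Ξ → Hist m k → ℝ≥0∞
  measurable_assign : ∀ k, Measurable fun p : Ξ × Hist m k => assign k p.1 p.2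
  measurable_review : ∀ k, Measurable fun p : Ξ × Hist m k => review k p.1 p.2
  review_pos : ∀ k e h, 0 < review k e h
  assign_mem : ∀ k e (h : Hist m k), h.now.time ≠ ⊤ →
    ∀ j i, assign k e h j = some i → i ∈ I.inSystem h
  assign_inj : ∀ k e (h : Hist m k), h.now.time ≠ ⊤ →
    ∀ j j' i, assign k e h j = some i → assign k e h j' = some i → j = j'

/-- The first arrival time after `T` (`⊤` if there is none). -/
noncomputable def Input.nextArrival (I : Input) (T : ℝ≥0∞) : ℝ≥0∞ :=
  sInf {t | ∃ i : ℕ, (i : ℕ∞) < I.n ∧ t = I.arr i ∧ T < t}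

/-- The full state at epoch `k`, before the decision of epoch `k`: the visible history and, hidden
from the policy, the time at which each ongoing service is going to be completed if it is not
preempted. -/
structure SysState (m k : ℕ) where
  hist : Hist m k
  finish : Fin m → ℝ≥0∞

/-- The realization of the primitive random elements: the seed of the policy, and the service times;
`x k j` is the service time of a service that server `j` starts at epoch `k`. -/
abbrev Outcome (m : ℕ) (Ξ : Type*) : Type _ := Ξ × (ℕ → Fin m → ℝ)

section Dynamics

variable {I : Input} {Ξ : Type*} [MeasurableSpace Ξ]

/-- The completion times after the decision of epoch `k`, if no server is preempted from now on. An
ongoing service continues if its server keeps its packet; otherwise a new service starts, with a new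
service time. -/
noncomputable def Policy.newFinish (π : Policy I m Ξ) {k : ℕ} (e : Ξ) (x : Fin m → ℝ)
    (S : SysState m k) (j : Fin m) : ℝ≥0∞ :=
  if π.assign k e S.hist j = none then ⊤
  else if π.assign k e S.hist j = S.hist.now.serving j then S.finish j
  else S.hist.now.time + ENNReal.ofReal (x j)

/-- The time of the next epoch: the next arrival, review or service completion. -/
noncomputable def Policy.nextTime (π : Policy I m Ξ) {k : ℕ} (e : Ξ) (x : Fin m → ℝ)
    (S : SysState m k) : ℝ≥0∞ :=
  min (I.nextArrival S.hist.now.time)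
    (min (S.hist.now.time + π.review k e S.hist) (⨅ j, π.newFinish e x S j))

/-- The packets delivered by the servers at the next epoch. -/
noncomputable def Policy.nextDelivered (π : Policy I m Ξ) {k : ℕ} (e : Ξ) (x : Fin m → ℝ)
    (S : SysState m k) (j : Fin m) : Option ℕ :=
  open Classical in
  if π.newFinish e x S j ≤ π.nextTime e x S ∧ π.nextTime e x S ≠ ⊤ then π.assign k e S.hist j
  else none

/-- The packets still under service at the next epoch, before the decision taken there. -/
noncomputable def Policy.nextServing (π : Policy I m Ξ) {k : ℕ} (e : Ξ) (x : Fin m → ℝ)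
    (S : SysState m k) (j : Fin m) : Option ℕ :=
  if π.nextDelivered e x S j = none then π.assign k e S.hist j else none

/-- The evolution of the system, started empty at time `0`. -/
noncomputable def Policy.run (π : Policy I m Ξ) (w : Outcome m Ξ) : (k : ℕ) → SysState m k
  | 0 => { hist := fun _ => (0, fun _ => none, fun _ => none), finish := fun _ => ⊤ }
  | k + 1 =>
    { hist := Fin.snoc (π.run w k).hist
        (π.nextTime w.1 (w.2 k) (π.run w k), π.nextDelivered w.1 (w.2 k) (π.run w k),
          π.nextServing w.1 (w.2 k) (π.run w k))
      finish := π.newFinish w.1 (w.2 k) (π.run w k) }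

/-- The observation at epoch `k`. -/
noncomputable def Policy.obs (π : Policy I m Ξ) (w : Outcome m Ξ) (k : ℕ) : Obs m :=
  (π.run w k).hist.now

/-- The assignment chosen at epoch `k`. -/
noncomputable def Policy.decision (π : Policy I m Ξ) (w : Outcome m Ξ) (k : ℕ) : Fin m → Option ℕ :=
  π.assign k w.1 (π.run w k).hist

/-- The packets in the system at epoch `k` that are not put in service by the decision taken
there. -/
def Policy.waiting (π : Policy I m Ξ) (w : Outcome m Ξ) (k : ℕ) : Set ℕ :=
  {i | i ∈ I.inSystem (π.run w k).hist ∧ ∀ j, π.decision w k j ≠ some i}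

/-- The time `c_i` at which packet `i` is delivered (`⊤` if it never is). -/
noncomputable def Policy.completion (π : Policy I m Ξ) (w : Outcome m Ξ) (i : ℕ) : ℝ≥0∞ :=
  sInf {t | ∃ k j, (π.obs w k).delivered j = some i ∧ t = (π.obs w k).time}

/-- `γ(t)`, the number of packets delivered up to time `t`. -/
noncomputable def Policy.deliveredCount (π : Policy I m Ξ) (w : Outcome m Ξ) (t : ℝ≥0) : ℕ :=
  {i : ℕ | (i : ℕ∞) < I.n ∧ π.completion w i ≤ t}.ncard

/-- `N(t)`, the number of packets in the system at time `t`. -/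
noncomputable def Policy.queueLength (π : Policy I m Ξ) (w : Outcome m Ξ) (t : ℝ≥0) : ℕ :=
  {i : ℕ | (i : ℕ∞) < I.n ∧ I.arr i ≤ t ∧ (t : ℝ≥0∞) < π.completion w i}.ncard

end Dynamics

/-- The number of packets that arrive up to time `T`. -/
noncomputable def Input.arrivalCount (I : Input) (T : ℝ≥0) : ℕ :=
  {i : ℕ | (i : ℕ∞) < I.n ∧ I.arr i ≤ T}.ncard

section Random

variable {I : Input} {Ξ : Type*} [MeasurableSpace Ξ] {Ω : Type*} [MeasurableSpace Ω]

/-- Membership in the class of causal policies: almost surely there are only finitely many decision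
epochs in every bounded time interval. -/
def Policy.Admissible (π : Policy I m Ξ) (P : Measure Ω) (W : Ω → Outcome m Ξ) : Prop :=
  ∀ᵐ ω ∂P, Tendsto (fun k => (π.obs (W ω) k).time) atTop (𝓝 ⊤)

/-- No server is idle while packets are waiting. -/
def Policy.WorkConserving (π : Policy I m Ξ) (P : Measure Ω) (W : Ω → Outcome m Ξ) : Prop :=
  ∀ᵐ ω ∂P, ∀ k, (π.obs (W ω) k).time ≠ ⊤ →
    ∀ j, π.decision (W ω) k j = none → π.waiting (W ω) k = ∅

/-- The preemptive Last Generated First Served rule, with arbitrary tie-breaking: decisions are only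
made at arrivals and deliveries; no server idles while packets are waiting; no waiting packet is
fresher than a packet under service; and an ongoing service is interrupted only in favour of a
strictly fresher packet, the preempted packet going back to the queue. -/
def Policy.IsPrmpLGFS (π : Policy I m Ξ) (P : Measure Ω) (W : Ω → Outcome m Ξ) : Prop :=
  ∀ᵐ ω ∂P, ∀ k, (π.obs (W ω) k).time ≠ ⊤ →
    π.review k (W ω).1 (π.run (W ω) k).hist = ⊤ ∧
    (∀ j, π.decision (W ω) k j = none → π.waiting (W ω) k = ∅) ∧
    (∀ j i, π.decision (W ω) k j = some i → ∀ i' ∈ π.waiting (W ω) k, I.gen i' ≤ I.gen i) ∧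
    (∀ j i, (π.obs (W ω) k).serving j = some i →
      π.decision (W ω) k j = some i ∨
      (i ∈ π.waiting (W ω) k ∧ ∃ i', π.decision (W ω) k j = some i' ∧ I.gen i < I.gen i'))

/-- Stochastic ordering of processes indexed by `[0, ∞)`: the finite-dimensional distributions
are ordered on all upper sets. -/
def StochLE (P : Measure Ω) (X Y : ℝ≥0 → Ω → ℕ) : Prop :=
  ∀ (r : ℕ) (t : Fin r → ℝ≥0), StrictMono t → ∀ U : Set (Fin r → ℕ), IsUpperSet U →
    P {ω | (fun l => X (t l) ω) ∈ U} ≤ P {ω | (fun l => Y (t l) ω) ∈ U}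

/-- The throughput on `[0, T]`: the expected number of deliveries per unit of time. -/
noncomputable def Policy.throughput (π : Policy I m Ξ) (P : Measure Ω) (W : Ω → Outcome m Ξ)
    (T : ℝ≥0) : ℝ≥0∞ :=
  (∫⁻ ω, (π.deliveredCount (W ω) T : ℝ≥0∞) ∂P) / T

/-- The mean delay on `[0, T]`: the expected time spent in the system during `[0, T]`, averaged
over the packets that arrive in `[0, T]`. -/
noncomputable def Policy.meanDelayUpTo (π : Policy I m Ξ) (P : Measure Ω) (W : Ω → Outcome m Ξ)
    (T : ℝ≥0) : ℝ≥0∞ :=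
  open Classical in
  (∑' i : ℕ, if (i : ℕ∞) < I.n ∧ I.arr i ≤ T then
      ∫⁻ ω, (min (π.completion (W ω) i) T - I.arr i) ∂P else 0) / I.arrivalCount T

/-- The sum over all packets of the expected delays `c_i - a_i`. -/
noncomputable def Policy.totalDelay (π : Policy I m Ξ) (P : Measure Ω) (W : Ω → Outcome m Ξ) :
    ℝ≥0∞ :=
  open Classical in
  ∑' i : ℕ, if (i : ℕ∞) < I.n then ∫⁻ ω, (π.completion (W ω) i - I.arr i) ∂P else 0

/-- `π` maximizes the throughput among all causal policies: its delivery process is stochastically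
largest, and so are its throughput on every horizon and its long-run throughput. -/
def Policy.ThroughputOptimal (π : Policy I m Ξ) (P : Measure Ω) (W : Ω → Outcome m Ξ) : Prop :=
  ∀ π' : Policy I m Ξ, π'.Admissible P W →
    StochLE P (fun t ω => π'.deliveredCount (W ω) t) (fun t ω => π.deliveredCount (W ω) t) ∧
    (∀ T : ℝ≥0, 0 < T → π'.throughput P W T ≤ π.throughput P W T) ∧
    liminf (π'.throughput P W) atTop ≤ liminf (π.throughput P W) atTop ∧
    limsup (π'.throughput P W) atTop ≤ limsup (π.throughput P W) atTop

/-- `π` minimizes the mean delay among all causal policies: its queue-length process is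
stochastically smallest; its mean delay on every horizon and its long-run mean delay are smallest;
the total expected delay is smallest; and, if there are finitely many packets, so is the mean delay
per packet. -/
def Policy.MeanDelayOptimal (π : Policy I m Ξ) (P : Measure Ω) (W : Ω → Outcome m Ξ) : Prop :=
  ∀ π' : Policy I m Ξ, π'.Admissible P W →
    StochLE P (fun t ω => π.queueLength (W ω) t) (fun t ω => π'.queueLength (W ω) t) ∧
    (∀ T : ℝ≥0, π.meanDelayUpTo P W T ≤ π'.meanDelayUpTo P W T) ∧
    liminf (π.meanDelayUpTo P W) atTop ≤ liminf (π'.meanDelayUpTo P W) atTop ∧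
    limsup (π.meanDelayUpTo P W) atTop ≤ limsup (π'.meanDelayUpTo P W) atTop ∧
    π.totalDelay P W ≤ π'.totalDelay P W ∧
    (∀ n : ℕ, I.n = n → π.totalDelay P W / n ≤ π'.totalDelay P W / n)

end Random

end UpdateSystem

/-!
Count time in units of work: a server at work for time `t` does work `t`. By memorylessness, at
every epoch the residual service times of the busy servers are, given the visible history, again
independent with law `ρ`, whichever services the policy chooses to continue. Hence under every
causal policy the amounts of total work done between successive deliveries are an i.i.d. sequence
`E` of law `ρ`.

When `i` packets have been delivered and `A` have arrived, at most `min m (A - i)` servers are busy,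
with equality under a work-conserving policy. So the delivery times under any policy are at least
those of the ideal system in which the next delivery occurs once the integral of `min m (A - i)`
since the `i`-th delivery reaches `E i`, and a work-conserving policy attains them. The law of the
ideal system depends on the input alone, so it bounds the throughput of every policy and is the
common law of the work-conserving ones. The rest follows from `N = A - γ` and from Little's
identity, by which the total delay up to time `T` is the integral of `N` over `[0, T]`.

A prmp-LGFS policy acts only at arrivals and deliveries, so each of its epochs brings one of these,
and only finitely many of them fall in a bounded time interval.
-/

namespace UpdateSystem

section ProductMeasure

variable {α β γ : Type*} [MeasurableSpace α] [MeasurableSpace β] [MeasurableSpace γ]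

lemma measure_ext_of_Ioi [LinearOrder α] [TopologicalSpace α] [OrderTopology α]
    [SecondCountableTopology α] [BorelSpace α] {κ κ' : Measure α} [IsFiniteMeasure κ]
    (huniv : κ Set.univ = κ' Set.univ) (h : ∀ c, κ (Set.Ioi c) = κ' (Set.Ioi c)) : κ = κ' := by
  refine ext_of_generate_finite (Set.range Set.Ioi) ?_ isPiSystem_Ioi ?_ huniv
  · rw [← borel_eq_generateFrom_Ioi]
    exact BorelSpace.measurable_eq
  · rintro _ ⟨c, rfl⟩
    exact h c

lemma map_restrict_prod_congr {μ : Measure α} {ν : Measure β} [SFinite ν] {f g : α × β → γ}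
    (hf : Measurable f) (hg : Measurable g) {A : Set (α × β)} (hA : MeasurableSet A)
    (h : ∀ a, (ν.restrict (Prod.mk a ⁻¹' A)).map (fun b => f (a, b)) =
      (ν.restrict (Prod.mk a ⁻¹' A)).map (fun b => g (a, b))) :
    ((μ.prod ν).restrict A).map f = ((μ.prod ν).restrict A).map g := by
  have hslice {u : α × β → γ} (hu : Measurable u) {s : Set γ} (hs : MeasurableSet s) (a : α) :
      ν (Prod.mk a ⁻¹' (u ⁻¹' s ∩ A)) =
        (ν.restrict (Prod.mk a ⁻¹' A)).map (fun b => u (a, b)) s := by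
    have hua : Measurable fun b => u (a, b) := hu.comp measurable_prodMk_left
    rw [Measure.map_apply hua hs, Measure.restrict_apply (hua hs)]
    rfl
  refine Measure.ext fun s hs => ?_
  rw [Measure.map_apply hf hs, Measure.map_apply hg hs, Measure.restrict_apply (hf hs),
    Measure.restrict_apply (hg hs), Measure.prod_apply ((hf hs).inter hA),
    Measure.prod_apply ((hg hs).inter hA)]
  exact lintegral_congr fun a => by rw [hslice hf hs, hslice hg hs, h]

lemma map_prod_congr {μ : Measure α} {ν : Measure β} [SFinite ν] {f g : α × β → γ}
    (hf : Measurable f) (hg : Measurable g)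
    (h : ∀ a, ν.map (fun b => f (a, b)) = ν.map (fun b => g (a, b))) :
    (μ.prod ν).map f = (μ.prod ν).map g := by
  simpa only [Set.preimage_univ, Measure.restrict_univ] using
    map_restrict_prod_congr hf hg MeasurableSet.univ fun a => by simpa using h a

lemma measurePreserving_update_infinitePi {ι : Type*} [DecidableEq ι] {X : ι → Type*}
    [∀ i, MeasurableSpace (X i)] (ν : ∀ i, Measure (X i)) [∀ i, IsProbabilityMeasure (ν i)]
    (i : ι) :
    MeasurePreserving (fun p : X i × (∀ i, X i) => Function.update p.2 i p.1)
      ((ν i).prod (Measure.infinitePi ν)) (Measure.infinitePi ν) := by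
  have hm : Measurable fun p : X i × (∀ i, X i) => Function.update p.2 i p.1 :=
    measurable_update'.comp measurable_swap
  refine ⟨hm, Measure.eq_infinitePi _ fun s t ht => ?_⟩
  have hpre : (fun p : X i × (∀ i, X i) => Function.update p.2 i p.1) ⁻¹' (s : Set ι).pi t =
      (if i ∈ s then t i else Set.univ) ×ˢ ((s.erase i : Finset ι) : Set ι).pi t := by
    ext ⟨r, R⟩
    simp only [Set.mem_preimage, Set.mem_pi, Set.mem_prod, Finset.mem_coe, Finset.mem_erase]
    constructor
    · refine fun h => ⟨?_, fun j hj => by simpa [hj.1] using h j hj.2⟩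
      split_ifs with hi
      · simpa using h i hi
      · trivial
    · rintro ⟨hi, hrest⟩ j hj
      by_cases hji : j = i
      · subst hji; simpa [hj] using hi
      · simpa [hji] using hrest j ⟨hji, hj⟩
  rw [Measure.map_apply hm (MeasurableSet.pi s.countable_toSet fun j _ => ht j), hpre,
    Measure.prod_prod, Measure.infinitePi_pi _ fun j _ => ht j]
  split_ifs with hi
  · exact Finset.mul_prod_erase s (fun j => ν j (t j)) hi
  · rw [measure_univ, one_mul, Finset.erase_eq_of_notMem hi]

lemma measurePreserving_update_infinitePi_of {ι : Type*} [DecidableEq ι] {X : ι → Type*}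
    [∀ i, MeasurableSpace (X i)] {ν : ∀ i, Measure (X i)} [∀ i, IsProbabilityMeasure (ν i)]
    {μ : Measure α} [SFinite μ] {i : ι} {f : α × X i → X i}
    (hf : MeasurePreserving f (μ.prod (ν i)) (ν i)) :
    MeasurePreserving (fun p : α × (∀ i, X i) => Function.update p.2 i (f (p.1, p.2 i)))
      (μ.prod (Measure.infinitePi ν)) (Measure.infinitePi ν) := by
  have hupd := measurePreserving_update_infinitePi ν i
  have hpair := ((MeasurePreserving.id μ).prod hupd).comp
    (measurePreserving_prodAssoc μ (ν i) (Measure.infinitePi ν))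
  have hnew := hupd.comp (hf.prod (MeasurePreserving.id (Measure.infinitePi ν)))
  have hm : Measurable fun p : α × (∀ i, X i) => Function.update p.2 i (f (p.1, p.2 i)) :=
    measurable_update'.comp (measurable_snd.prodMk (hf.measurable.comp
      (measurable_fst.prodMk ((measurable_pi_apply i).comp measurable_snd))))
  have hcomp : (fun p : α × (∀ i, X i) => Function.update p.2 i (f (p.1, p.2 i))) ∘
      (Prod.map id fun p => Function.update p.2 i p.1) ∘ MeasurableEquiv.prodAssoc =
      (fun p => Function.update p.2 i p.1) ∘ Prod.map f id := by
    ext ⟨⟨a, r⟩, R⟩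
    simp [MeasurableEquiv.prodAssoc]
  exact ⟨hm, by rw [← hpair.map_eq, Measure.map_map hm hpair.measurable, hcomp, hnew.map_eq]⟩

lemma measurePreserving_update_pi {ι : Type*} [Fintype ι] [DecidableEq ι] {X : ι → Type*}
    [∀ i, MeasurableSpace (X i)] (ν : ∀ i, Measure (X i)) [∀ i, IsProbabilityMeasure (ν i)]
    (i : ι) :
    MeasurePreserving (fun p : X i × (∀ i, X i) => Function.update p.2 i p.1)
      ((ν i).prod (Measure.pi ν)) (Measure.pi ν) := by
  simpa only [Measure.infinitePi_eq_pi] using measurePreserving_update_infinitePi ν i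

lemma ae_injective_pi {ι : Type*} [Fintype ι] [MeasurableEq α] (ν : ι → Measure α)
    [∀ i, IsProbabilityMeasure (ν i)] [∀ i, NullSingletonClass (ν i)] :
    ∀ᵐ R ∂Measure.pi ν, Function.Injective R := by
  classical
  have hne (i j : ι) (hij : i ≠ j) : ∀ᵐ R ∂Measure.pi ν, R i ≠ R j := by
    have hms : MeasurableSet {R : ι → α | R i = R j} :=
      measurableSet_eq_fun (measurable_pi_apply i) (measurable_pi_apply j)
    have hup := measurePreserving_update_pi ν i
    simp only [ae_iff, not_not]
    rw [← hup.map_eq, Measure.map_apply hup.measurable hms,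
      ← (Measure.measurePreserving_swap (μ := Measure.pi ν)).measure_preimage
        (hup.measurable hms).nullMeasurableSet,
      Measure.measure_prod_null (measurable_swap (hup.measurable hms))]
    refine Eventually.of_forall fun R => ?_
    simp [Function.update_of_ne hij.symm, Set.preimage]
  have hall : ∀ᵐ R ∂Measure.pi ν, ∀ i j : ι, i ≠ j → R i ≠ R j := by
    simpa only [ae_all_iff] using hne
  filter_upwards [hall] with R hR i j hij
  exact by_contra fun h => hR i j h hij

end ProductMeasure

section FinsetMeasurable

variable {α β γ δ : Type*} [MeasurableSpace α]

/-- The discrete σ-algebra on finite sets. -/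
instance instMeasurableSpaceFinset : MeasurableSpace (Finset β) := ⊤

instance instDiscreteMeasurableSpaceFinset : DiscreteMeasurableSpace (Finset β) :=
  ⟨fun _ => trivial⟩

lemma measurable_finset_iff [Countable β] {f : α → Finset β} :
    Measurable f ↔ ∀ j, MeasurableSet {x | j ∈ f x} := by
  refine ⟨fun hf j => hf (MeasurableSet.of_discrete (s := {S | j ∈ S})), fun h => ?_⟩
  refine measurable_to_countable' fun S => ?_
  have hpre : f ⁻¹' {S} = ⋂ j, {x | j ∈ f x ↔ j ∈ S} := by
    ext x
    simp [Finset.ext_iff]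
  rw [hpre]
  refine MeasurableSet.iInter fun j => ?_
  by_cases hj : j ∈ S
  · simpa [hj] using h j
  · simp only [hj, iff_false]
    exact (h j).compl

lemma measurable_comp_countable [MeasurableSpace β] [Countable β] [DiscreteMeasurableSpace β]
    [MeasurableSpace γ] [MeasurableSpace δ] {g : β → δ → γ} (hg : ∀ b, Measurable (g b))
    {f : α → β} (hf : Measurable f) {x : α → δ} (hx : Measurable x) :
    Measurable fun a => g (f a) (x a) :=
  (measurable_from_prod_countable_right (f := fun p : β × δ => g p.1 p.2) hg).comp (hf.prodMk hx)

lemma measurable_piecewise_sub [Countable β] [DecidableEq β] {C : α → Finset β}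
    (hC : Measurable C) {R Y : α → β → ℝ≥0∞} (hR : Measurable R) (hY : Measurable Y)
    {T : α → ℝ≥0∞} (hT : Measurable T) :
    Measurable fun a => (C a).piecewise (fun j => R a j - T a) (Y a) :=
  measurable_pi_iff.2 fun j => Measurable.ite (measurable_finset_iff.1 hC j)
    (((measurable_pi_apply j).comp hR).sub hT) ((measurable_pi_apply j).comp hY)

lemma measurableSet_forall_lt (B : Finset β) (c : ℝ≥0∞) :
    MeasurableSet {R : β → ℝ≥0∞ | ∀ j ∈ B, c < R j} := by
  simpa only [Set.pi, Finset.mem_coe, Set.mem_Ioi] using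
    MeasurableSet.pi B.countable_toSet fun _ _ => measurableSet_Ioi

end FinsetMeasurable

section Memoryless

/-- A law on `[0, ∞]` is memoryless if its tail is multiplicative, so that what is left of a
duration exceeding `c` has the law of a whole duration. -/
def Memoryless (ρ : Measure ℝ≥0∞) : Prop :=
  ∀ c d, ρ (Set.Ioi (c + d)) = ρ (Set.Ioi c) * ρ (Set.Ioi d)

variable {ρ : Measure ℝ≥0∞} [IsProbabilityMeasure ρ]

lemma measure_Ioi_zero [NullSingletonClass ρ] : ρ (Set.Ioi 0) = 1 := by
  rw [← bot_eq_zero, Set.Ioi_bot, prob_compl_eq_one_sub (measurableSet_singleton _),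
    measure_singleton, tsub_zero]

lemma Memoryless.tail_pow (h : Memoryless ρ) [NullSingletonClass ρ] (c : ℝ≥0∞) (b : ℕ) :
    ρ (Set.Ioi c) ^ b = ρ (Set.Ioi (b * c)) := by
  induction b with
  | zero => simp [measure_Ioi_zero]
  | succ b ih => rw [pow_succ, ih, ← h, Nat.cast_succ, add_mul, one_mul]

lemma Memoryless.map_sub (h : Memoryless ρ) (c : ℝ≥0∞) :
    (ρ.restrict (Set.Ioi c)).map (fun r => r - c) = ρ (Set.Ioi c) • ρ := by
  have hm : Measurable fun r : ℝ≥0∞ => r - c := measurable_id.sub_const c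
  refine measure_ext_of_Ioi ?_ fun d => ?_
  · rw [Measure.map_apply hm MeasurableSet.univ]
    simp
  · have hpre : (fun r => r - c) ⁻¹' Set.Ioi d ∩ Set.Ioi c = Set.Ioi (c + d) := by
      ext r
      simp only [Set.mem_inter_iff, Set.mem_preimage, Set.mem_Ioi, lt_tsub_iff_left]
      exact ⟨And.left, fun hr => ⟨hr, le_self_add.trans_lt hr⟩⟩
    rw [Measure.map_apply hm measurableSet_Ioi, Measure.restrict_apply (hm measurableSet_Ioi),
      hpre, h, Measure.smul_apply, smul_eq_mul]

variable {ι : Type*} [Fintype ι]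

lemma Memoryless.measure_forall_lt (h : Memoryless ρ) [NullSingletonClass ρ] (B : Finset ι)
    (c : ℝ≥0∞) :
    (Measure.pi fun _ : ι => ρ) {R | ∀ j ∈ B, c < R j} = ρ (Set.Ioi (B.card * c)) := by
  classical
  have hpi : {R : ι → ℝ≥0∞ | ∀ j ∈ B, c < R j} =
      Set.univ.pi fun j => if j ∈ B then Set.Ioi c else Set.univ := by
    ext R
    simp only [Set.mem_ofPred_eq, Set.mem_univ_pi]
    refine forall_congr' fun j => ?_
    by_cases hj : j ∈ B <;> simp [hj]
  simp only [hpi, Measure.pi_pi, apply_ite ρ, measure_univ, Finset.prod_ite_mem,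
    Finset.univ_inter, Finset.prod_const, h.tail_pow]

variable [DecidableEq ι]

lemma Memoryless.map_piecewise_sub_restrict_eq_pi (h : Memoryless ρ) {B C : Finset ι} (hC : C ⊆ B)
    (c : ℝ≥0∞) :
    (((Measure.pi fun _ : ι => ρ).prod (Measure.pi fun _ : ι => ρ)).restrict
      ({R | ∀ j ∈ B, c < R j} ×ˢ Set.univ)).map
        (fun p => C.piecewise (fun j => p.1 j - c) p.2) =
      Measure.pi fun j => (if j ∈ B then ρ (Set.Ioi c) else 1) • ρ := by
  have hfin (j : ι) : IsFiniteMeasure ((if j ∈ B then ρ (Set.Ioi c) else 1) • ρ) :=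
    Measure.smul_finite ρ (by split_ifs <;> simp)
  have hm : Measurable fun p : (ι → ℝ≥0∞) × (ι → ℝ≥0∞) =>
      C.piecewise (fun j => p.1 j - c) p.2 :=
    measurable_piecewise_sub measurable_const measurable_fst measurable_snd measurable_const
  symm
  refine Measure.pi_eq fun s hs => ?_
  have hsub : Measurable fun r : ℝ≥0∞ => r - c := measurable_id.sub_const c
  have hpre : (fun p : (ι → ℝ≥0∞) × (ι → ℝ≥0∞) => C.piecewise (fun j => p.1 j - c) p.2) ⁻¹'
        Set.univ.pi s ∩ ({R | ∀ j ∈ B, c < R j} ×ˢ Set.univ) =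
      (Set.univ.pi fun j => if j ∈ C then (fun r => r - c) ⁻¹' s j ∩ Set.Ioi c else
        if j ∈ B then Set.Ioi c else Set.univ) ×ˢ
      (Set.univ.pi fun j => if j ∈ C then Set.univ else s j) := by
    ext ⟨R, Y⟩
    simp only [Set.mem_inter_iff, Set.mem_preimage, Set.mem_univ_pi, Set.mem_prod,
      Set.mem_ofPred_eq, Set.mem_univ, and_true]
    rw [← forall_and, ← forall_and]
    refine forall_congr' fun j => ?_
    by_cases hjC : j ∈ C
    · simp [hjC, hC hjC]
    · by_cases hjB : j ∈ B <;> simp [hjC, hjB, and_comm]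
  rw [Measure.map_apply hm (MeasurableSet.univ_pi hs),
    Measure.restrict_apply (hm (MeasurableSet.univ_pi hs)), hpre, Measure.prod_prod,
    Measure.pi_pi, Measure.pi_pi, ← Finset.prod_mul_distrib]
  refine Finset.prod_congr rfl fun j _ => ?_
  by_cases hjC : j ∈ C
  · simp only [hjC, hC hjC, if_true, measure_univ, mul_one]
    rw [← h.map_sub, Measure.map_apply hsub (hs j), Measure.restrict_apply (hsub (hs j))]
  · by_cases hjB : j ∈ B <;> simp [hjC, hjB]

lemma Memoryless.map_piecewise_sub_restrict (h : Memoryless ρ) {B C : Finset ι} (hC : C ⊆ B)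
    (c : ℝ≥0∞) :
    (((Measure.pi fun _ : ι => ρ).prod (Measure.pi fun _ : ι => ρ)).restrict
      ({R | ∀ j ∈ B, c < R j} ×ˢ Set.univ)).map
        (fun p => C.piecewise (fun j => p.1 j - c) p.2) =
      (((Measure.pi fun _ : ι => ρ).prod (Measure.pi fun _ : ι => ρ)).restrict
        ({R | ∀ j ∈ B, c < R j} ×ˢ Set.univ)).map Prod.snd := by
  rw [h.map_piecewise_sub_restrict_eq_pi hC,
    ← h.map_piecewise_sub_restrict_eq_pi (Finset.empty_subset B)]
  simp only [Finset.piecewise_empty]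

end Memoryless

section ServiceLaw

/-- The law of an exponential service time of rate `μ`, seen as a law on `[0, ∞]`. -/
noncomputable def serviceLaw (μ : ℝ) : Measure ℝ≥0∞ := (expMeasure μ).map ENNReal.ofReal

variable {μ : ℝ}

lemma isProbabilityMeasure_serviceLaw (hμ : 0 < μ) : IsProbabilityMeasure (serviceLaw μ) := by
  have := isProbabilityMeasure_expMeasure hμ
  exact Measure.isProbabilityMeasure_map ENNReal.measurable_ofReal.aemeasurable

lemma serviceLaw_Ioi (hμ : 0 < μ) (c : ℝ≥0) :
    serviceLaw μ (Set.Ioi (c : ℝ≥0∞)) = ENNReal.ofReal (Real.exp (-(μ * c))) := by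
  have := isProbabilityMeasure_expMeasure hμ
  have hpre : ENNReal.ofReal ⁻¹' Set.Ioi (c : ℝ≥0∞) = (Set.Iic (c : ℝ))ᶜ := by
    ext x
    simp [ENNReal.lt_ofReal_iff_toReal_lt]
  have hexp : 0 ≤ 1 - Real.exp (-(μ * c)) := by
    rw [sub_nonneg, Real.exp_le_one_iff, Left.neg_nonpos_iff]
    positivity
  rw [serviceLaw, Measure.map_apply ENNReal.measurable_ofReal measurableSet_Ioi, hpre,
    prob_compl_eq_one_sub measurableSet_Iic, ← ofReal_cdf, cdf_expMeasure_eq hμ,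
    if_pos c.coe_nonneg, ← ENNReal.ofReal_one, ← ENNReal.ofReal_sub _ hexp, sub_sub_cancel]

lemma memoryless_serviceLaw (hμ : 0 < μ) : Memoryless (serviceLaw μ) := by
  intro c d
  induction c with
  | top => simp
  | coe c =>
    induction d with
    | top => simp
    | coe d =>
      rw [← ENNReal.coe_add, serviceLaw_Ioi hμ, serviceLaw_Ioi hμ, serviceLaw_Ioi hμ,
        ← ENNReal.ofReal_mul (Real.exp_pos _).le, ← Real.exp_add, NNReal.coe_add, mul_add, neg_add]

lemma nullSingletonClass_serviceLaw (hμ : 0 < μ) : NullSingletonClass (serviceLaw μ) := by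
  have := isProbabilityMeasure_expMeasure hμ
  have hatom : NullSingletonClass (expMeasure μ) := by
    rw [expMeasure, gammaMeasure]
    infer_instance
  have hneg : expMeasure μ (Set.Iic 0) = 0 := by
    rw [← ofReal_cdf, cdf_expMeasure_eq hμ]
    simp
  refine ⟨fun c => ?_⟩
  rw [serviceLaw, Measure.map_apply ENNReal.measurable_ofReal (measurableSet_singleton c)]
  refine measure_mono_null (fun x (hx : ENNReal.ofReal x = c) => ?_)
    (measure_union_null hneg (measure_singleton c.toReal))
  obtain hx0 | hx0 := le_or_gt x 0
  · exact Or.inl hx0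
  · exact Or.inr (by rw [Set.mem_singleton_iff, ← hx, ENNReal.toReal_ofReal hx0.le])

end ServiceLaw

section FirstCompletion

variable {ι : Type*}

/-- The time until the first completion among the servers in `B` with residual service times `R`,
or `D` if that is smaller. -/
noncomputable def firstTime (B : Finset ι) (D : ℝ≥0∞) (R : ι → ℝ≥0∞) : ℝ≥0∞ := D ⊓ B.inf R

/-- The servers in `B` that complete their service at time `firstTime B D R`. -/
noncomputable def firstSet (B : Finset ι) (D : ℝ≥0∞) (R : ι → ℝ≥0∞) : Finset ι :=
  {j ∈ B | R j ≤ firstTime B D R}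

variable {B : Finset ι} {D : ℝ≥0∞} {R : ι → ℝ≥0∞}

lemma firstTime_le {j : ι} (hj : j ∈ B) (D : ℝ≥0∞) (R : ι → ℝ≥0∞) : firstTime B D R ≤ R j :=
  inf_le_right.trans (Finset.inf_le hj)

lemma firstSet_subset : firstSet B D R ⊆ B := Finset.filter_subset _ _

lemma eq_firstTime_of_mem {j : ι} (hj : j ∈ firstSet B D R) : R j = firstTime B D R :=
  le_antisymm (Finset.mem_filter.1 hj).2 (firstTime_le (firstSet_subset hj) D R)

lemma firstSet_eq_empty_iff : firstSet B D R = ∅ ↔ ∀ j ∈ B, D < R j := by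
  constructor
  · intro h j hj
    by_contra! hle
    obtain ⟨i, hi, he⟩ := Finset.exists_mem_eq_inf B ⟨j, hj⟩ R
    have hmem : i ∈ firstSet B D R :=
      Finset.mem_filter.2 ⟨hi, le_inf ((he.ge.trans (Finset.inf_le hj)).trans hle) he.ge⟩
    simp [h] at hmem
  · exact fun h => Finset.filter_eq_empty_iff.2 fun j hj hle =>
      (hle.trans inf_le_left).not_gt (h j hj)

lemma firstTime_of_empty (h : firstSet B D R = ∅) : firstTime B D R = D :=
  inf_eq_left.2 (Finset.le_inf fun j hj => (firstSet_eq_empty_iff.1 h j hj).le)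

lemma firstTime_of_singleton {i : ι} (h : firstSet B D R = {i}) : firstTime B D R = R i :=
  (eq_firstTime_of_mem (h ▸ Finset.mem_singleton_self i)).symm

lemma firstSet_eq_singleton_iff [DecidableEq ι] {i : ι} :
    firstSet B D R = {i} ↔ (i ∈ B ∧ R i ≤ D) ∧ ∀ j ∈ B.erase i, R i < R j := by
  constructor
  · intro h
    have hi : i ∈ firstSet B D R := h ▸ Finset.mem_singleton_self i
    have hT := firstTime_of_singleton h
    refine ⟨⟨firstSet_subset hi, hT.ge.trans inf_le_left⟩, fun j hj => ?_⟩
    obtain ⟨hji, hj⟩ := Finset.mem_erase.1 hj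
    by_contra! hle
    have hmem : j ∈ firstSet B D R := Finset.mem_filter.2 ⟨hj, hle.trans hT.ge⟩
    exact hji (Finset.mem_singleton.1 (h ▸ hmem))
  · rintro ⟨⟨hi, hD⟩, hlt⟩
    have hmin : ∀ j ∈ B, j ≠ i → R i < R j := fun j hj hji =>
      hlt j (Finset.mem_erase.2 ⟨hji, hj⟩)
    have hT : firstTime B D R = R i :=
      le_antisymm (firstTime_le hi D R) (le_inf hD (Finset.le_inf fun j hj => by
        obtain rfl | hji := eq_or_ne j i
        exacts [le_rfl, (hmin j hj hji).le]))
    ext j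
    rw [firstSet, Finset.mem_filter, Finset.mem_singleton, hT]
    refine ⟨fun ⟨hj, hle⟩ => ?_, fun hji => hji.symm ▸ ⟨hi, le_rfl⟩⟩
    by_contra hji
    exact hle.not_gt (hmin j hj hji)

lemma card_firstSet_le_one (hR : Function.Injective R) : (firstSet B D R).card ≤ 1 :=
  Finset.card_le_one.2 fun _ hi _ hj =>
    hR ((eq_firstTime_of_mem hi).trans (eq_firstTime_of_mem hj).symm)

lemma measurable_firstTime (B : Finset ι) :
    Measurable fun p : ℝ≥0∞ × (ι → ℝ≥0∞) => firstTime B p.1 p.2 := by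
  have hinf : Measurable fun R : ι → ℝ≥0∞ => B.inf R := by
    classical
    induction B using Finset.induction_on with
    | empty => simp
    | insert j B _ ih =>
      simp only [Finset.inf_insert]
      exact (measurable_pi_apply j).inf ih
  exact measurable_fst.inf (hinf.comp measurable_snd)

lemma measurable_firstSet [Countable ι] (B : Finset ι) :
    Measurable fun p : ℝ≥0∞ × (ι → ℝ≥0∞) => firstSet B p.1 p.2 := by
  refine measurable_finset_iff.2 fun j => ?_
  simp only [firstSet, Finset.mem_filter]
  exact (MeasurableSet.const _).inter
    (measurableSet_le ((measurable_pi_apply j).comp measurable_snd) (measurable_firstTime B))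

end FirstCompletion

section Residual

variable {ι : Type*} {B : Finset ι} {D : ℝ≥0∞}

lemma measurable_firstCompletion [Countable ι] :
    Measurable fun R : ι → ℝ≥0∞ => (firstSet B D R, firstTime B D R) :=
  ((measurable_firstSet B).comp measurable_prodMk_left).prodMk
    ((measurable_firstTime B).comp measurable_prodMk_left)

lemma measurableSet_firstSet_eq [Countable ι] (S : Finset ι) :
    MeasurableSet {p : (ι → ℝ≥0∞) × (ι → ℝ≥0∞) | firstSet B D p.1 = S} :=
  (measurable_fst.comp (measurable_firstCompletion.comp measurable_fst))
    (measurableSet_singleton S)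

lemma measure_firstSet_eq_zero [Fintype ι] {ρ : Measure ℝ≥0∞} [IsProbabilityMeasure ρ]
    [NullSingletonClass ρ] {S : Finset ι} (hS : 1 < S.card) :
    ((Measure.pi fun _ : ι => ρ).prod (Measure.pi fun _ : ι => ρ))
      {p | firstSet B D p.1 = S} = 0 := by
  have hinj := Measure.quasiMeasurePreserving_fst (ν := Measure.pi fun _ : ι => ρ)
    |>.ae (ae_injective_pi fun _ : ι => ρ)
  refine measure_mono_null (t := {p | ¬ Function.Injective p.1}) ?_ (ae_iff.1 hinj)
  exact fun p (hp : firstSet B D p.1 = S) (hp' : Function.Injective p.1) =>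
    hS.not_ge (hp ▸ card_firstSet_le_one hp')

variable [DecidableEq ι]

/-- The servers and the time of the first completion, together with the residual service times
beyond it: those of `p.1` on the servers in `C`, fresh ones from `p.2` elsewhere. The set `C` may
depend on the servers and the time of the completion, as a policy may choose it in view of them. -/
noncomputable def atFirstCompletion (B : Finset ι) (D : ℝ≥0∞) (C : Finset ι × ℝ≥0∞ → Finset ι)
    (p : (ι → ℝ≥0∞) × (ι → ℝ≥0∞)) : (Finset ι × ℝ≥0∞) × (ι → ℝ≥0∞) :=
  ((firstSet B D p.1, firstTime B D p.1),
    (C (firstSet B D p.1, firstTime B D p.1)).piecewise (fun j => p.1 j - firstTime B D p.1) p.2)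

variable {C : Finset ι × ℝ≥0∞ → Finset ι}

lemma atFirstCompletion_of_eq {p : (ι → ℝ≥0∞) × (ι → ℝ≥0∞)} {S : Finset ι} {T : ℝ≥0∞}
    (hS : firstSet B D p.1 = S) (hT : firstTime B D p.1 = T) :
    atFirstCompletion B D C p = ((S, T), (C (S, T)).piecewise (fun j => p.1 j - T) p.2) := by
  subst hS hT
  rfl

lemma measurable_atFirstCompletion [Countable ι] (hC : Measurable C) :
    Measurable (atFirstCompletion B D C) := by
  have hfirst := (measurable_firstCompletion (B := B) (D := D)).comp
    (measurable_fst : Measurable (Prod.fst : (ι → ℝ≥0∞) × (ι → ℝ≥0∞) → _))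
  exact hfirst.prodMk (measurable_piecewise_sub (hC.comp hfirst) measurable_fst measurable_snd
    (measurable_snd.comp hfirst))

variable [Fintype ι] {ρ : Measure ℝ≥0∞}

lemma map_atFirstCompletion_update_restrict_singleton {i : ι} {r : ℝ≥0∞}
    (hi : i ∈ B) (hr : r ≤ D) (hC : C ({i}, r) ⊆ B.erase i) :
    (((Measure.pi fun _ : ι => ρ).prod (Measure.pi fun _ : ι => ρ)).restrict
        {p | firstSet B D (Function.update p.1 i r) = {i}}).map
          (fun p => atFirstCompletion B D C (Function.update p.1 i r, p.2)) =
      ((((Measure.pi fun _ : ι => ρ).prod (Measure.pi fun _ : ι => ρ)).restrict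
        ({R | ∀ j ∈ B.erase i, r < R j} ×ˢ Set.univ)).map
          fun p => (C ({i}, r)).piecewise (fun j => p.1 j - r) p.2).map
        (Prod.mk (({i} : Finset ι), r)) := by
  have hset : {p : (ι → ℝ≥0∞) × (ι → ℝ≥0∞) | firstSet B D (Function.update p.1 i r) = {i}} =
      {R | ∀ j ∈ B.erase i, r < R j} ×ˢ Set.univ := by
    ext p
    simp only [Set.mem_ofPred_eq, firstSet_eq_singleton_iff, hi, Function.update_self, hr,
      true_and, Set.mem_prod, Set.mem_univ, and_true]
    exact forall₂_congr fun j hj => by rw [Function.update_of_ne (Finset.ne_of_mem_erase hj)]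
  rw [Measure.map_map measurable_prodMk_left (measurable_piecewise_sub measurable_const
    measurable_fst measurable_snd measurable_const), hset]
  refine Measure.map_congr (ae_restrict_of_forall_mem
    ((measurableSet_forall_lt _ r).prod MeasurableSet.univ) fun p hp => ?_)
  rw [← hset] at hp
  have hS : firstSet B D (Function.update p.1 i r) = {i} := hp
  have hT : firstTime B D (Function.update p.1 i r) = r := by
    rw [firstTime_of_singleton hS, Function.update_self]
  refine (atFirstCompletion_of_eq hS hT).trans (congrArg (Prod.mk ({i}, r))
    (Finset.piecewise_congr _ (fun j hj => ?_) fun j _ => rfl))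
  exact congrArg (· - r) (Function.update_of_ne (Finset.ne_of_mem_erase (hC hj)) r p.1)

variable [IsProbabilityMeasure ρ]

lemma Memoryless.map_atFirstCompletion_restrict_empty (h : Memoryless ρ) (hC : ∀ q, C q ⊆ B) :
    (((Measure.pi fun _ : ι => ρ).prod (Measure.pi fun _ : ι => ρ)).restrict
        {p | firstSet B D p.1 = ∅}).map (atFirstCompletion B D C) =
      (((Measure.pi fun _ : ι => ρ).prod (Measure.pi fun _ : ι => ρ)).restrict
        {p | firstSet B D p.1 = ∅}).map (atFirstCompletion B D fun _ => ∅) := by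
  have hfactor (C' : Finset ι × ℝ≥0∞ → Finset ι) :
      (((Measure.pi fun _ : ι => ρ).prod (Measure.pi fun _ : ι => ρ)).restrict
        {p | firstSet B D p.1 = ∅}).map (atFirstCompletion B D C') =
      ((((Measure.pi fun _ : ι => ρ).prod (Measure.pi fun _ : ι => ρ)).restrict
        ({R | ∀ j ∈ B, D < R j} ×ˢ Set.univ)).map
          fun p => (C' (∅, D)).piecewise (fun j => p.1 j - D) p.2).map
        (Prod.mk ((∅ : Finset ι), D)) := by
    have hset : {p : (ι → ℝ≥0∞) × (ι → ℝ≥0∞) | firstSet B D p.1 = ∅} =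
        {R | ∀ j ∈ B, D < R j} ×ˢ Set.univ := by
      ext p
      simp [firstSet_eq_empty_iff]
    rw [Measure.map_map measurable_prodMk_left (measurable_piecewise_sub measurable_const
      measurable_fst measurable_snd measurable_const), ← hset]
    refine Measure.map_congr (ae_restrict_of_forall_mem (measurableSet_firstSet_eq ∅) ?_)
    exact fun p (hp : firstSet B D p.1 = ∅) => atFirstCompletion_of_eq hp (firstTime_of_empty hp)
  rw [hfactor, hfactor, h.map_piecewise_sub_restrict (hC _),
    h.map_piecewise_sub_restrict (Finset.empty_subset B)]

-- Conditioning on the time `r` of a completion by `i` alone leaves the event that all other busy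
-- servers have a residual exceeding `r`, to which `Memoryless.map_piecewise_sub_restrict` applies.
lemma Memoryless.map_atFirstCompletion_restrict_singleton (h : Memoryless ρ) (i : ι)
    (hC : ∀ q, C q ⊆ B \ q.1) (hCm : Measurable C) :
    (((Measure.pi fun _ : ι => ρ).prod (Measure.pi fun _ : ι => ρ)).restrict
        {p | firstSet B D p.1 = {i}}).map (atFirstCompletion B D C) =
      (((Measure.pi fun _ : ι => ρ).prod (Measure.pi fun _ : ι => ρ)).restrict
        {p | firstSet B D p.1 = {i}}).map (atFirstCompletion B D fun _ => ∅) := by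
  set κ : Measure (ι → ℝ≥0∞) := Measure.pi fun _ : ι => ρ with hκ
  have hup : MeasurePreserving (fun q : ℝ≥0∞ × (ι → ℝ≥0∞) × (ι → ℝ≥0∞) =>
      (Function.update q.2.1 i q.1, q.2.2)) (ρ.prod (κ.prod κ)) (κ.prod κ) :=
    ((measurePreserving_update_pi (fun _ : ι => ρ) i).prod (MeasurePreserving.id κ)).comp
      ((measurePreserving_prodAssoc ρ κ κ).symm MeasurableEquiv.prodAssoc)
  have hset := measurableSet_firstSet_eq (B := B) (D := D) {i}
  have hFm := measurable_atFirstCompletion (B := B) (D := D) hCm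
  have hGm := measurable_atFirstCompletion (B := B) (D := D) (C := fun _ => ∅) measurable_const
  have hres := hup.restrict_preimage hset
  rw [← hres.map_eq, Measure.map_map hFm hup.measurable, Measure.map_map hGm hup.measurable]
  refine map_restrict_prod_congr (hFm.comp hup.measurable) (hGm.comp hup.measurable)
    (hup.measurable hset) fun r => ?_
  change ((κ.prod κ).restrict {p | firstSet B D (Function.update p.1 i r) = {i}}).map
      (fun p => atFirstCompletion B D C (Function.update p.1 i r, p.2)) =
    ((κ.prod κ).restrict {p | firstSet B D (Function.update p.1 i r) = {i}}).map
      (fun p => atFirstCompletion B D (fun _ => ∅) (Function.update p.1 i r, p.2))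
  by_cases hir : i ∈ B ∧ r ≤ D
  · have hCi : C ({i}, r) ⊆ B.erase i := Finset.sdiff_singleton_eq_erase i B ▸ hC ({i}, r)
    rw [hκ, map_atFirstCompletion_update_restrict_singleton hir.1 hir.2 hCi,
      map_atFirstCompletion_update_restrict_singleton hir.1 hir.2 (Finset.empty_subset _),
      h.map_piecewise_sub_restrict hCi, h.map_piecewise_sub_restrict (Finset.empty_subset _)]
  · have hempty : {p : (ι → ℝ≥0∞) × (ι → ℝ≥0∞) |
        firstSet B D (Function.update p.1 i r) = {i}} = ∅ := by
      refine Set.eq_empty_iff_forall_notMem.2 fun p hp => hir ?_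
      have hp' : firstSet B D (Function.update p.1 i r) = {i} := hp
      simpa using (firstSet_eq_singleton_iff.1 hp').1
    simp [hempty]

theorem Memoryless.map_atFirstCompletion [NullSingletonClass ρ] (h : Memoryless ρ)
    (hC : ∀ q, C q ⊆ B \ q.1) (hCm : Measurable C) :
    ((Measure.pi fun _ : ι => ρ).prod (Measure.pi fun _ : ι => ρ)).map
        (atFirstCompletion B D C) =
      ((Measure.pi fun _ : ι => ρ).prod (Measure.pi fun _ : ι => ρ)).map
        (atFirstCompletion B D fun _ => ∅) := by
  let A (S : Finset ι) : Set ((Finset ι × ℝ≥0∞) × (ι → ℝ≥0∞)) := {q | q.1.1 = S}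
  have hA (S : Finset ι) : MeasurableSet (A S) :=
    (measurable_fst.comp measurable_fst) (measurableSet_singleton S)
  have hcover : ⋃ S, A S = Set.univ := by
    ext q
    simp [A]
  refine (Measure.ext_iff_of_iUnion_eq_univ hcover).2 fun S => ?_
  rw [Measure.restrict_map (measurable_atFirstCompletion hCm) (hA S),
    Measure.restrict_map (measurable_atFirstCompletion measurable_const) (hA S)]
  change (Measure.restrict _ {p : (ι → ℝ≥0∞) × (ι → ℝ≥0∞) | firstSet B D p.1 = S}).map _ =
    (Measure.restrict _ {p : (ι → ℝ≥0∞) × (ι → ℝ≥0∞) | firstSet B D p.1 = S}).map _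
  rcases Nat.lt_trichotomy S.card 1 with hS | hS | hS
  · obtain rfl := Finset.card_eq_zero.1 (Nat.lt_one_iff.1 hS)
    exact h.map_atFirstCompletion_restrict_empty fun q => (hC q).trans Finset.sdiff_subset
  · obtain ⟨i, rfl⟩ := Finset.card_eq_one.1 hS
    exact h.map_atFirstCompletion_restrict_singleton i hC hCm
  · rw [Measure.restrict_eq_zero.2 (measure_firstSet_eq_zero hS), Measure.map_zero,
      Measure.map_zero]

end Residual

section ContinuedWork

variable {ι : Type*} [DecidableEq ι] {B : Finset ι} {D : ℝ≥0∞} {R : ι → ℝ≥0∞} {z : ℝ≥0∞}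

/-- The total work done by the servers in `B` until the first completion; if time `D` comes first,
the amount `z` of work is added. -/
noncomputable def continuedWork (B : Finset ι) (D : ℝ≥0∞) (R : ι → ℝ≥0∞) (z : ℝ≥0∞) : ℝ≥0∞ :=
  B.card * firstTime B D R + if firstSet B D R = ∅ then z else 0

lemma continuedWork_of_empty (h : firstSet B D R = ∅) :
    continuedWork B D R z = B.card * D + z := by
  rw [continuedWork, firstTime_of_empty h, if_pos h]

lemma continuedWork_of_ne_empty (h : firstSet B D R ≠ ∅) :
    continuedWork B D R z = B.card * firstTime B D R := by
  rw [continuedWork, if_neg h, add_zero]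

lemma measurable_continuedWork [Countable ι] (B : Finset ι) :
    Measurable fun p : ℝ≥0∞ × (ι → ℝ≥0∞) × ℝ≥0∞ => continuedWork B p.1 p.2.1 p.2.2 := by
  have hp : Measurable fun p : ℝ≥0∞ × (ι → ℝ≥0∞) × ℝ≥0∞ => (p.1, p.2.1) :=
    measurable_fst.prodMk (measurable_fst.comp measurable_snd)
  exact (((measurable_firstTime B).comp hp).const_mul _).add (Measurable.ite
    (((measurable_firstSet B).comp hp) (measurableSet_singleton ∅))
    (measurable_snd.comp measurable_snd) measurable_const)

lemma lt_continuedWork_iff_of_lt {c : ℝ≥0∞} (hc : c < B.card * D) :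
    c < continuedWork B D R z ↔ ∀ j ∈ B, c / B.card < R j := by
  have hb0 : (B.card : ℝ≥0∞) ≠ 0 := fun h => by simp [h] at hc
  have hdiv (d : ℝ≥0∞) : c / B.card < d ↔ c < B.card * d := by
    rw [ENNReal.div_lt_iff (Or.inl hb0) (Or.inl (ENNReal.natCast_ne_top _)), mul_comm]
  by_cases hS : firstSet B D R = ∅
  · rw [continuedWork_of_empty hS]
    exact iff_of_true (hc.trans_le le_self_add) fun j hj =>
      ((hdiv D).2 hc).trans (firstSet_eq_empty_iff.1 hS j hj)
  · rw [continuedWork_of_ne_empty hS, ← hdiv]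
    refine ⟨fun h j hj => h.trans_le (firstTime_le hj D R), fun h => ?_⟩
    obtain ⟨j, hj⟩ := Finset.nonempty_iff_ne_empty.2 hS
    exact eq_firstTime_of_mem hj ▸ h j (firstSet_subset hj)

lemma lt_continuedWork_iff_of_le {c : ℝ≥0∞} (hc : B.card * D ≤ c) :
    c < continuedWork B D R z ↔ (∀ j ∈ B, D < R j) ∧ c - B.card * D < z := by
  rw [← firstSet_eq_empty_iff]
  by_cases hS : firstSet B D R = ∅
  · rw [continuedWork_of_empty hS]
    simp only [hS, true_and]
    obtain rfl | ⟨j, hj⟩ := B.eq_empty_or_nonempty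
    · simp
    · have hD : D ≠ ⊤ := (firstSet_eq_empty_iff.1 hS j hj).ne_top
      exact (ENNReal.sub_lt_iff_lt_left
        (ENNReal.mul_ne_top (ENNReal.natCast_ne_top _) hD) hc).symm
  · rw [continuedWork_of_ne_empty hS]
    simp only [hS, false_and, iff_false, not_lt]
    exact (mul_le_mul_right inf_le_left _).trans hc

theorem Memoryless.measurePreserving_continuedWork [Fintype ι] {ρ : Measure ℝ≥0∞}
    [IsProbabilityMeasure ρ] [NullSingletonClass ρ] (h : Memoryless ρ) (B : Finset ι)
    (D : ℝ≥0∞) :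
    MeasurePreserving (fun p : (ι → ℝ≥0∞) × ℝ≥0∞ => continuedWork B D p.1 p.2)
      ((Measure.pi fun _ : ι => ρ).prod ρ) ρ := by
  have hm : Measurable fun p : (ι → ℝ≥0∞) × ℝ≥0∞ => continuedWork B D p.1 p.2 :=
    (measurable_continuedWork B).comp measurable_prodMk_left
  refine ⟨hm, measure_ext_of_Ioi ?_ fun c => ?_⟩
  · rw [Measure.map_apply hm MeasurableSet.univ]
    simp
  rw [Measure.map_apply hm measurableSet_Ioi]
  obtain hc | hc := lt_or_ge c (B.card * D)
  · have hpre : (fun p : (ι → ℝ≥0∞) × ℝ≥0∞ => continuedWork B D p.1 p.2) ⁻¹' Set.Ioi c =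
        {R | ∀ j ∈ B, c / B.card < R j} ×ˢ Set.univ := by
      ext p
      simp [lt_continuedWork_iff_of_lt hc]
    have hb0 : (B.card : ℝ≥0∞) ≠ 0 := fun h => by simp [h] at hc
    rw [hpre, Measure.prod_prod, measure_univ, mul_one, h.measure_forall_lt,
      ENNReal.mul_div_cancel hb0 (ENNReal.natCast_ne_top _)]
  · have hpre : (fun p : (ι → ℝ≥0∞) × ℝ≥0∞ => continuedWork B D p.1 p.2) ⁻¹' Set.Ioi c =
        {R | ∀ j ∈ B, D < R j} ×ˢ Set.Ioi (c - B.card * D) := by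
      ext p
      simp [lt_continuedWork_iff_of_le hc]
    rw [hpre, Measure.prod_prod, h.measure_forall_lt, ← h, add_tsub_cancel_of_le hc]

end ContinuedWork

section Epochs

variable {m : ℕ} {I : Input}

lemma Input.le_nextArrival (I : Input) (T : ℝ≥0∞) : T ≤ I.nextArrival T := by
  refine le_sInf ?_
  rintro t ⟨i, -, -, h⟩
  exact h.le

lemma Input.nextArrival_mono (I : Input) : Monotone I.nextArrival := by
  intro T T' h
  refine sInf_le_sInf ?_
  rintro t ⟨i, hi, ht, hT⟩
  exact ⟨i, hi, ht, h.trans_lt hT⟩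

lemma Input.measurable_nextArrival (I : Input) : Measurable I.nextArrival :=
  I.nextArrival_mono.measurable

variable {Ξ : Type*} [MeasurableSpace Ξ] {k : ℕ}

/-- The servers that are busy after the decision taken on the seed and history `p`. -/
noncomputable def Policy.busy (π : Policy I m Ξ) (p : Ξ × Hist m k) : Finset (Fin m) :=
  {j | p.2.now.time ≠ ⊤ ∧ π.assign k p.1 p.2 j ≠ none}

/-- The servers that continue an ongoing service after the decision taken on the seed and
history `p`. -/
noncomputable def Policy.continuing (π : Policy I m Ξ) (p : Ξ × Hist m k) : Finset (Fin m) :=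
  {j | p.2.now.time ≠ ⊤ ∧ π.assign k p.1 p.2 j ≠ none ∧
    π.assign k p.1 p.2 j = p.2.now.serving j}

/-- The time from the current to the next epoch if there is no service completion in between. -/
noncomputable def Policy.horizon (π : Policy I m Ξ) (p : Ξ × Hist m k) : ℝ≥0∞ :=
  min (I.nextArrival p.2.now.time - p.2.now.time) (π.review k p.1 p.2)

/-- The seed and the history at the next epoch, if that occurs after time `q.2` with service
completions of the servers in `q.1`. -/
def Policy.extend (π : Policy I m Ξ) (p : Ξ × Hist m k) (q : Finset (Fin m) × ℝ≥0∞) :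
    Ξ × Hist m (k + 1) :=
  (p.1, Fin.snoc p.2 (p.2.now.time + q.2, fun j => if j ∈ q.1 then π.assign k p.1 p.2 j else none,
    fun j => if j ∈ q.1 then none else π.assign k p.1 p.2 j))

/-- What the policy can base the decision of epoch `k` on: its seed and the history. -/
noncomputable def Policy.visible (π : Policy I m Ξ) (w : Outcome m Ξ) (k : ℕ) : Ξ × Hist m k :=
  (w.1, (π.run w k).hist)

/-- The service times of the services that may start at epoch `k`. -/
noncomputable def service {Ξ : Type*} (w : Outcome m Ξ) (k : ℕ) (j : Fin m) : ℝ≥0∞ :=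
  ENNReal.ofReal (w.2 k j)

/-- The residual service times after the decision of epoch `k`, completed by the fresh service times
of the servers that do not continue an ongoing service. -/
noncomputable def Policy.residual (π : Policy I m Ξ) (w : Outcome m Ξ) (k : ℕ) (j : Fin m) :
    ℝ≥0∞ :=
  if j ∈ π.continuing (π.visible w k) then (π.run w k).finish j - (π.run w k).hist.now.time
  else service w k j

/-- The time between epochs `k` and `k + 1`. -/
noncomputable def Policy.gap (π : Policy I m Ξ) (w : Outcome m Ξ) (k : ℕ) : ℝ≥0∞ :=
  firstTime (π.busy (π.visible w k)) (π.horizon (π.visible w k)) (π.residual w k)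

/-- The servers that complete a service at epoch `k + 1`. -/
noncomputable def Policy.completing (π : Policy I m Ξ) (w : Outcome m Ξ) (k : ℕ) :
    Finset (Fin m) :=
  firstSet (π.busy (π.visible w k)) (π.horizon (π.visible w k)) (π.residual w k)

variable {π : Policy I m Ξ} {w : Outcome m Ξ} {p : Ξ × Hist m k} {j : Fin m}

lemma Policy.mem_busy : j ∈ π.busy p ↔ p.2.now.time ≠ ⊤ ∧ π.assign k p.1 p.2 j ≠ none := by
  simp [Policy.busy]

lemma Policy.mem_continuing :
    j ∈ π.continuing p ↔ p.2.now.time ≠ ⊤ ∧ π.assign k p.1 p.2 j ≠ none ∧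
      π.assign k p.1 p.2 j = p.2.now.serving j := by
  simp [Policy.continuing]

lemma Policy.busy_of_time_eq_top (ht : p.2.now.time = ⊤) : π.busy p = ∅ := by
  ext j
  simp [Policy.mem_busy, ht]

lemma Policy.now_extend {q : Finset (Fin m) × ℝ≥0∞} :
    (π.extend p q).2.now =
      (p.2.now.time + q.2, fun j => if j ∈ q.1 then π.assign k p.1 p.2 j else none,
        fun j => if j ∈ q.1 then none else π.assign k p.1 p.2 j) := by
  simp [Policy.extend, Hist.now]

lemma Policy.continuing_extend_subset (π : Policy I m Ξ) (p : Ξ × Hist m k)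
    (q : Finset (Fin m) × ℝ≥0∞) : π.continuing (π.extend p q) ⊆ π.busy p \ q.1 := by
  intro j hj
  rw [Policy.mem_continuing, Policy.now_extend] at hj
  obtain ⟨ht, ha, hs⟩ := hj
  simp only [Obs.time, Obs.serving] at ht hs
  rw [Finset.mem_sdiff, Policy.mem_busy]
  by_cases hq : j ∈ q.1
  · rw [if_pos hq] at hs
    exact absurd hs ha
  · rw [if_neg hq] at hs
    exact ⟨⟨(ENNReal.add_ne_top.1 ht).1, hs ▸ ha⟩, hq⟩

lemma Policy.time_le_finish (π : Policy I m Ξ) (w : Outcome m Ξ) (k : ℕ) (j : Fin m) :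
    (π.run w k).hist.now.time ≤ (π.run w k).finish j := by
  cases k with
  | zero => simp [Policy.run]
  | succ k =>
    simp only [Policy.run, Hist.now, Fin.snoc_last, Obs.time]
    exact (min_le_right _ _).trans ((min_le_right _ _).trans (iInf_le _ j))

lemma Policy.time_le_newFinish (π : Policy I m Ξ) (w : Outcome m Ξ) (k : ℕ) (j : Fin m) :
    (π.run w k).hist.now.time ≤ π.newFinish w.1 (w.2 k) (π.run w k) j := by
  rw [Policy.newFinish]
  split_ifs
  · exact le_top
  · exact π.time_le_finish w k j
  · exact le_self_add

lemma Policy.time_succ_eq_nextTime (π : Policy I m Ξ) (w : Outcome m Ξ) (k : ℕ) :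
    (π.run w (k + 1)).hist.now.time = π.nextTime w.1 (w.2 k) (π.run w k) := by
  simp [Policy.run, Hist.now, Obs.time]

lemma Policy.time_le_time_succ (π : Policy I m Ξ) (w : Outcome m Ξ) (k : ℕ) :
    (π.run w k).hist.now.time ≤ (π.run w (k + 1)).hist.now.time := by
  rw [π.time_succ_eq_nextTime]
  exact le_min (I.le_nextArrival _) (le_min le_self_add (le_iInf (π.time_le_newFinish w k)))

lemma Policy.finish_ne_top (k : ℕ) (j : Fin m) (ht : (π.run w k).hist.now.time ≠ ⊤)
    (hs : (π.run w k).hist.now.serving j ≠ none) : (π.run w k).finish j ≠ ⊤ := by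
  induction k with
  | zero => simp [Policy.run, Hist.now, Obs.serving] at hs
  | succ k ih =>
    have ht' : (π.run w k).hist.now.time ≠ ⊤ := ne_top_of_le_ne_top ht (π.time_le_time_succ w k)
    have ha : π.assign k w.1 (π.run w k).hist j ≠ none := fun h => hs <| by
      simp [Policy.run, Hist.now, Obs.serving, Policy.nextServing, h]
    simp only [Policy.run, Policy.newFinish, ha, if_false]
    split_ifs with h
    · exact ih ht' (h ▸ ha)
    · exact ENNReal.add_ne_top.2 ⟨ht', ENNReal.ofReal_ne_top⟩

lemma Policy.residual_ne_top (π : Policy I m Ξ) (w : Outcome m Ξ) (k : ℕ) (j : Fin m) :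
    π.residual w k j ≠ ⊤ := by
  rw [Policy.residual]
  split_ifs with h
  · obtain ⟨ht, ha, hs⟩ := Policy.mem_continuing.1 h
    exact ENNReal.sub_ne_top (Policy.finish_ne_top k j ht (hs ▸ ha))
  · exact ENNReal.ofReal_ne_top

lemma Policy.newFinish_eq (ht : (π.run w k).hist.now.time ≠ ⊤) (j : Fin m) :
    π.newFinish w.1 (w.2 k) (π.run w k) j =
      if j ∈ π.busy (π.visible w k) then (π.run w k).hist.now.time + π.residual w k j else ⊤ := by
  rw [Policy.newFinish, Policy.residual]
  by_cases ha : π.assign k w.1 (π.run w k).hist j = none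
  · rw [if_pos ha, if_neg fun h => (Policy.mem_busy.1 h).2 ha]
  · rw [if_neg ha, if_pos (Policy.mem_busy.2 ⟨ht, ha⟩)]
    by_cases hs : π.assign k w.1 (π.run w k).hist j = (π.run w k).hist.now.serving j
    · rw [if_pos hs, if_pos (Policy.mem_continuing.2 ⟨ht, ha, hs⟩),
        add_tsub_cancel_of_le (π.time_le_finish w k j)]
    · rw [if_neg hs, if_neg fun h => hs (Policy.mem_continuing.1 h).2.2]
      rfl

lemma Policy.iInf_newFinish (ht : (π.run w k).hist.now.time ≠ ⊤) :
    ⨅ j, π.newFinish w.1 (w.2 k) (π.run w k) j =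
      (π.run w k).hist.now.time + (π.busy (π.visible w k)).inf (π.residual w k) := by
  set T := (π.run w k).hist.now.time
  have hinf : T + (π.busy (π.visible w k)).inf (π.residual w k) =
      (π.busy (π.visible w k)).inf fun j => T + π.residual w k j :=
    Finset.apply_inf_eq_inf_comp (T + ·) (fun a b => (min_add_add_left T a b).symm) (by simp)
  rw [hinf]
  refine le_antisymm (Finset.le_inf fun j hj => ?_) (le_iInf fun j => ?_)
  · exact (iInf_le _ j).trans_eq (by rw [Policy.newFinish_eq ht, if_pos hj])
  · rw [Policy.newFinish_eq ht]
    split_ifs with hj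
    · exact Finset.inf_le hj
    · exact le_top

lemma Policy.nextTime_eq (π : Policy I m Ξ) (w : Outcome m Ξ) (k : ℕ) :
    π.nextTime w.1 (w.2 k) (π.run w k) = (π.run w k).hist.now.time + π.gap w k := by
  by_cases ht : (π.run w k).hist.now.time = ⊤
  · have hle := π.time_le_time_succ w k
    rw [π.time_succ_eq_nextTime, ht, top_le_iff] at hle
    rw [hle, ht, top_add]
  set T := (π.run w k).hist.now.time
  rw [Policy.nextTime, Policy.iInf_newFinish ht, Policy.gap, firstTime, Policy.horizon, ← min_assoc]
  change _ = T + min (min (I.nextArrival T - T) _) _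
  rw [← min_add_add_left, ← min_add_add_left, add_tsub_cancel_of_le (I.le_nextArrival T)]
  rfl

lemma Policy.time_succ (π : Policy I m Ξ) (w : Outcome m Ξ) (k : ℕ) :
    (π.run w (k + 1)).hist.now.time = (π.run w k).hist.now.time + π.gap w k := by
  rw [π.time_succ_eq_nextTime, π.nextTime_eq]

lemma Policy.newFinish_le_nextTime_iff (π : Policy I m Ξ) (w : Outcome m Ξ) (k : ℕ)
    (j : Fin m) :
    (π.newFinish w.1 (w.2 k) (π.run w k) j ≤ π.nextTime w.1 (w.2 k) (π.run w k) ∧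
      π.nextTime w.1 (w.2 k) (π.run w k) ≠ ⊤) ↔ j ∈ π.completing w k := by
  by_cases ht : (π.run w k).hist.now.time = ⊤
  · have hB : π.busy (π.visible w k) = ∅ := Policy.busy_of_time_eq_top ht
    simp [π.nextTime_eq, ht, Policy.completing, hB, firstSet]
  rw [Policy.newFinish_eq ht, π.nextTime_eq, Policy.completing, firstSet, Finset.mem_filter]
  by_cases hj : j ∈ π.busy (π.visible w k)
  · rw [if_pos hj, ENNReal.add_le_add_iff_left ht]
    refine ⟨fun h => ⟨hj, h.1⟩, fun ⟨_, h⟩ => ⟨h, ENNReal.add_ne_top.2 ⟨ht, ?_⟩⟩⟩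
    exact ne_top_of_le_ne_top (π.residual_ne_top w k j) (firstTime_le hj _ _)
  · simp only [hj, if_false, false_and, iff_false, not_and, not_not]
    exact top_le_iff.1

lemma Policy.completing_subset_busy (π : Policy I m Ξ) (w : Outcome m Ξ) (k : ℕ) :
    π.completing w k ⊆ π.busy (π.visible w k) := firstSet_subset

theorem Policy.visible_succ (π : Policy I m Ξ) (w : Outcome m Ξ) (k : ℕ) :
    π.visible w (k + 1) = π.extend (π.visible w k) (π.completing w k, π.gap w k) := by
  have hd (j : Fin m) : π.nextDelivered w.1 (w.2 k) (π.run w k) j =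
      if j ∈ π.completing w k then π.assign k w.1 (π.run w k).hist j else none :=
    if_congr (π.newFinish_le_nextTime_iff w k j) rfl rfl
  have hs (j : Fin m) : π.nextServing w.1 (w.2 k) (π.run w k) j =
      if j ∈ π.completing w k then none else π.assign k w.1 (π.run w k).hist j := by
    rw [Policy.nextServing, hd]
    by_cases hj : j ∈ π.completing w k
    · have ha : π.assign k w.1 (π.run w k).hist j ≠ none :=
        (Policy.mem_busy.1 (π.completing_subset_busy w k hj)).2
      simp [hj, ha]
    · simp [hj]
  rw [Policy.visible, Policy.run, π.nextTime_eq w k, funext hd, funext hs]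
  rfl

lemma Policy.delivered_succ (π : Policy I m Ξ) (w : Outcome m Ξ) (k : ℕ) (j : Fin m) :
    (π.run w (k + 1)).hist.now.delivered j =
      if j ∈ π.completing w k then π.assign k w.1 (π.run w k).hist j else none := by
  change (π.visible w (k + 1)).2.now.delivered j = _
  rw [π.visible_succ, Policy.now_extend]
  rfl

lemma Policy.serving_succ (π : Policy I m Ξ) (w : Outcome m Ξ) (k : ℕ) (j : Fin m) :
    (π.run w (k + 1)).hist.now.serving j =
      if j ∈ π.completing w k then none else π.assign k w.1 (π.run w k).hist j := by
  change (π.visible w (k + 1)).2.now.serving j = _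
  rw [π.visible_succ, Policy.now_extend]
  rfl

lemma Policy.residual_zero (π : Policy I m Ξ) (w : Outcome m Ξ) :
    π.residual w 0 = service w 0 := by
  funext j
  refine if_neg fun h => ?_
  obtain ⟨-, ha, hs⟩ := Policy.mem_continuing.1 h
  exact ha hs

theorem Policy.residual_succ (π : Policy I m Ξ) (w : Outcome m Ξ) (k : ℕ) :
    π.residual w (k + 1) =
      (π.continuing (π.visible w (k + 1))).piecewise
        (fun j => π.residual w k j - π.gap w k) (service w (k + 1)) := by
  refine (Finset.piecewise_congr _ (fun j hj => ?_) fun _ _ => rfl)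
  have hb : j ∈ π.busy (π.visible w k) := by
    rw [π.visible_succ] at hj
    exact (Finset.mem_sdiff.1 (π.continuing_extend_subset _ _ hj)).1
  have ht : (π.run w k).hist.now.time ≠ ⊤ := (Policy.mem_busy.1 hb).1
  have hfinish : (π.run w (k + 1)).finish j = (π.run w k).hist.now.time + π.residual w k j :=
    (Policy.newFinish_eq ht j).trans (if_pos hb)
  rw [π.time_succ, hfinish, ENNReal.add_sub_add_eq_sub_left ht]

end Epochs

section Measurability

variable {m k : ℕ} {I : Input} {Ξ : Type*} [MeasurableSpace Ξ]

instance instDiscreteMeasurableSpaceOptionNat : DiscreteMeasurableSpace (Option ℕ) :=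
  ⟨fun _ => trivial⟩

lemma measurable_now_time : Measurable fun h : Hist m k => h.now.time :=
  measurable_fst.comp (measurable_pi_apply _)

lemma measurable_now_serving (j : Fin m) : Measurable fun h : Hist m k => h.now.serving j :=
  (measurable_pi_apply j).comp ((measurable_snd.comp measurable_snd).comp (measurable_pi_apply _))

lemma measurable_delivered (l : Fin (k + 1)) (j : Fin m) :
    Measurable fun h : Hist m k => (h l).delivered j :=
  (measurable_pi_apply j).comp ((measurable_fst.comp measurable_snd).comp (measurable_pi_apply l))

lemma Policy.measurable_assign_apply (π : Policy I m Ξ) (j : Fin m) :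
    Measurable fun p : Ξ × Hist m k => π.assign k p.1 p.2 j :=
  (measurable_pi_apply j).comp (π.measurable_assign k)

lemma measurableSet_time_ne_top : MeasurableSet {p : Ξ × Hist m k | p.2.now.time ≠ ⊤} :=
  (measurable_now_time.comp measurable_snd) (measurableSet_singleton ⊤).compl

lemma Policy.measurable_busy (π : Policy I m Ξ) :
    Measurable (π.busy : Ξ × Hist m k → Finset (Fin m)) := by
  refine measurable_finset_iff.2 fun j => ?_
  simp only [Policy.mem_busy]
  exact measurableSet_time_ne_top.inter
    (π.measurable_assign_apply j (MeasurableSet.of_discrete (s := {none}ᶜ)))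

lemma Policy.measurable_continuing (π : Policy I m Ξ) :
    Measurable (π.continuing : Ξ × Hist m k → Finset (Fin m)) := by
  refine measurable_finset_iff.2 fun j => ?_
  simp only [Policy.mem_continuing]
  refine measurableSet_time_ne_top.inter (MeasurableSet.inter
    (π.measurable_assign_apply j (MeasurableSet.of_discrete (s := {none}ᶜ))) ?_)
  exact ((π.measurable_assign_apply j).prodMk ((measurable_now_serving j).comp measurable_snd))
    (MeasurableSet.of_discrete (s := {q : Option ℕ × Option ℕ | q.1 = q.2}))

lemma Policy.measurable_horizon (π : Policy I m Ξ) :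
    Measurable (π.horizon : Ξ × Hist m k → ℝ≥0∞) := by
  have ht : Measurable fun p : Ξ × Hist m k => p.2.now.time :=
    measurable_now_time.comp measurable_snd
  exact ((I.measurable_nextArrival.comp ht).sub ht).min (π.measurable_review k)

lemma Policy.measurable_extend (π : Policy I m Ξ) :
    Measurable fun p : (Ξ × Hist m k) × (Finset (Fin m) × ℝ≥0∞) => π.extend p.1 p.2 := by
  refine (measurable_fst.comp measurable_fst).prodMk (measurable_pi_iff.2 fun i => ?_)
  induction i using Fin.lastCases with
  | last =>
    simp only [Fin.snoc_last]
    have hmem (j : Fin m) : MeasurableSet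
        {p : (Ξ × Hist m k) × (Finset (Fin m) × ℝ≥0∞) | j ∈ p.2.1} :=
      measurable_finset_iff.1 (measurable_fst.comp measurable_snd) j
    have hassign (j : Fin m) : Measurable
        fun p : (Ξ × Hist m k) × (Finset (Fin m) × ℝ≥0∞) => π.assign k p.1.1 p.1.2 j :=
      (π.measurable_assign_apply j).comp measurable_fst
    refine Measurable.prodMk ?_ (Measurable.prodMk ?_ ?_)
    · exact (measurable_now_time.comp (measurable_snd.comp measurable_fst)).add
        (measurable_snd.comp measurable_snd)
    · exact measurable_pi_iff.2 fun j => Measurable.ite (hmem j) (hassign j) measurable_const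
    · exact measurable_pi_iff.2 fun j => Measurable.ite (hmem j) measurable_const (hassign j)
  | cast i =>
    simp only [Fin.snoc_castSucc]
    exact (measurable_pi_apply i).comp (measurable_snd.comp measurable_fst)

/-- The servers that complete next and the time until then, as a function of the seed, the history
and the residual service times. -/
noncomputable def Policy.nextCompletion (π : Policy I m Ξ)
    (p : (Ξ × Hist m k) × (Fin m → ℝ≥0∞)) : Finset (Fin m) × ℝ≥0∞ :=
  (firstSet (π.busy p.1) (π.horizon p.1) p.2, firstTime (π.busy p.1) (π.horizon p.1) p.2)

lemma Policy.nextCompletion_visible_residual (π : Policy I m Ξ) (w : Outcome m Ξ) (k : ℕ) :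
    π.nextCompletion (π.visible w k, π.residual w k) = (π.completing w k, π.gap w k) := rfl

lemma Policy.measurable_nextCompletion (π : Policy I m Ξ) :
    Measurable (π.nextCompletion : (Ξ × Hist m k) × (Fin m → ℝ≥0∞) → _) :=
  measurable_comp_countable
    (g := fun B (q : ℝ≥0∞ × (Fin m → ℝ≥0∞)) => (firstSet B q.1 q.2, firstTime B q.1 q.2))
    (fun B => (measurable_firstSet B).prodMk (measurable_firstTime B))
    (π.measurable_busy.comp measurable_fst)
    ((π.measurable_horizon.comp measurable_fst).prodMk measurable_snd)

lemma measurable_service (k : ℕ) : Measurable fun w : Outcome m Ξ => service w k :=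
  measurable_pi_iff.2 fun j => ENNReal.measurable_ofReal.comp
    ((measurable_pi_apply j).comp ((measurable_pi_apply k).comp measurable_snd))

lemma Policy.measurable_visible_residual (π : Policy I m Ξ) (k : ℕ) :
    Measurable fun w : Outcome m Ξ => (π.visible w k, π.residual w k) := by
  induction k with
  | zero =>
    simp only [π.residual_zero]
    exact (measurable_fst.prodMk measurable_const).prodMk (measurable_service 0)
  | succ k ih =>
    have hnext : Measurable fun w : Outcome m Ξ => (π.completing w k, π.gap w k) := by
      simp only [← π.nextCompletion_visible_residual]
      exact π.measurable_nextCompletion.comp ih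
    have hvisible : Measurable fun w : Outcome m Ξ => π.visible w (k + 1) := by
      simp only [π.visible_succ]
      exact π.measurable_extend.comp ((measurable_fst.comp ih).prodMk hnext)
    refine hvisible.prodMk ?_
    simp only [π.residual_succ]
    exact measurable_piecewise_sub (π.measurable_continuing.comp hvisible)
      (measurable_snd.comp ih) (measurable_service (k + 1)) (measurable_snd.comp hnext)

lemma Policy.measurable_visible (π : Policy I m Ξ) (k : ℕ) :
    Measurable fun w : Outcome m Ξ => π.visible w k :=
  measurable_fst.comp (π.measurable_visible_residual k)

lemma Policy.measurable_residual (π : Policy I m Ξ) (k : ℕ) :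
    Measurable fun w : Outcome m Ξ => π.residual w k :=
  measurable_snd.comp (π.measurable_visible_residual k)

end Measurability

section Independence

variable {Ω : Type*} [MeasurableSpace Ω] {P : Measure Ω}

lemma map_prodMk_assoc_eq_iff {α β γ : Type*} [MeasurableSpace α] [MeasurableSpace β]
    [MeasurableSpace γ] {μ : Measure α} {ν : Measure β} {κ : Measure γ} [SFinite μ] [SFinite ν]
    [SFinite κ] {f : Ω → α} {g : Ω → β} {h : Ω → γ} (hf : Measurable f) (hg : Measurable g)
    (hh : Measurable h) :
    P.map (fun ω => ((f ω, g ω), h ω)) = (μ.prod ν).prod κ ↔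
      P.map (fun ω => (f ω, g ω, h ω)) = μ.prod (ν.prod κ) := by
  have hassoc : P.map (fun ω => (f ω, g ω, h ω)) =
      (P.map fun ω => ((f ω, g ω), h ω)).map MeasurableEquiv.prodAssoc := by
    rw [Measure.map_map MeasurableEquiv.prodAssoc.measurable ((hf.prodMk hg).prodMk hh)]
    rfl
  rw [hassoc, ← Measure.prodAssoc_prod]
  exact MeasurableEquiv.prodAssoc.map_measurableEquiv_injective.eq_iff.symm

lemma indepFun_prodMk_of_indepFun [IsProbabilityMeasure P] {α β γ : Type*}
    [MeasurableSpace α] [MeasurableSpace β] [MeasurableSpace γ]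
    {f : Ω → α} {g : Ω → β} {h : Ω → γ} (hf : Measurable f)
    (hg : Measurable g) (hh : Measurable h) (hfgh : IndepFun f (fun ω => (g ω, h ω)) P)
    (hgh : IndepFun g h P) : IndepFun (fun ω => (f ω, g ω)) h P := by
  have hfg : IndepFun f g P := hfgh.comp measurable_id measurable_fst
  rw [indepFun_iff_map_prod_eq_prod_map_map hf.aemeasurable (hg.prodMk hh).aemeasurable] at hfgh
  rw [indepFun_iff_map_prod_eq_prod_map_map hg.aemeasurable hh.aemeasurable] at hgh
  rw [indepFun_iff_map_prod_eq_prod_map_map hf.aemeasurable hg.aemeasurable] at hfg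
  rw [indepFun_iff_map_prod_eq_prod_map_map (hf.prodMk hg).aemeasurable hh.aemeasurable, hfg,
    map_prodMk_assoc_eq_iff hf hg hh, hfgh, hgh]

lemma indepFun_truncate {ι : Type*} [Finite ι] {X : ℕ × ι → Ω → ℝ}
    (hX : ∀ p, Measurable (X p)) (hindep : iIndepFun X P) (k : ℕ) :
    IndepFun (fun ω l => if l < k then fun j => X (l, j) ω else 0) (fun ω j => X (k, j) ω) P := by
  have := Fintype.ofFinite ι
  let S : Finset (ℕ × ι) := Finset.range k ×ˢ Finset.univ
  let T : Finset (ℕ × ι) := {k} ×ˢ Finset.univ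
  have hST : Disjoint S T := Finset.disjoint_product.2 (Or.inl (by simp))
  let f (y : S → ℝ) (l : ℕ) : ι → ℝ :=
    if h : l < k then fun j => y ⟨(l, j), by simpa [S] using h⟩ else 0
  have hf : Measurable f := by
    refine measurable_pi_iff.2 fun l => ?_
    by_cases h : l < k
    · simp only [f, h, dite_true]
      exact measurable_pi_iff.2 fun j => measurable_pi_apply _
    · simp only [f, h, dite_false]
      exact measurable_const
  have hg : Measurable fun (y : T → ℝ) (j : ι) => y ⟨(k, j), by simp [T]⟩ :=
    measurable_pi_iff.2 fun j => measurable_pi_apply _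
  have h := (hindep.indepFun_finset S T hST hX).comp hf hg
  have hpast : (f ∘ fun ω (p : S) => X p ω) =
      fun ω l => if l < k then fun j => X (l, j) ω else 0 := by
    funext ω l
    simp only [f, Function.comp_apply]
    split_ifs <;> rfl
  rwa [hpast] at h

end Independence

section Driven

variable {m k : ℕ} {I : Input} {Ξ : Type*}

/-- The seed and the service times of the services that start before epoch `k` (the others are
replaced by `0`). -/
def past (k : ℕ) (w : Outcome m Ξ) : Outcome m Ξ := (w.1, fun l => if l < k then w.2 l else 0)

variable [MeasurableSpace Ξ]

lemma measurable_past (k : ℕ) : Measurable (past k : Outcome m Ξ → Outcome m Ξ) :=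
  measurable_fst.prodMk (measurable_pi_iff.2 fun l => Measurable.ite (MeasurableSet.const (l < k))
    ((measurable_pi_apply l).comp measurable_snd) measurable_const)

lemma Policy.run_past (π : Policy I m Ξ) (w : Outcome m Ξ) {l : ℕ} (h : l ≤ k) :
    π.run (past k w) l = π.run w l := by
  induction l with
  | zero => rfl
  | succ l ih =>
    have hl : (past k w).2 l = w.2 l := if_pos (Nat.lt_of_succ_le h)
    rw [Policy.run, Policy.run, ih (Nat.le_of_succ_le h), hl, past]

lemma Policy.visible_past (π : Policy I m Ξ) (w : Outcome m Ξ) {l : ℕ} (h : l ≤ k) :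
    π.visible (past k w) l = π.visible w l := by
  rw [Policy.visible, π.run_past w h]
  rfl

lemma Policy.residual_past (π : Policy I m Ξ) (w : Outcome m Ξ) {l : ℕ} (h : l < k) :
    π.residual (past k w) l = π.residual w l := by
  funext j
  have hl : (past k w).2 l = w.2 l := if_pos h
  rw [Policy.residual, Policy.residual, π.visible_past w h.le, π.run_past w h.le, service, hl,
    service]

variable {Ω : Type*} [MeasurableSpace Ω] {P : Measure Ω} {W : Ω → Outcome m Ξ} {ρ : Measure ℝ≥0∞}

/-- The service times started at each epoch are independent with law `ρ` and independent of the
seed and of the service times started before. This is all that is used of the primitive random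
elements. -/
structure IsDriven (P : Measure Ω) (W : Ω → Outcome m Ξ) (ρ : Measure ℝ≥0∞) : Prop where
  measurable : Measurable W
  map_past : ∀ k, P.map (fun ω => (past k (W ω), service (W ω) k)) =
    (P.map fun ω => past k (W ω)).prod (Measure.pi fun _ => ρ)

lemma map_service [IsProbabilityMeasure P] {μ : ℝ} {X : Fin m → Ω → ℝ}
    (hX : ∀ j, Measurable (X j)) (hX_exp : ∀ j, P.map (X j) = expMeasure μ)
    (hindep : iIndepFun X P) :
    P.map (fun ω j => ENNReal.ofReal (X j ω)) = Measure.pi fun _ => serviceLaw μ := by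
  have hlaw (j : Fin m) : P.map (fun ω => ENNReal.ofReal (X j ω)) = serviceLaw μ := by
    rw [serviceLaw, ← hX_exp j, Measure.map_map ENNReal.measurable_ofReal (hX j)]
    rfl
  have hpi := (hindep.comp (fun _ => ENNReal.ofReal) fun _ => ENNReal.measurable_ofReal)
    |>.map_fun_eq_pi_map fun j => (ENNReal.measurable_ofReal.comp (hX j)).aemeasurable
  exact hpi.trans (congrArg Measure.pi (funext hlaw))

theorem isDriven_of_iIndepFun [IsProbabilityMeasure P] {μ : ℝ} {seed : Ω → Ξ}
    (hseed : Measurable seed) {X : ℕ → Fin m → Ω → ℝ} (hX : ∀ k j, Measurable (X k j))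
    (hX_exp : ∀ k j, P.map (X k j) = expMeasure μ)
    (hX_indep : iIndepFun (fun p : ℕ × Fin m => X p.1 p.2) P)
    (hX_seed : IndepFun seed (fun ω k j => X k j ω) P)
    (hW : ∀ ω, W ω = (seed ω, fun k j => X k j ω)) :
    IsDriven P W (serviceLaw μ) := by
  obtain rfl : W = fun ω => (seed ω, fun k j => X k j ω) := funext hW
  have hWm : Measurable fun ω => (seed ω, fun k j => X k j ω) :=
    hseed.prodMk (measurable_pi_iff.2 fun k => measurable_pi_iff.2 fun j => hX k j)
  refine ⟨hWm, fun k => ?_⟩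
  have htrunc : Measurable fun x : ℕ → Fin m → ℝ => (fun l => if l < k then x l else 0) :=
    measurable_pi_iff.2 fun l => Measurable.ite (MeasurableSet.const (l < k))
      (measurable_pi_apply l) measurable_const
  have hofReal : Measurable fun (y : Fin m → ℝ) (j : Fin m) => ENNReal.ofReal (y j) :=
    measurable_pi_iff.2 fun j => ENNReal.measurable_ofReal.comp (measurable_pi_apply j)
  have hpast_indep := (indepFun_truncate (fun p => hX p.1 p.2) hX_indep k).comp
    measurable_id hofReal
  have hindep : IndepFun
      (fun ω => (seed ω, fun l => if l < k then fun j => X l j ω else 0))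
      (fun ω j => ENNReal.ofReal (X k j ω)) P :=
    indepFun_prodMk_of_indepFun hseed (htrunc.comp (measurable_snd.comp hWm))
      ((measurable_service k).comp hWm)
      (hX_seed.comp measurable_id (htrunc.prodMk (hofReal.comp (measurable_pi_apply k))))
      hpast_indep
  have hlaw := map_service (hX k) (hX_exp k)
    (hX_indep.precomp (g := Prod.mk k) (Prod.mk_right_injective k))
  exact ((indepFun_iff_map_prod_eq_prod_map_map ((measurable_past k).comp hWm).aemeasurable
    ((measurable_service k).comp hWm).aemeasurable).1 hindep).trans (congrArg _ hlaw)

lemma IsDriven.map_comp_past [SFinite P] [IsProbabilityMeasure ρ] (hW : IsDriven P W ρ)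
    {β : Type*} [MeasurableSpace β] {f : Outcome m Ξ → β} (hf : Measurable f)
    (hfp : ∀ w, f (past k w) = f w) :
    P.map (fun ω => (f (W ω), service (W ω) k)) =
      (P.map fun ω => f (W ω)).prod (Measure.pi fun _ => ρ) := by
  have hp : Measurable fun ω => past k (W ω) := (measurable_past k).comp hW.measurable
  have hs : Measurable fun ω => service (W ω) k := (measurable_service k).comp hW.measurable
  have h := congrArg (Measure.map (Prod.map f id)) (hW.map_past k)
  rw [Measure.map_map (hf.prodMap measurable_id) (hp.prodMk hs),
    ← Measure.map_prod_map _ _ hf measurable_id, Measure.map_map hf hp, Measure.map_id] at h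
  simpa only [Function.comp_def, Prod.map_apply, hfp, id_eq] using h

end Driven

section Residuals

variable {m k : ℕ} {I : Input} {Ξ : Type*} [MeasurableSpace Ξ]

/-- The seed and the history at the next epoch, together with the residual service times if the
services of the servers in `C` are continued, as a function of the seed and history `q.1`, the
residual service times `q.2.1` and the fresh service times `q.2.2`. -/
noncomputable def Policy.nextState (π : Policy I m Ξ)
    (C : Ξ × Hist m k → Finset (Fin m) × ℝ≥0∞ → Finset (Fin m))
    (q : (Ξ × Hist m k) × (Fin m → ℝ≥0∞) × (Fin m → ℝ≥0∞)) :
    (Ξ × Hist m (k + 1)) × (Fin m → ℝ≥0∞) :=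
  (atFirstCompletion (π.busy q.1) (π.horizon q.1) (C q.1) q.2).map (π.extend q.1) id

lemma Policy.nextState_continuing (π : Policy I m Ξ) (w : Outcome m Ξ) (k : ℕ) :
    π.nextState (fun p q => π.continuing (π.extend p q))
        (π.visible w k, π.residual w k, service w (k + 1)) =
      (π.visible w (k + 1), π.residual w (k + 1)) := by
  rw [π.residual_succ, π.visible_succ]
  rfl

lemma Policy.nextState_empty (π : Policy I m Ξ) (w : Outcome m Ξ) (k : ℕ) :
    π.nextState (fun _ _ => ∅) (π.visible w k, π.residual w k, service w (k + 1)) =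
      (π.visible w (k + 1), service w (k + 1)) := by
  rw [π.visible_succ]
  rfl

lemma Policy.measurable_nextState (π : Policy I m Ξ)
    {C : Ξ × Hist m k → Finset (Fin m) × ℝ≥0∞ → Finset (Fin m)} (hC : Measurable C.uncurry) :
    Measurable (π.nextState C) := by
  have hnext : Measurable fun q : (Ξ × Hist m k) × (Fin m → ℝ≥0∞) × (Fin m → ℝ≥0∞) =>
      π.nextCompletion (q.1, q.2.1) :=
    π.measurable_nextCompletion.comp (measurable_fst.prodMk (measurable_fst.comp measurable_snd))
  exact (π.measurable_extend.comp (measurable_fst.prodMk hnext)).prodMk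
    (measurable_piecewise_sub (hC.comp (measurable_fst.prodMk hnext))
      (measurable_fst.comp measurable_snd) (measurable_snd.comp measurable_snd)
      (measurable_snd.comp hnext))

variable {Ω : Type*} [MeasurableSpace Ω] {P : Measure Ω} [IsProbabilityMeasure P]
  {W : Ω → Outcome m Ξ} {ρ : Measure ℝ≥0∞} [IsProbabilityMeasure ρ] [NullSingletonClass ρ]

lemma Policy.map_nextState (hρ : Memoryless ρ) {μ : Measure (Ξ × Hist m k)} [SFinite μ]
    (π : Policy I m Ξ) :
    (μ.prod ((Measure.pi fun _ => ρ).prod (Measure.pi fun _ => ρ))).map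
        (π.nextState fun p q => π.continuing (π.extend p q)) =
      (μ.prod ((Measure.pi fun _ => ρ).prod (Measure.pi fun _ => ρ))).map
        (π.nextState fun _ _ => ∅) := by
  have hC : Measurable fun p : (Ξ × Hist m k) × (Finset (Fin m) × ℝ≥0∞) =>
      π.continuing (π.extend p.1 p.2) := π.measurable_continuing.comp π.measurable_extend
  refine map_prod_congr (π.measurable_nextState (C := fun p q => π.continuing (π.extend p q)) hC)
    (π.measurable_nextState measurable_const) fun p => ?_
  have hextend : Measurable (π.extend p) :=
    (π.measurable_extend (k := k)).comp (measurable_prodMk_left (x := p))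
  have hCp : Measurable fun q => π.continuing (π.extend p q) := π.measurable_continuing.comp hextend
  have hmap : Measurable (Prod.map (π.extend p) (id : (Fin m → ℝ≥0∞) → Fin m → ℝ≥0∞)) :=
    hextend.prodMap measurable_id
  have h := congrArg (Measure.map (Prod.map (π.extend p) id)) (hρ.map_atFirstCompletion
    (D := π.horizon p) (fun q => π.continuing_extend_subset p q) hCp)
  rwa [Measure.map_map hmap (measurable_atFirstCompletion hCp),
    Measure.map_map hmap (measurable_atFirstCompletion measurable_const)] at h

theorem Policy.map_visible_residual (hρ : Memoryless ρ) (hW : IsDriven P W ρ)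
    (π : Policy I m Ξ) (k : ℕ) :
    P.map (fun ω => (π.visible (W ω) k, π.residual (W ω) k)) =
      (P.map fun ω => π.visible (W ω) k).prod (Measure.pi fun _ => ρ) := by
  induction k with
  | zero =>
    simp only [π.residual_zero]
    exact hW.map_comp_past (π.measurable_visible 0) fun w => π.visible_past w le_rfl
  | succ k ih =>
    have hWm := hW.measurable
    have hstate : Measurable fun ω =>
        (π.visible (W ω) k, π.residual (W ω) k, service (W ω) (k + 1)) :=
      ((π.measurable_visible k).comp hWm).prodMk
        (((π.measurable_residual k).comp hWm).prodMk ((measurable_service (k + 1)).comp hWm))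
    have hlaw : P.map (fun ω => (π.visible (W ω) k, π.residual (W ω) k, service (W ω) (k + 1))) =
        (P.map fun ω => π.visible (W ω) k).prod
          ((Measure.pi fun _ => ρ).prod (Measure.pi fun _ => ρ)) := by
      have h := hW.map_comp_past (k := k + 1) (π.measurable_visible_residual k) fun w => by
        rw [π.visible_past w k.le_succ, π.residual_past w k.lt_succ_self]
      rw [ih] at h
      exact (map_prodMk_assoc_eq_iff ((π.measurable_visible k).comp hWm)
        ((π.measurable_residual k).comp hWm) ((measurable_service (k + 1)).comp hWm)).1 h
    have hC : Measurable fun p : (Ξ × Hist m k) × (Finset (Fin m) × ℝ≥0∞) =>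
        π.continuing (π.extend p.1 p.2) := π.measurable_continuing.comp π.measurable_extend
    calc P.map (fun ω => (π.visible (W ω) (k + 1), π.residual (W ω) (k + 1)))
        = P.map (fun ω => (π.visible (W ω) (k + 1), service (W ω) (k + 1))) := by
          simp only [← π.nextState_continuing, ← π.nextState_empty]
          have h := π.map_nextState hρ (μ := P.map fun ω => π.visible (W ω) k)
          rwa [← hlaw, Measure.map_map (π.measurable_nextState
              (C := fun p q => π.continuing (π.extend p q)) hC) hstate,
            Measure.map_map (π.measurable_nextState measurable_const) hstate] at h
      _ = (P.map fun ω => π.visible (W ω) (k + 1)).prod (Measure.pi fun _ => ρ) :=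
          hW.map_comp_past (π.measurable_visible (k + 1)) fun w => π.visible_past w le_rfl

end Residuals

section Record

variable {m k : ℕ} {I : Input} {Ξ : Type*} [MeasurableSpace Ξ]

/-- The history before the current epoch. -/
def Hist.prev (h : Hist m (k + 1)) : Hist m k := fun i => h i.castSucc

/-- The number `g` of deliveries in a history, together with the amounts of work: entry `i < g` is
the work done by the servers between the deliveries number `i` and `i + 1`, and entry `g` is the
work done since the last delivery. -/
noncomputable def Policy.record (π : Policy I m Ξ) : (k : ℕ) → Ξ × Hist m k → ℕ × (ℕ → ℝ≥0∞)
  | 0, _ => (0, 0)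
  | k + 1, p =>
    ((π.record k (p.1, p.2.prev)).1 +
        ({j | p.2.now.delivered j ≠ none} : Finset (Fin m)).card,
      Function.update (π.record k (p.1, p.2.prev)).2 (π.record k (p.1, p.2.prev)).1
        ((π.record k (p.1, p.2.prev)).2 (π.record k (p.1, p.2.prev)).1 +
          (π.busy (p.1, p.2.prev)).card * (p.2.now.time - p.2.prev.now.time)))

lemma measurable_prev : Measurable (Hist.prev : Hist m (k + 1) → Hist m k) :=
  measurable_pi_iff.2 fun i => measurable_pi_apply i.castSucc

lemma measurable_update_nat :
    Measurable fun p : ℕ × (ℕ → ℝ≥0∞) × ℝ≥0∞ => Function.update p.2.1 p.1 p.2.2 :=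
  measurable_comp_countable (g := fun (i : ℕ) (q : (ℕ → ℝ≥0∞) × ℝ≥0∞) => Function.update q.1 i q.2)
    (fun _ => measurable_update') measurable_fst measurable_snd

lemma measurable_eval_nat : Measurable fun p : ℕ × (ℕ → ℝ≥0∞) => p.2 p.1 :=
  measurable_comp_countable (g := fun (i : ℕ) (q : ℕ → ℝ≥0∞) => q i)
    measurable_pi_apply measurable_fst measurable_snd

lemma Policy.measurable_record (π : Policy I m Ξ) (k : ℕ) : Measurable (π.record k) := by
  induction k with
  | zero => exact measurable_const
  | succ k ih =>
    have hprev : Measurable fun p : Ξ × Hist m (k + 1) => (p.1, p.2.prev) :=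
      measurable_fst.prodMk (measurable_prev.comp measurable_snd)
    have hrecord := ih.comp hprev
    have hdelivering : Measurable fun p : Ξ × Hist m (k + 1) =>
        ({j | p.2.now.delivered j ≠ none} : Finset (Fin m)) := by
      refine measurable_finset_iff.2 fun j => ?_
      simp only [Finset.mem_filter, Finset.mem_univ, true_and]
      exact ((measurable_delivered (Fin.last (k + 1)) j).comp measurable_snd)
        (MeasurableSet.of_discrete (s := {none}ᶜ))
    have hbusy : Measurable fun p : Ξ × Hist m (k + 1) =>
        ((π.busy (p.1, p.2.prev)).card : ℝ≥0∞) :=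
      (Measurable.of_discrete (f := fun S : Finset (Fin m) => (S.card : ℝ≥0∞))).comp
        (π.measurable_busy.comp hprev)
    have hgap : Measurable fun p : Ξ × Hist m (k + 1) => p.2.now.time - p.2.prev.now.time :=
      (measurable_now_time.comp measurable_snd).sub
        (measurable_now_time.comp (measurable_prev.comp measurable_snd))
    simp only [Policy.record]
    exact ((measurable_fst.comp hrecord).add
      ((Measurable.of_discrete (f := Finset.card)).comp hdelivering)).prodMk
      (measurable_update_nat.comp ((measurable_fst.comp hrecord).prodMk
        ((measurable_snd.comp hrecord).prodMk
          ((measurable_eval_nat.comp hrecord).add (hbusy.mul hgap)))))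

/-- The number of deliveries up to epoch `k`. -/
noncomputable def Policy.count (π : Policy I m Ξ) (w : Outcome m Ξ) (k : ℕ) : ℕ :=
  (π.record k (π.visible w k)).1

/-- The amounts of work done between successive deliveries up to epoch `k`. -/
noncomputable def Policy.work (π : Policy I m Ξ) (w : Outcome m Ξ) (k : ℕ) : ℕ → ℝ≥0∞ :=
  (π.record k (π.visible w k)).2

lemma Policy.prev_visible_succ (π : Policy I m Ξ) (w : Outcome m Ξ) (k : ℕ) :
    ((π.visible w (k + 1)).1, (π.visible w (k + 1)).2.prev) = π.visible w k := by
  rw [Policy.visible, Policy.visible, Prod.mk.injEq]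
  refine ⟨rfl, funext fun i => ?_⟩
  simp [Policy.run, Hist.prev]

lemma Policy.count_succ (π : Policy I m Ξ) (w : Outcome m Ξ) (k : ℕ) :
    π.count w (k + 1) = π.count w k + (π.completing w k).card := by
  have hdelivering : ({j | (π.visible w (k + 1)).2.now.delivered j ≠ none} : Finset (Fin m)) =
      π.completing w k := by
    ext j
    simp only [Finset.mem_filter, Finset.mem_univ, true_and, Policy.visible, π.delivered_succ]
    by_cases hj : j ∈ π.completing w k
    · simp only [hj, if_true, iff_true]
      exact (Policy.mem_busy.1 (π.completing_subset_busy w k hj)).2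
    · simp [hj]
  rw [Policy.count, Policy.record, hdelivering, π.prev_visible_succ]
  rfl

lemma Policy.work_succ (π : Policy I m Ξ) (w : Outcome m Ξ) (k : ℕ) :
    π.work w (k + 1) = Function.update (π.work w k) (π.count w k)
      (π.work w k (π.count w k) + (π.busy (π.visible w k)).card * π.gap w k) := by
  have hgap : (π.busy (π.visible w k)).card *
      ((π.visible w (k + 1)).2.now.time - (π.visible w k).2.now.time) =
        (π.busy (π.visible w k)).card * π.gap w k := by
    by_cases ht : (π.visible w k).2.now.time = ⊤
    · simp [Policy.busy_of_time_eq_top ht]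
    · have htime : (π.visible w (k + 1)).2.now.time = (π.visible w k).2.now.time + π.gap w k :=
        π.time_succ w k
      rw [htime, ENNReal.add_sub_cancel_left ht]
  have hprev := congrArg Prod.snd (π.prev_visible_succ w k)
  simp only at hprev
  rw [Policy.work, Policy.record, π.prev_visible_succ, hprev, hgap]
  rfl

/-- The amounts of work between deliveries in the record `r`, the last of them continued and the
others supplemented by the amounts `Z`. -/
noncomputable def combine (r : ℕ × (ℕ → ℝ≥0∞)) (Z : ℕ → ℝ≥0∞) (i : ℕ) : ℝ≥0∞ :=
  if i < r.1 then r.2 i else r.2 i + Z i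

lemma measurable_combine :
    Measurable fun p : (ℕ × (ℕ → ℝ≥0∞)) × (ℕ → ℝ≥0∞) => combine p.1 p.2 :=
  measurable_pi_iff.2 fun i => Measurable.ite
    ((measurable_fst.comp measurable_fst) (MeasurableSet.of_discrete (s := Set.Ioi i)))
    ((measurable_pi_apply i).comp (measurable_snd.comp measurable_fst))
    (((measurable_pi_apply i).comp (measurable_snd.comp measurable_fst)).add
      ((measurable_pi_apply i).comp measurable_snd))

/-- The amounts `Z` with the entry of the current number of deliveries replaced by the work until
the next completion, continued by that entry if the horizon comes first. -/
noncomputable def Policy.continueWork (π : Policy I m Ξ)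
    (q : (Ξ × Hist m k) × (Fin m → ℝ≥0∞) × (ℕ → ℝ≥0∞)) : ℕ → ℝ≥0∞ :=
  Function.update q.2.2 (π.record k q.1).1
    (continuedWork (π.busy q.1) (π.horizon q.1) q.2.1 (q.2.2 (π.record k q.1).1))

lemma Policy.measurable_continueWork (π : Policy I m Ξ) :
    Measurable (π.continueWork : (Ξ × Hist m k) × (Fin m → ℝ≥0∞) × (ℕ → ℝ≥0∞) → ℕ → ℝ≥0∞) := by
  have hcount : Measurable fun q : (Ξ × Hist m k) × (Fin m → ℝ≥0∞) × (ℕ → ℝ≥0∞) =>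
      (π.record k q.1).1 :=
    measurable_fst.comp ((π.measurable_record k).comp measurable_fst)
  have hwork : Measurable fun q : (Ξ × Hist m k) × (Fin m → ℝ≥0∞) × (ℕ → ℝ≥0∞) =>
      continuedWork (π.busy q.1) (π.horizon q.1) q.2.1 (q.2.2 (π.record k q.1).1) :=
    measurable_comp_countable
      (g := fun B (u : ℝ≥0∞ × (Fin m → ℝ≥0∞) × ℝ≥0∞) => continuedWork B u.1 u.2.1 u.2.2)
      measurable_continuedWork (π.measurable_busy.comp measurable_fst)
      ((π.measurable_horizon.comp measurable_fst).prodMk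
        ((measurable_fst.comp measurable_snd).prodMk (measurable_eval_nat.comp
          (hcount.prodMk (measurable_snd.comp measurable_snd)))))
  exact measurable_update_nat.comp
    (hcount.prodMk ((measurable_snd.comp measurable_snd).prodMk hwork))

lemma Policy.combine_record_succ (π : Policy I m Ξ) (w : Outcome m Ξ) (k : ℕ)
    (h : (π.completing w k).card ≤ 1) (Z : ℕ → ℝ≥0∞) :
    combine (π.record (k + 1) (π.visible w (k + 1))) Z =
      combine (π.record k (π.visible w k))
        (π.continueWork (π.visible w k, π.residual w k, Z)) := by
  funext i
  change (if i < π.count w (k + 1) then π.work w (k + 1) i else π.work w (k + 1) i + Z i) =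
    if i < π.count w k then π.work w k i else π.work w k i + Function.update Z (π.count w k)
      (continuedWork (π.busy (π.visible w k)) (π.horizon (π.visible w k)) (π.residual w k)
        (Z (π.count w k))) i
  rw [π.count_succ, π.work_succ]
  obtain hi | rfl | hi := lt_trichotomy i (π.count w k)
  · rw [Function.update_of_ne hi.ne, if_pos hi, if_pos (by omega)]
  · rw [Function.update_self, Function.update_self, if_neg (lt_irrefl _)]
    by_cases hS : π.completing w k = ∅
    · have hgap : π.gap w k = π.horizon (π.visible w k) := firstTime_of_empty hS
      rw [continuedWork_of_empty hS, hS, Finset.card_empty, add_zero, if_neg (lt_irrefl _), hgap,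
        add_assoc]
    · have hcard := Finset.card_pos.2 (Finset.nonempty_iff_ne_empty.2 hS)
      rw [continuedWork_of_ne_empty hS, if_pos (by omega)]
      rfl
  · rw [Function.update_of_ne hi.ne', Function.update_of_ne hi.ne', if_neg hi.not_gt,
      if_neg (by omega)]

end Record

section WorkLaw

variable {m k : ℕ} {I : Input} {Ξ : Type*} [MeasurableSpace Ξ] {ρ : Measure ℝ≥0∞}
  [IsProbabilityMeasure ρ] [NullSingletonClass ρ]

lemma Policy.map_combine_continueWork (hρ : Memoryless ρ) (π : Policy I m Ξ)
    {μ : Measure (Ξ × Hist m k)} [SFinite μ] :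
    (μ.prod ((Measure.pi fun _ : Fin m => ρ).prod (Measure.infinitePi fun _ : ℕ => ρ))).map
        (fun q => combine (π.record k q.1) (π.continueWork q)) =
      (μ.prod ((Measure.pi fun _ : Fin m => ρ).prod (Measure.infinitePi fun _ : ℕ => ρ))).map
        (fun q => combine (π.record k q.1) q.2.2) := by
  have hrecord : Measurable fun q : (Ξ × Hist m k) × (Fin m → ℝ≥0∞) × (ℕ → ℝ≥0∞) =>
      π.record k q.1 := (π.measurable_record k).comp measurable_fst
  refine map_prod_congr (measurable_combine.comp (hrecord.prodMk π.measurable_continueWork))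
    (measurable_combine.comp (hrecord.prodMk (measurable_snd.comp measurable_snd))) fun p => ?_
  have hcontinue : MeasurePreserving (fun q => π.continueWork (p, q))
      ((Measure.pi fun _ : Fin m => ρ).prod (Measure.infinitePi fun _ => ρ))
      (Measure.infinitePi fun _ => ρ) :=
    measurePreserving_update_infinitePi_of (ν := fun _ : ℕ => ρ) (i := (π.record k p).1)
      (hρ.measurePreserving_continuedWork (π.busy p) (π.horizon p))
  have hcombine : Measurable (combine (π.record k p)) :=
    measurable_combine.comp measurable_prodMk_left
  calc ((Measure.pi fun _ : Fin m => ρ).prod (Measure.infinitePi fun _ : ℕ => ρ)).map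
        (fun q => combine (π.record k p) (π.continueWork (p, q)))
      = (((Measure.pi fun _ => ρ).prod (Measure.infinitePi fun _ => ρ)).map
          (fun q => π.continueWork (p, q))).map (combine (π.record k p)) :=
        (Measure.map_map hcombine hcontinue.measurable).symm
    _ = (Measure.infinitePi fun _ => ρ).map (combine (π.record k p)) :=
        congrArg _ hcontinue.map_eq
    _ = (((Measure.pi fun _ : Fin m => ρ).prod (Measure.infinitePi fun _ => ρ)).map Prod.snd).map
          (combine (π.record k p)) := by
        rw [Measure.map_snd_prod, measure_univ, one_smul]
    _ = _ := Measure.map_map hcombine measurable_snd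

variable {Ω : Type*} [MeasurableSpace Ω] {P : Measure Ω} [IsProbabilityMeasure P]
  {W : Ω → Outcome m Ξ}

lemma Policy.ae_completing_card_le_one (hρ : Memoryless ρ) (hW : IsDriven P W ρ)
    (π : Policy I m Ξ) : ∀ᵐ ω ∂P, ∀ k, (π.completing (W ω) k).card ≤ 1 := by
  refine ae_all_iff.2 fun k => ?_
  have hstate : Measurable fun ω => (π.visible (W ω) k, π.residual (W ω) k) :=
    (π.measurable_visible_residual k).comp hW.measurable
  have hinj : ∀ᵐ q ∂(P.map fun ω => (π.visible (W ω) k, π.residual (W ω) k)),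
      Function.Injective q.2 := by
    rw [π.map_visible_residual hρ hW k]
    exact Measure.quasiMeasurePreserving_snd.ae (ae_injective_pi _)
  filter_upwards [ae_of_ae_map hstate.aemeasurable hinj] with ω hω
  exact card_firstSet_le_one hω

lemma Policy.map_visible_residual_prod {α : Type*} [MeasurableSpace α] {ν : Measure α} [SFinite ν]
    (hρ : Memoryless ρ) (hW : IsDriven P W ρ) (π : Policy I m Ξ) (k : ℕ) :
    (P.prod ν).map (fun p => (π.visible (W p.1) k, π.residual (W p.1) k, p.2)) =
      (P.map fun ω => π.visible (W ω) k).prod ((Measure.pi fun _ => ρ).prod ν) := by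
  have hvisible : Measurable fun p : Ω × α => π.visible (W p.1) k :=
    (π.measurable_visible k).comp (hW.measurable.comp measurable_fst)
  have hresidual : Measurable fun p : Ω × α => π.residual (W p.1) k :=
    (π.measurable_residual k).comp (hW.measurable.comp measurable_fst)
  have hstate : Measurable fun ω => (π.visible (W ω) k, π.residual (W ω) k) :=
    (π.measurable_visible_residual k).comp hW.measurable
  rw [← map_prodMk_assoc_eq_iff hvisible hresidual measurable_snd, ← π.map_visible_residual hρ hW k]
  calc (P.prod ν).map (fun p => ((π.visible (W p.1) k, π.residual (W p.1) k), p.2))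
      = (P.map fun ω => (π.visible (W ω) k, π.residual (W ω) k)).prod (ν.map id) :=
        (Measure.map_prod_map P ν hstate measurable_id).symm
    _ = _ := by rw [Measure.map_id]

lemma Policy.combine_record_zero (π : Policy I m Ξ) (p : Ξ × Hist m 0) (z : ℕ → ℝ≥0∞) :
    combine (π.record 0 p) z = z := by
  funext i
  simp [combine, Policy.record]

theorem Policy.map_combine_record (hρ : Memoryless ρ) (hW : IsDriven P W ρ) (π : Policy I m Ξ)
    (k : ℕ) :
    (P.prod (Measure.infinitePi fun _ : ℕ => ρ)).map
        (fun p => combine (π.record k (π.visible (W p.1) k)) p.2) =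
      Measure.infinitePi fun _ : ℕ => ρ := by
  induction k with
  | zero =>
    simp only [π.combine_record_zero]
    rw [Measure.map_snd_prod, measure_univ, one_smul]
  | succ k ih =>
    have hstate : Measurable fun p : Ω × (ℕ → ℝ≥0∞) =>
        (π.visible (W p.1) k, π.residual (W p.1) k, p.2) :=
      ((π.measurable_visible k).comp (hW.measurable.comp measurable_fst)).prodMk
        (((π.measurable_residual k).comp (hW.measurable.comp measurable_fst)).prodMk
          measurable_snd)
    have hrecord : Measurable fun q : (Ξ × Hist m k) × (Fin m → ℝ≥0∞) × (ℕ → ℝ≥0∞) =>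
        π.record k q.1 := (π.measurable_record k).comp measurable_fst
    have hsucc : ∀ᵐ p ∂P.prod (Measure.infinitePi fun _ : ℕ => ρ),
        combine (π.record (k + 1) (π.visible (W p.1) (k + 1))) p.2 =
          combine (π.record k (π.visible (W p.1) k))
            (π.continueWork (π.visible (W p.1) k, π.residual (W p.1) k, p.2)) := by
      filter_upwards [Measure.quasiMeasurePreserving_fst.ae
        (π.ae_completing_card_le_one hρ hW)] with p hp
      exact π.combine_record_succ (W p.1) k (hp k) p.2
    have hcontinue := π.map_combine_continueWork hρ (μ := P.map fun ω => π.visible (W ω) k)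
    rw [← π.map_visible_residual_prod hρ hW k] at hcontinue
    calc (P.prod (Measure.infinitePi fun _ : ℕ => ρ)).map
          (fun p => combine (π.record (k + 1) (π.visible (W p.1) (k + 1))) p.2)
        = (P.prod (Measure.infinitePi fun _ : ℕ => ρ)).map fun p =>
            combine (π.record k (π.visible (W p.1) k))
              (π.continueWork (π.visible (W p.1) k, π.residual (W p.1) k, p.2)) :=
          Measure.map_congr hsucc
      _ = (P.prod (Measure.infinitePi fun _ : ℕ => ρ)).map
            fun p => combine (π.record k (π.visible (W p.1) k)) p.2 :=
          ((Measure.map_map (measurable_combine.comp (hrecord.prodMk π.measurable_continueWork))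
            hstate).symm.trans hcontinue).trans (Measure.map_map (measurable_combine.comp
              (hrecord.prodMk (measurable_snd.comp measurable_snd))) hstate)
      _ = Measure.infinitePi fun _ => ρ := ih

end WorkLaw

section Path

variable {m : ℕ} {I : Input} {Ξ : Type*} [MeasurableSpace Ξ]

/-- The time of epoch `k`. -/
noncomputable def Policy.time (π : Policy I m Ξ) (w : Outcome m Ξ) (k : ℕ) : ℝ≥0∞ :=
  (π.obs w k).time

/-- The packets that arrive up to time `T`. -/
def Input.arrived (I : Input) (T : ℝ≥0∞) : Set ℕ := {i | (i : ℕ∞) < I.n ∧ (I.arr i : ℝ≥0∞) ≤ T}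

/-- The packets delivered up to epoch `k`. -/
def Policy.deliveredSet (π : Policy I m Ξ) (w : Outcome m Ξ) (k : ℕ) : Set ℕ :=
  {i | ∃ l ≤ k, ∃ j, (π.obs w l).delivered j = some i}

/-- The packets in service after the decision of epoch `k`. -/
def Policy.served (π : Policy I m Ξ) (w : Outcome m Ξ) (k : ℕ) : Set ℕ :=
  {i | ∃ j, π.decision w k j = some i}

variable (π : Policy I m Ξ) (w : Outcome m Ξ)

lemma Policy.time_zero : π.time w 0 = 0 := rfl

lemma Policy.time_add_gap (k : ℕ) : π.time w (k + 1) = π.time w k + π.gap w k :=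
  π.time_succ w k

lemma Policy.time_mono : Monotone (π.time w) :=
  monotone_nat_of_le_succ fun k => π.time_le_time_succ w k

lemma Policy.time_ne_top_of_le {k l : ℕ} (h : k ≤ l) (hl : π.time w l ≠ ⊤) : π.time w k ≠ ⊤ :=
  ne_top_of_le_ne_top hl (π.time_mono w h)

lemma Policy.time_succ_le_nextArrival (k : ℕ) :
    π.time w (k + 1) ≤ I.nextArrival (π.time w k) :=
  (π.time_succ_eq_nextTime w k).trans_le (min_le_left _ _)

lemma Policy.hist_apply (k : ℕ) (l : Fin (k + 1)) : (π.run w k).hist l = π.obs w l := by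
  induction k with
  | zero =>
    obtain rfl : l = Fin.last 0 := Fin.ext (by have := l.2; simp)
    rfl
  | succ k ih =>
    induction l using Fin.lastCases with
    | last => rfl
    | cast l =>
      exact (congrFun (congrArg Prod.snd (π.prev_visible_succ w k)) l).trans (ih l)

lemma Policy.inSystem_run (k : ℕ) :
    I.inSystem (π.run w k).hist = I.arrived (π.time w k) \ π.deliveredSet w k := by
  ext i
  simp only [Input.inSystem, Input.arrived, Policy.deliveredSet, Set.mem_sdiff, Set.mem_ofPred_eq,
    π.hist_apply]
  constructor
  · rintro ⟨hn, harr, hdel⟩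
    refine ⟨⟨hn, harr⟩, ?_⟩
    rintro ⟨l, hl, j, hj⟩
    exact hdel ⟨l, Nat.lt_succ_of_le hl⟩ j hj
  · rintro ⟨⟨hn, harr⟩, hdel⟩
    exact ⟨hn, harr, fun l j hj => hdel ⟨l, Nat.le_of_lt_succ l.2, j, hj⟩⟩

lemma Policy.delivered_eq_some_iff {k : ℕ} {j : Fin m} {i : ℕ} :
    (π.obs w (k + 1)).delivered j = some i ↔
      j ∈ π.completing w k ∧ π.decision w k j = some i := by
  have h := π.delivered_succ w k j
  change (π.obs w (k + 1)).delivered j = if _ then π.decision w k j else none at h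
  rw [h, ite_eq_iff]
  simp

lemma Policy.deliveredSet_zero : π.deliveredSet w 0 = ∅ := by
  ext i
  simp only [Policy.deliveredSet, Set.mem_ofPred_eq, Set.mem_empty_iff_false, iff_false]
  rintro ⟨l, hl, j, hj⟩
  obtain rfl : l = 0 := by omega
  have hnone : (π.obs w 0).delivered j = none := rfl
  simp [hnone] at hj

/-- The packets delivered at epoch `k + 1`. -/
def Policy.newlyDelivered (k : ℕ) : Set ℕ :=
  {i | ∃ j ∈ π.completing w k, π.decision w k j = some i}

lemma Policy.deliveredSet_succ (k : ℕ) :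
    π.deliveredSet w (k + 1) = π.deliveredSet w k ∪ π.newlyDelivered w k := by
  ext i
  simp only [Policy.deliveredSet, Policy.newlyDelivered, Set.mem_ofPred_eq, Set.mem_union]
  constructor
  · rintro ⟨l, hl, j, hj⟩
    rcases Nat.lt_or_ge l (k + 1) with h | h
    · exact Or.inl ⟨l, by omega, j, hj⟩
    · obtain rfl : l = k + 1 := by omega
      exact Or.inr ⟨j, (π.delivered_eq_some_iff w).1 hj⟩
  · rintro (⟨l, hl, j, hj⟩ | ⟨j, hj⟩)
    · exact ⟨l, by omega, j, hj⟩
    · exact ⟨k + 1, le_rfl, j, (π.delivered_eq_some_iff w).2 hj⟩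

lemma Policy.time_ne_top_of_mem_completing {k : ℕ} {j : Fin m} (h : j ∈ π.completing w k) :
    π.time w k ≠ ⊤ := (Policy.mem_busy.1 (π.completing_subset_busy w k h)).1

lemma Policy.served_subset_inSystem {k : ℕ} (ht : π.time w k ≠ ⊤) :
    π.served w k ⊆ I.inSystem (π.run w k).hist := by
  rintro i ⟨j, hj⟩
  exact π.assign_mem k w.1 _ ht j i hj

lemma Policy.newlyDelivered_subset_inSystem (k : ℕ) :
    π.newlyDelivered w k ⊆ I.inSystem (π.run w k).hist := by
  rintro i ⟨j, hcompl, hi⟩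
  exact π.served_subset_inSystem w (π.time_ne_top_of_mem_completing w hcompl) ⟨j, hi⟩

lemma Input.arrived_mono (I : Input) : Monotone I.arrived := fun _ _ h _ hi =>
  ⟨hi.1, hi.2.trans h⟩

lemma Input.arrived_finite (I : Input) {T : ℝ≥0∞} (hT : T ≠ ⊤) : (I.arrived T).Finite := by
  lift T to ℝ≥0 using hT
  refine (I.finite_arrivals T).subset ?_
  exact fun i hi => ⟨hi.1, ENNReal.coe_le_coe.1 hi.2⟩

lemma Input.ncard_arrived (I : Input) (T : ℝ≥0) : (I.arrived T).ncard = I.arrivalCount T := by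
  rw [Input.arrivalCount]
  congr 1
  ext i
  simp [Input.arrived]

lemma Policy.deliveredSet_subset_arrived (k : ℕ) :
    π.deliveredSet w k ⊆ I.arrived (π.time w k) := by
  induction k with
  | zero => simp [π.deliveredSet_zero]
  | succ k ih =>
    rw [π.deliveredSet_succ]
    refine Set.union_subset (ih.trans (I.arrived_mono (π.time_mono w (Nat.le_succ k)))) ?_
    refine (π.newlyDelivered_subset_inSystem w k).trans ?_
    rw [π.inSystem_run]
    exact Set.sdiff_subset.trans (I.arrived_mono (π.time_mono w (Nat.le_succ k)))

lemma ncard_assigned {a : Fin m → Option ℕ} (B : Finset (Fin m)) (hB : ∀ j ∈ B, a j ≠ none)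
    (hinj : ∀ j j' i, a j = some i → a j' = some i → j = j') :
    {i | ∃ j ∈ B, a j = some i}.ncard = B.card := by
  have himage : (some '' {i | ∃ j ∈ B, a j = some i} : Set (Option ℕ)) =
      a '' (B : Set (Fin m)) := by
    ext o
    constructor
    · rintro ⟨i, ⟨j, hj, hji⟩, rfl⟩
      exact ⟨j, hj, hji⟩
    · rintro ⟨j, hj, rfl⟩
      obtain ⟨i, hi⟩ := Option.ne_none_iff_exists'.1 (hB j hj)
      exact ⟨i, ⟨j, hj, hi⟩, hi.symm⟩
  rw [← Set.ncard_image_of_injective _ (Option.some_injective ℕ), himage, Set.InjOn.ncard_image,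
    Set.ncard_coe_finset]
  intro j hj j' _ he
  obtain ⟨i, hi⟩ := Option.ne_none_iff_exists'.1 (hB j hj)
  exact hinj j j' i hi (he ▸ hi)

lemma Policy.ncard_newlyDelivered (k : ℕ) :
    (π.newlyDelivered w k).ncard = (π.completing w k).card := by
  by_cases hne : (π.completing w k).Nonempty
  · obtain ⟨j, hj⟩ := hne
    exact ncard_assigned _
      (fun j hj => (Policy.mem_busy.1 (π.completing_subset_busy w k hj)).2)
      (π.assign_inj k w.1 _ (π.time_ne_top_of_mem_completing w hj))
  · rw [Finset.not_nonempty_iff_eq_empty] at hne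
    simp [Policy.newlyDelivered, hne]

lemma Policy.newlyDelivered_finite (k : ℕ) : (π.newlyDelivered w k).Finite := by
  have hsub : π.newlyDelivered w k ⊆ ⋃ j, {i | π.decision w k j = some i} := by
    rintro i ⟨j, -, hi⟩
    exact Set.mem_iUnion.2 ⟨j, hi⟩
  refine (Set.finite_iUnion fun j => ?_).subset hsub
  exact Set.Subsingleton.finite fun i hi i' hi' =>
    Option.some_injective _ (Eq.trans (Eq.symm hi) hi')

lemma Policy.deliveredSet_finite (k : ℕ) : (π.deliveredSet w k).Finite := by
  induction k with
  | zero => simp [π.deliveredSet_zero]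
  | succ k ih =>
    rw [π.deliveredSet_succ]
    exact ih.union (π.newlyDelivered_finite w k)

lemma Policy.ncard_deliveredSet (k : ℕ) : (π.deliveredSet w k).ncard = π.count w k := by
  induction k with
  | zero => simp [π.deliveredSet_zero, Policy.count, Policy.record]
  | succ k ih =>
    have hdisjoint : Disjoint (π.deliveredSet w k) (π.newlyDelivered w k) := by
      refine (Set.disjoint_sdiff_left (t := I.arrived (π.time w k))).symm.mono_right ?_
      rw [← π.inSystem_run]
      exact π.newlyDelivered_subset_inSystem w k
    rw [π.deliveredSet_succ, π.count_succ, ← ih, ← π.ncard_newlyDelivered,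
      Set.ncard_union_eq hdisjoint (π.deliveredSet_finite w k) (π.newlyDelivered_finite w k)]

lemma Policy.ncard_inSystem (k : ℕ) :
    (I.inSystem (π.run w k).hist).ncard = (I.arrived (π.time w k)).ncard - π.count w k := by
  rw [π.inSystem_run, Set.ncard_sdiff (π.deliveredSet_subset_arrived w k)
    (π.deliveredSet_finite w k), π.ncard_deliveredSet]

lemma Policy.ncard_served {k : ℕ} (ht : π.time w k ≠ ⊤) :
    (π.served w k).ncard = (π.busy (π.visible w k)).card := by
  rw [← ncard_assigned (a := π.decision w k) (π.busy (π.visible w k))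
    (fun j hj => (Policy.mem_busy.1 hj).2) (π.assign_inj k w.1 _ ht)]
  congr 1
  ext i
  constructor
  · rintro ⟨j, hj⟩
    refine ⟨j, Policy.mem_busy.2 ⟨ht, ?_⟩, hj⟩
    change π.decision w k j ≠ none
    simp [hj]
  · rintro ⟨j, -, hj⟩
    exact ⟨j, hj⟩

lemma Policy.inSystem_finite {k : ℕ} (ht : π.time w k ≠ ⊤) :
    (I.inSystem (π.run w k).hist).Finite := by
  rw [π.inSystem_run]
  exact (I.arrived_finite ht).subset Set.sdiff_subset

lemma Policy.card_busy_le {k : ℕ} (ht : π.time w k ≠ ⊤) :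
    (π.busy (π.visible w k)).card ≤
      min m ((I.arrived (π.time w k)).ncard - π.count w k) := by
  refine le_min ((Finset.card_le_univ _).trans (by simp)) ?_
  rw [← π.ncard_inSystem w k, ← π.ncard_served w ht]
  exact Set.ncard_le_ncard (π.served_subset_inSystem w ht) (π.inSystem_finite w ht)

lemma Policy.card_busy_eq {k : ℕ} (ht : π.time w k ≠ ⊤)
    (hwc : ∀ j, π.decision w k j = none → π.waiting w k = ∅) :
    (π.busy (π.visible w k)).card =
      min m ((I.arrived (π.time w k)).ncard - π.count w k) := by
  refine le_antisymm (π.card_busy_le w ht) ?_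
  by_cases h : ∃ j, π.decision w k j = none
  · obtain ⟨j, hj⟩ := h
    have hw := hwc j hj
    refine (min_le_right _ _).trans ?_
    rw [← π.ncard_inSystem w k, ← π.ncard_served w ht]
    refine Set.ncard_le_ncard (fun i hi => ?_)
      ((π.inSystem_finite w ht).subset (π.served_subset_inSystem w ht))
    by_contra hns
    exact (hw ▸ (⟨hi, fun j hj => hns ⟨j, hj⟩⟩ : i ∈ π.waiting w k) : i ∈ (∅ : Set ℕ))
  · push Not at h
    refine (min_le_left _ _).trans ?_
    have hbusy : π.busy (π.visible w k) = Finset.univ :=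
      Finset.eq_univ_of_forall fun j => Policy.mem_busy.2 ⟨ht, h j⟩
    simp [hbusy]

lemma Policy.count_mono : Monotone (π.count w) :=
  monotone_nat_of_le_succ fun k => by
    rw [π.count_succ]
    exact Nat.le_add_right _ _

lemma Policy.work_mono : Monotone (π.work w) :=
  monotone_nat_of_le_succ fun k i => by
    rw [π.work_succ]
    by_cases hi : i = π.count w k
    · rw [hi, Function.update_self]
      exact le_self_add
    · rw [Function.update_of_ne hi]

lemma Policy.work_stable {k l : ℕ} (h : k ≤ l) {i : ℕ} (hi : i < π.count w k) :
    π.work w l i = π.work w k i := by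
  induction l, h using Nat.le_induction with
  | base => rfl
  | succ l hl ih =>
    rw [π.work_succ, Function.update_of_ne, ih]
    have := π.count_mono w hl
    omega

lemma Policy.work_eq_zero {k i : ℕ} (hi : π.count w k < i) : π.work w k i = 0 := by
  induction k with
  | zero => rfl
  | succ k ih =>
    have := π.count_succ w k
    rw [π.work_succ, Function.update_of_ne (by omega)]
    exact ih (by omega)

lemma Policy.completion_le_iff {k : ℕ} {t : ℝ≥0∞} (hk : π.time w k ≤ t)
    (hk' : t < π.time w (k + 1)) (i : ℕ) : π.completion w i ≤ t ↔ i ∈ π.deliveredSet w k := by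
  constructor
  · intro h
    by_contra hn
    refine absurd (h.trans_lt hk') (not_lt.2 (le_sInf ?_))
    rintro _ ⟨l, j, hj, rfl⟩
    refine π.time_mono w ?_
    by_contra hl
    exact hn ⟨l, by omega, j, hj⟩
  · rintro ⟨l, hl, j, hj⟩
    have hle : π.completion w i ≤ π.time w l := sInf_le ⟨l, j, hj, rfl⟩
    exact hle.trans ((π.time_mono w hl).trans hk)

lemma Policy.deliveredCount_eq_count {k : ℕ} {t : ℝ≥0} (hk : π.time w k ≤ t)
    (hk' : (t : ℝ≥0∞) < π.time w (k + 1)) : π.deliveredCount w t = π.count w k := by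
  rw [← π.ncard_deliveredSet w k, Policy.deliveredCount]
  congr 1
  ext i
  simp only [Set.mem_ofPred_eq, π.completion_le_iff w hk hk']
  exact ⟨fun h => h.2, fun h => ⟨(π.deliveredSet_subset_arrived w k h).1, h⟩⟩

lemma Policy.exists_epoch {K : ℕ} {t : ℝ≥0∞} (h : t < π.time w K) :
    ∃ k < K, π.time w k ≤ t ∧ t < π.time w (k + 1) := by
  induction K with
  | zero => simp [π.time_zero] at h
  | succ K ih =>
    by_cases hK : t < π.time w K
    · obtain ⟨k, hk, hle, hlt⟩ := ih hK
      exact ⟨k, by omega, hle, hlt⟩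
    · exact ⟨K, Nat.lt_succ_self K, not_lt.1 hK, h⟩

lemma Policy.arr_le_completion (i : ℕ) : (I.arr i : ℝ≥0∞) ≤ π.completion w i := by
  refine le_sInf ?_
  rintro _ ⟨l, j, hj, rfl⟩
  exact (π.deliveredSet_subset_arrived w l ⟨l, le_rfl, j, hj⟩).2

end Path

section Capacity

/-- The times in `[a, t)`. -/
def timesBetween (a : ℝ≥0) (t : ℝ≥0∞) : Set ℝ := {s | (a : ℝ) ≤ s ∧ ENNReal.ofReal s < t}

lemma measurableSet_timesBetween (a : ℝ≥0) (t : ℝ≥0∞) : MeasurableSet (timesBetween a t) :=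
  measurableSet_Ici.inter (ENNReal.measurable_ofReal measurableSet_Iio)

lemma volume_timesBetween (a : ℝ≥0) (t : ℝ≥0∞) : volume (timesBetween a t) = t - a := by
  induction t using ENNReal.recTopCoe with
  | top =>
    have hIci : timesBetween a ⊤ = Set.Ici (a : ℝ) := by
      ext s
      simp [timesBetween]
    rw [hIci, Real.volume_Ici, ENNReal.top_sub_coe]
  | coe t =>
    have hIco : timesBetween a t = Set.Ico (a : ℝ) t := by
      ext s
      simp only [timesBetween, Set.mem_ofPred_eq, Set.mem_Ico]
      refine and_congr_right fun h => ?_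
      rw [← ENNReal.ofReal_coe_nnreal, ENNReal.ofReal_lt_ofReal_iff_of_nonneg (a.2.trans h)]
    rw [hIco, Real.volume_Ico, ENNReal.ofReal_sub _ a.coe_nonneg]
    simp

variable (I : Input) (m : ℕ)

/-- The largest possible number of busy servers at time `s` when `i` packets have been delivered. -/
noncomputable def rate (i : ℕ) (s : ℝ≥0) : ℕ := min m (I.arrivalCount s - i)

/-- The largest possible amount of work up to time `t` if `i` packets are delivered all the time. -/
noncomputable def capacity (i : ℕ) (t : ℝ≥0∞) : ℝ≥0∞ :=
  ∫⁻ s in timesBetween 0 t, (rate I m i s.toNNReal : ℝ≥0∞)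

lemma Input.arrivalCount_mono : Monotone I.arrivalCount := by
  intro s t h
  rw [← I.ncard_arrived, ← I.ncard_arrived]
  exact Set.ncard_le_ncard (I.arrived_mono (ENNReal.coe_le_coe.2 h))
    (I.arrived_finite ENNReal.coe_ne_top)

lemma rate_mono (i : ℕ) : Monotone (rate I m i) := fun _ _ h =>
  min_le_min_left m (Nat.sub_le_sub_right (I.arrivalCount_mono h) i)

lemma timesBetween_subset {t t' : ℝ≥0∞} (a : ℝ≥0) (h : t ≤ t') :
    timesBetween a t ⊆ timesBetween a t' := fun _ hs => ⟨hs.1, hs.2.trans_le h⟩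

lemma capacity_mono (i : ℕ) : Monotone (capacity I m i) := fun _ _ h =>
  lintegral_mono_set (timesBetween_subset 0 h)

lemma capacity_ne_top (i : ℕ) {t : ℝ≥0∞} (ht : t ≠ ⊤) : capacity I m i t ≠ ⊤ := by
  have hle : capacity I m i t ≤ ∫⁻ _ in timesBetween 0 t, (m : ℝ≥0∞) :=
    lintegral_mono fun s => Nat.cast_le.2 (min_le_left m _)
  refine ne_top_of_le_ne_top ?_ hle
  rw [setLIntegral_const, volume_timesBetween]
  exact ENNReal.mul_ne_top (ENNReal.natCast_ne_top m) (ENNReal.sub_ne_top ht)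

lemma timesBetween_union {a : ℝ≥0} {t : ℝ≥0∞} (h : (a : ℝ≥0∞) ≤ t) :
    timesBetween 0 a ∪ timesBetween a t = timesBetween 0 t := by
  ext s
  simp only [timesBetween, Set.mem_ofPred_eq, Set.mem_union, NNReal.coe_zero]
  constructor
  · rintro (⟨hs0, hs⟩ | ⟨ha, hs⟩)
    · exact ⟨hs0, hs.trans_le h⟩
    · exact ⟨a.2.trans ha, hs⟩
  · rintro ⟨hs0, hs⟩
    rcases lt_or_ge s (a : ℝ) with ha | ha
    · refine Or.inl ⟨hs0, ?_⟩
      rwa [← ENNReal.ofReal_coe_nnreal, ENNReal.ofReal_lt_ofReal_iff_of_nonneg hs0]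
    · exact Or.inr ⟨ha, hs⟩

lemma disjoint_timesBetween (a : ℝ≥0) (t : ℝ≥0∞) :
    Disjoint (timesBetween 0 a) (timesBetween a t) := by
  refine Set.disjoint_left.2 fun s hs0 ha => not_le.2 ?_ ha.1
  have hs := hs0.2
  rwa [← ENNReal.ofReal_coe_nnreal, ENNReal.ofReal_lt_ofReal_iff_of_nonneg hs0.1] at hs

lemma capacity_eq_add (i : ℕ) {a : ℝ≥0} {t : ℝ≥0∞} (h : (a : ℝ≥0∞) ≤ t) :
    capacity I m i t = capacity I m i a +
      ∫⁻ s in timesBetween a t, (rate I m i s.toNNReal : ℝ≥0∞) := by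
  rw [capacity, ← timesBetween_union h,
    lintegral_union (measurableSet_timesBetween a t) (disjoint_timesBetween a t), capacity]

lemma capacity_add_of_const (i : ℕ) {a : ℝ≥0} {t : ℝ≥0∞} (h : (a : ℝ≥0∞) ≤ t)
    (hc : ∀ s : ℝ≥0, a ≤ s → (s : ℝ≥0∞) < t → rate I m i s = rate I m i a) :
    capacity I m i t = capacity I m i a + rate I m i a * (t - a) := by
  rw [capacity_eq_add I m i h, ← volume_timesBetween, ← setLIntegral_const]
  congr 1
  refine setLIntegral_congr_fun (measurableSet_timesBetween a t) fun s hs => ?_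
  rw [hc s.toNNReal (NNReal.le_toNNReal_of_coe_le hs.1) hs.2]

lemma capacity_add_le (i : ℕ) {a : ℝ≥0} {t : ℝ≥0∞} (h : (a : ℝ≥0∞) ≤ t)
    (hc : 1 ≤ rate I m i a) : capacity I m i a + (t - a) ≤ capacity I m i t := by
  rw [capacity_eq_add I m i h, ← volume_timesBetween]
  gcongr
  rw [← setLIntegral_one]
  refine setLIntegral_mono' (measurableSet_timesBetween a t) fun s hs => ?_
  exact Nat.one_le_cast.2 (hc.trans (rate_mono I m i (NNReal.le_toNNReal_of_coe_le hs.1)))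

/-- The delivery times of a work-conserving system in which `E i` is the amount of work between the
deliveries number `i` and `i + 1`. -/
noncomputable def idealTime (E : ℕ → ℝ≥0∞) : ℕ → ℝ≥0∞
  | 0 => 0
  | i + 1 => sInf {t | capacity I m i (idealTime E i) + E i < capacity I m i t}

/-- The number of deliveries up to time `t` in the work-conserving system driven by `E`. -/
noncomputable def idealCount (E : ℕ → ℝ≥0∞) (t : ℝ≥0) : ℕ :=
  ({i ∈ Finset.range (I.arrivalCount t) | idealTime I m E (i + 1) ≤ t} : Finset ℕ).card

lemma idealTime_mono (E : ℕ → ℝ≥0∞) : Monotone (idealTime I m E) :=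
  monotone_nat_of_le_succ fun i => le_sInf fun _ ht =>
    ((capacity_mono I m i).reflect_lt (le_self_add.trans_lt ht)).le

variable {I m} in
lemma le_idealTime_succ {E : ℕ → ℝ≥0∞} {i : ℕ} {t : ℝ≥0∞}
    (h : capacity I m i t ≤ capacity I m i (idealTime I m E i) + E i) :
    t ≤ idealTime I m E (i + 1) :=
  le_sInf fun _ hs => ((capacity_mono I m i).reflect_lt (h.trans_lt hs)).le

variable {I m} in
lemma idealTime_succ_le {E : ℕ → ℝ≥0∞} {i : ℕ} {t : ℝ≥0} (hrate : 1 ≤ rate I m i t)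
    (h : capacity I m i (idealTime I m E i) + E i ≤ capacity I m i t) :
    idealTime I m E (i + 1) ≤ t := by
  refine ENNReal.le_of_forall_pos_le_add fun ε hε _ => sInf_le ?_
  calc capacity I m i (idealTime I m E i) + E i ≤ capacity I m i t := h
    _ < capacity I m i t + ε :=
      ENNReal.lt_add_right (capacity_ne_top I m i ENNReal.coe_ne_top) (by simpa using hε.ne')
    _ = capacity I m i t + (t + ε - t) := by rw [ENNReal.add_sub_cancel_left ENNReal.coe_ne_top]
    _ ≤ capacity I m i (t + ε) := capacity_add_le I m i le_self_add hrate

variable {I m} in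
lemma le_idealCount {E : ℕ → ℝ≥0∞} {i : ℕ} {t : ℝ≥0} (hi : i ≤ I.arrivalCount t)
    (ht : idealTime I m E i ≤ t) : i ≤ idealCount I m E t := by
  have hsub : Finset.range i ⊆
      {l ∈ Finset.range (I.arrivalCount t) | idealTime I m E (l + 1) ≤ t} := fun l hl =>
    have hli := Finset.mem_range.1 hl
    Finset.mem_filter.2 ⟨Finset.mem_range.2 (hli.trans_le hi), (idealTime_mono I m E hli).trans ht⟩
  exact (Finset.card_range i).ge.trans (Finset.card_le_card hsub)

variable {I m} in
lemma idealCount_le {E : ℕ → ℝ≥0∞} {i : ℕ} {t : ℝ≥0} (ht : t < idealTime I m E (i + 1)) :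
    idealCount I m E t ≤ i := by
  have hsub : {l ∈ Finset.range (I.arrivalCount t) | idealTime I m E (l + 1) ≤ t} ⊆
      Finset.range i := by
    intro l hl
    by_contra hil
    rw [Finset.mem_range, not_lt] at hil
    exact ((idealTime_mono I m E (Nat.succ_le_succ hil)).trans (Finset.mem_filter.1 hl).2).not_gt ht
  exact (Finset.card_le_card hsub).trans (Finset.card_range i).le

lemma measurable_idealTime (i : ℕ) : Measurable fun E : ℕ → ℝ≥0∞ => idealTime I m E i := by
  induction i with
  | zero => exact measurable_const
  | succ i ih =>
    have hm : Monotone fun y : ℝ≥0∞ => sInf {t | y < capacity I m i t} := fun y y' h =>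
      sInf_le_sInf fun t ht => h.trans_lt ht
    exact hm.measurable.comp
      (((capacity_mono I m i).measurable.comp ih).add (measurable_pi_apply i))

lemma measurable_idealCount (t : ℝ≥0) : Measurable fun E : ℕ → ℝ≥0∞ => idealCount I m E t := by
  simp only [idealCount, Finset.card_filter]
  refine Finset.measurable_sum _ fun i _ => ?_
  exact Measurable.ite ((measurable_idealTime I m (i + 1)) measurableSet_Iic)
    measurable_const measurable_const

end Capacity

section Comparison

variable {m : ℕ} {I : Input} {Ξ : Type*} [MeasurableSpace Ξ] (π : Policy I m Ξ) (w : Outcome m Ξ)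

lemma Policy.arrived_eq_of_lt {k : ℕ} {s : ℝ≥0∞} (hk : π.time w k ≤ s)
    (hk' : s < π.time w (k + 1)) : I.arrived s = I.arrived (π.time w k) := by
  refine Set.Subset.antisymm (fun i hi => ?_) (I.arrived_mono hk)
  refine ⟨hi.1, ?_⟩
  by_contra hlt
  have hnext : I.nextArrival (π.time w k) ≤ I.arr i := sInf_le ⟨i, hi.1, rfl, not_le.1 hlt⟩
  exact (((π.time_succ_le_nextArrival w k).trans hnext).trans hi.2).not_gt hk'

lemma Policy.capacity_succ {k : ℕ} (ht : π.time w k ≠ ⊤) (i : ℕ) :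
    capacity I m i (π.time w (k + 1)) = capacity I m i (π.time w k) +
      (min m ((I.arrived (π.time w k)).ncard - i) : ℕ) * π.gap w k := by
  obtain ⟨a, ha⟩ : ∃ a : ℝ≥0, (a : ℝ≥0∞) = π.time w k := ⟨_, ENNReal.coe_toNNReal ht⟩
  have hle := π.time_mono w (Nat.le_succ k)
  have h := capacity_add_of_const I m i (a := a) (t := π.time w (k + 1)) (ha ▸ hle) ?_
  · rw [ha] at h
    rw [h, rate, ← I.ncard_arrived, ha, π.time_add_gap, ENNReal.add_sub_cancel_left ht]
  · intro s has hst
    rw [rate, rate, ← I.ncard_arrived, ← I.ncard_arrived, ha,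
      π.arrived_eq_of_lt w (ha ▸ ENNReal.coe_le_coe.2 has) hst]

lemma Policy.work_succ_count (k : ℕ) :
    π.work w (k + 1) (π.count w k) =
      π.work w k (π.count w k) + (π.busy (π.visible w k)).card * π.gap w k := by
  rw [π.work_succ, Function.update_self]

lemma Policy.work_eq_of_succ {E : ℕ → ℝ≥0∞} {k : ℕ}
    (hE : ∀ i < π.count w (k + 1), E i = π.work w (k + 1) i) :
    ∀ i < π.count w k, E i = π.work w k i := fun i hi => by
  rw [hE i (hi.trans_le (π.count_mono w (Nat.le_succ k))), π.work_stable w (Nat.le_succ k) hi]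

lemma Policy.one_le_rate {k : ℕ} (hne : (π.completing w k).Nonempty)
    (ht : π.time w (k + 1) ≠ ⊤) :
    1 ≤ rate I m (π.count w k) (π.time w (k + 1)).toNNReal := by
  have ht' := π.time_ne_top_of_le w (Nat.le_succ k) ht
  calc 1 ≤ (π.busy (π.visible w k)).card :=
        (hne.mono (π.completing_subset_busy w k)).card_pos
    _ ≤ min m ((I.arrived (π.time w k)).ncard - π.count w k) := π.card_busy_le w ht'
    _ ≤ min m ((I.arrived (π.time w (k + 1))).ncard - π.count w k) :=
        min_le_min_left m (Nat.sub_le_sub_right (Set.ncard_le_ncard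
          (I.arrived_mono (π.time_mono w (Nat.le_succ k))) (I.arrived_finite ht)) _)
    _ = rate I m (π.count w k) (π.time w (k + 1)).toNNReal := by
        rw [rate, ← I.ncard_arrived, ENNReal.coe_toNNReal ht]

theorem Policy.idealTime_le_time (hc : ∀ k, (π.completing w k).card ≤ 1) (E : ℕ → ℝ≥0∞) {k : ℕ}
    (ht : π.time w k ≠ ⊤) (hE : ∀ i < π.count w k, E i = π.work w k i) :
    idealTime I m E (π.count w k) ≤ π.time w k ∧
      capacity I m (π.count w k) (idealTime I m E (π.count w k)) + π.work w k (π.count w k) ≤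
        capacity I m (π.count w k) (π.time w k) := by
  induction k with
  | zero => simp [Policy.count, Policy.work, Policy.record, idealTime, π.time_zero]
  | succ k ih =>
    have ht' := π.time_ne_top_of_le w (Nat.le_succ k) ht
    obtain ⟨hideal, hcapacity⟩ := ih ht' (π.work_eq_of_succ w hE)
    have hcapacity' : capacity I m (π.count w k) (idealTime I m E (π.count w k)) +
        π.work w (k + 1) (π.count w k) ≤ capacity I m (π.count w k) (π.time w (k + 1)) := by
      rw [π.work_succ_count, π.capacity_succ w ht', ← add_assoc]
      gcongr
      exact π.card_busy_le w ht'
    rcases Finset.eq_empty_or_nonempty (π.completing w k) with hempty | hne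
    · have hcount : π.count w (k + 1) = π.count w k := by simp [π.count_succ, hempty]
      rw [hcount]
      exact ⟨hideal.trans (π.time_mono w (Nat.le_succ k)), hcapacity'⟩
    · have hcount : π.count w (k + 1) = π.count w k + 1 := by
        rw [π.count_succ, le_antisymm (hc k) hne.card_pos]
      have hideal' : idealTime I m E (π.count w k + 1) ≤ π.time w (k + 1) := by
        rw [← hE _ (by omega)] at hcapacity'
        rw [← ENNReal.coe_toNNReal ht] at hcapacity' ⊢
        exact idealTime_succ_le (π.one_le_rate w hne ht) hcapacity'
      rw [hcount, π.work_succ, Function.update_of_ne (by omega), π.work_eq_zero w (by omega),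
        add_zero]
      exact ⟨hideal', capacity_mono I m _ hideal'⟩

variable {π w}

lemma Policy.capacity_succ_of_workConserving {k : ℕ} (ht : π.time w k ≠ ⊤)
    (hwc : ∀ j, π.decision w k j = none → π.waiting w k = ∅) :
    capacity I m (π.count w k) (π.time w (k + 1)) = capacity I m (π.count w k) (π.time w k) +
      (π.busy (π.visible w k)).card * π.gap w k := by
  rw [π.capacity_succ w ht, π.card_busy_eq w ht hwc]

lemma Policy.capacity_time_le (hc : ∀ k, (π.completing w k).card ≤ 1)
    (hwc : ∀ k, π.time w k ≠ ⊤ → ∀ j, π.decision w k j = none → π.waiting w k = ∅)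
    {E : ℕ → ℝ≥0∞} {k : ℕ} (ht : π.time w k ≠ ⊤) (hE : ∀ i < π.count w k, E i = π.work w k i) :
    capacity I m (π.count w k) (π.time w k) ≤
      capacity I m (π.count w k) (idealTime I m E (π.count w k)) +
        π.work w k (π.count w k) := by
  induction k with
  | zero => simp [Policy.count, Policy.work, Policy.record, idealTime, π.time_zero]
  | succ k ih =>
    have ht' := π.time_ne_top_of_le w (Nat.le_succ k) ht
    have hcapacity : capacity I m (π.count w k) (π.time w (k + 1)) ≤
        capacity I m (π.count w k) (idealTime I m E (π.count w k)) +
          π.work w (k + 1) (π.count w k) := by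
      rw [π.work_succ_count, Policy.capacity_succ_of_workConserving ht' (hwc k ht'), ← add_assoc]
      gcongr
      exact ih ht' (π.work_eq_of_succ w hE)
    rcases Finset.eq_empty_or_nonempty (π.completing w k) with hempty | hne
    · have hcount : π.count w (k + 1) = π.count w k := by simp [π.count_succ, hempty]
      rwa [hcount]
    · have hcount : π.count w (k + 1) = π.count w k + 1 := by
        rw [π.count_succ, le_antisymm (hc k) hne.card_pos]
      rw [← hE _ (by omega)] at hcapacity
      rw [hcount]
      exact le_add_right (capacity_mono I m _ (le_idealTime_succ hcapacity))

theorem Policy.time_le_idealTime (hc : ∀ k, (π.completing w k).card ≤ 1)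
    (hwc : ∀ k, π.time w k ≠ ⊤ → ∀ j, π.decision w k j = none → π.waiting w k = ∅)
    {E : ℕ → ℝ≥0∞} {k : ℕ} (ht : π.time w k ≠ ⊤) (hE : ∀ i < π.count w k, E i = π.work w k i)
    (hE' : π.work w (k + 1) (π.count w k) ≤ E (π.count w k)) :
    π.time w (k + 1) ≤ idealTime I m E (π.count w k + 1) := by
  refine le_idealTime_succ ?_
  rw [Policy.capacity_succ_of_workConserving ht (hwc k ht)]
  refine (add_le_add_left (Policy.capacity_time_le hc hwc ht hE) _).trans ?_
  rw [add_assoc, ← π.work_succ_count]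
  gcongr

lemma le_combine (r : ℕ × (ℕ → ℝ≥0∞)) (Z : ℕ → ℝ≥0∞) (i : ℕ) : r.2 i ≤ combine r Z i := by
  rw [combine]
  split_ifs
  · exact le_rfl
  · exact le_self_add

lemma Policy.combine_record_of_lt_count {k K : ℕ} (hk : k ≤ K) (Z : ℕ → ℝ≥0∞) {i : ℕ}
    (hi : i < π.count w k) : combine (π.record K (π.visible w K)) Z i = π.work w k i :=
  (if_pos (hi.trans_le (π.count_mono w hk))).trans (π.work_stable w hk hi)

lemma Policy.deliveredCount_le_arrivalCount (π : Policy I m Ξ) (w : Outcome m Ξ) (t : ℝ≥0) :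
    π.deliveredCount w t ≤ I.arrivalCount t :=
  Set.ncard_le_ncard (fun i hi =>
    ⟨hi.1, ENNReal.coe_le_coe.1 ((π.arr_le_completion w i).trans hi.2)⟩) (I.finite_arrivals t)

theorem Policy.deliveredCount_le_idealCount (hc : ∀ k, (π.completing w k).card ≤ 1) {K : ℕ}
    {t : ℝ≥0} (ht : t < π.time w K) (Z : ℕ → ℝ≥0∞) :
    π.deliveredCount w t ≤ idealCount I m (combine (π.record K (π.visible w K)) Z) t := by
  obtain ⟨k, hkK, hk, hk'⟩ := π.exists_epoch w ht
  have hcount := π.deliveredCount_eq_count w hk hk'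
  have hideal := (π.idealTime_le_time w hc (combine (π.record K (π.visible w K)) Z)
    (ne_top_of_le_ne_top ENNReal.coe_ne_top hk)
    fun i hi => Policy.combine_record_of_lt_count hkK.le Z hi).1
  rw [hcount]
  exact le_idealCount (hcount ▸ π.deliveredCount_le_arrivalCount w t) (hideal.trans hk)

theorem Policy.idealCount_le_deliveredCount (hc : ∀ k, (π.completing w k).card ≤ 1)
    (hwc : ∀ k, π.time w k ≠ ⊤ → ∀ j, π.decision w k j = none → π.waiting w k = ∅) {K : ℕ}
    {t : ℝ≥0} (ht : t < π.time w K) (Z : ℕ → ℝ≥0∞) :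
    idealCount I m (combine (π.record K (π.visible w K)) Z) t ≤ π.deliveredCount w t := by
  obtain ⟨k, hkK, hk, hk'⟩ := π.exists_epoch w ht
  have hideal := Policy.time_le_idealTime hc hwc (E := combine (π.record K (π.visible w K)) Z)
    (ne_top_of_le_ne_top ENNReal.coe_ne_top hk)
    (fun i hi => Policy.combine_record_of_lt_count hkK.le Z hi)
    ((π.work_mono w (Nat.succ_le_of_lt hkK) _).trans (le_combine _ Z _))
  rw [π.deliveredCount_eq_count w hk hk']
  exact idealCount_le (hk'.trans_le hideal)

end Comparison

section CountMeasurability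

variable {m : ℕ} {I : Input} {Ξ : Type*} [MeasurableSpace Ξ] (π : Policy I m Ξ)

lemma Policy.measurable_obs (k : ℕ) : Measurable fun w : Outcome m Ξ => π.obs w k :=
  (measurable_pi_apply (Fin.last k)).comp (measurable_snd.comp (π.measurable_visible k))

lemma Policy.measurable_time (k : ℕ) : Measurable fun w : Outcome m Ξ => π.time w k :=
  measurable_fst.comp (π.measurable_obs k)

lemma Policy.completion_eq_iInf (w : Outcome m Ξ) (i : ℕ) :
    π.completion w i =
      ⨅ k, ⨅ j, if (π.obs w k).delivered j = some i then π.time w k else ⊤ := by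
  refine le_antisymm (le_iInf fun k => le_iInf fun j => ?_) (le_sInf ?_)
  · split_ifs with h
    · exact sInf_le ⟨k, j, h, rfl⟩
    · exact le_top
  · rintro _ ⟨k, j, h, rfl⟩
    refine (iInf_le _ k).trans ((iInf_le _ j).trans ?_)
    rw [if_pos h]
    rfl

lemma Policy.measurable_completion (i : ℕ) :
    Measurable fun w : Outcome m Ξ => π.completion w i := by
  simp only [π.completion_eq_iInf]
  refine Measurable.iInf fun k => Measurable.iInf fun j => Measurable.ite ?_ (π.measurable_time k)
    measurable_const
  exact ((measurable_pi_apply j).comp ((measurable_fst.comp measurable_snd).comp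
    (π.measurable_obs k))) (MeasurableSet.of_discrete (s := {some i}))

lemma Policy.deliveredCount_eq_sum (w : Outcome m Ξ) (t : ℝ≥0) :
    π.deliveredCount w t =
      ∑ i ∈ (I.finite_arrivals t).toFinset, if π.completion w i ≤ t then 1 else 0 := by
  rw [← Finset.card_filter, ← Set.ncard_coe_finset, Policy.deliveredCount]
  congr 1
  ext i
  simp only [Set.mem_ofPred_eq, Finset.coe_filter, Set.Finite.mem_toFinset]
  exact ⟨fun h => ⟨⟨h.1, ENNReal.coe_le_coe.1 ((π.arr_le_completion w i).trans h.2)⟩, h.2⟩,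
    fun h => ⟨h.1.1, h.2⟩⟩

lemma Policy.measurable_deliveredCount (t : ℝ≥0) :
    Measurable fun w : Outcome m Ξ => π.deliveredCount w t := by
  simp only [π.deliveredCount_eq_sum]
  refine Finset.measurable_sum _ fun i _ => ?_
  exact Measurable.ite ((π.measurable_completion i) measurableSet_Iic) measurable_const
    measurable_const

lemma Policy.queueLength_eq_sub (w : Outcome m Ξ) (t : ℝ≥0) :
    π.queueLength w t = I.arrivalCount t - π.deliveredCount w t := by
  have hsub : {i : ℕ | (i : ℕ∞) < I.n ∧ π.completion w i ≤ t} ⊆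
      {i : ℕ | (i : ℕ∞) < I.n ∧ I.arr i ≤ t} := fun i hi =>
    ⟨hi.1, ENNReal.coe_le_coe.1 ((π.arr_le_completion w i).trans hi.2)⟩
  rw [Input.arrivalCount, Policy.deliveredCount,
    ← Set.ncard_sdiff hsub ((I.finite_arrivals t).subset hsub), Policy.queueLength]
  congr 1
  ext i
  simp only [Set.mem_ofPred_eq, Set.mem_sdiff, not_and, not_le]
  exact ⟨fun h => ⟨⟨h.1, h.2.1⟩, fun _ => h.2.2⟩, fun h => ⟨h.1.1, h.1.2, h.2 h.1.1⟩⟩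

end CountMeasurability

section StochasticOrder

lemma measure_le_add_of_ae {Ω : Type*} [MeasurableSpace Ω] {P : Measure Ω} {A B C : Set Ω}
    (h : ∀ᵐ ω ∂P, ω ∉ C → ω ∈ A → ω ∈ B) : P A ≤ P B + P C := by
  refine (measure_mono_ae ?_).trans (measure_union_le B C)
  filter_upwards [h] with ω hω hA
  exact or_iff_not_imp_right.2 fun hC => hω hC hA

lemma measure_prod_preimage_fst {Ω Ω' : Type*} [MeasurableSpace Ω] [MeasurableSpace Ω']
    (P : Measure Ω) (ν : Measure Ω') [IsProbabilityMeasure ν] (A : Set Ω) :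
    (P.prod ν) (Prod.fst ⁻¹' A) = P A := by
  rw [← Set.prod_univ, Measure.prod_prod, measure_univ, mul_one]

lemma measure_ext_of_isUpperSet {α : Type*} [PartialOrder α] [Countable α] [MeasurableSpace α]
    [MeasurableSingletonClass α] {μ ν : Measure α} [IsFiniteMeasure μ]
    (h : ∀ U : Set α, IsUpperSet U → μ U = ν U) : μ = ν := by
  refine Measure.ext_of_singleton fun x => ?_
  have hmeas : NullMeasurableSet (Set.Ioi x) μ ∧ NullMeasurableSet (Set.Ioi x) ν :=
    ⟨MeasurableSet.of_discrete.nullMeasurableSet, MeasurableSet.of_discrete.nullMeasurableSet⟩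
  rw [← Set.Ici_sdiff_Ioi_same, measure_sdiff Set.Ioi_subset_Ici_self hmeas.1 (measure_ne_top μ _),
    measure_sdiff Set.Ioi_subset_Ici_self hmeas.2 (h _ (isUpperSet_Ioi x) ▸ measure_ne_top μ _),
    h _ (isUpperSet_Ici x), h _ (isUpperSet_Ioi x)]

lemma le_of_tendsto_add_zero {a b : ℝ≥0∞} {u : ℕ → ℝ≥0∞} (hu : Tendsto u atTop (𝓝 0))
    (h : ∀ K, a ≤ b + u K) : a ≤ b := by
  simpa only [add_zero] using ge_of_tendsto' (hu.const_add b) h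

variable {Ω : Type*} [MeasurableSpace Ω] {P : Measure Ω} {X Y : ℝ≥0 → Ω → ℕ}

lemma StochLE.lintegral_le (h : StochLE P X Y) {t : ℝ≥0} (hX : Measurable (X t))
    (hY : Measurable (Y t)) : ∫⁻ ω, (X t ω : ℝ≥0∞) ∂P ≤ ∫⁻ ω, (Y t ω : ℝ≥0∞) ∂P := by
  have hlayer : ∀ Z : Ω → ℕ, Measurable Z →
      ∫⁻ ω, (Z ω : ℝ≥0∞) ∂P = ∫⁻ x in Set.Ioi (0 : ℝ), P {ω | x < Z ω} := fun Z hZ => by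
    rw [← lintegral_eq_lintegral_meas_lt P (Eventually.of_forall fun ω => Nat.cast_nonneg (Z ω))
      (measurable_from_top.comp hZ).aemeasurable]
    simp only [ENNReal.ofReal_natCast]
  rw [hlayer _ hX, hlayer _ hY]
  have hupper : ∀ x : ℝ, IsUpperSet {u : Fin 1 → ℕ | x < (u 0 : ℝ)} := fun x u u' huu' hu =>
    lt_of_lt_of_le (Set.mem_ofPred_eq ▸ hu) (Nat.cast_le.2 (huu' 0))
  exact lintegral_mono fun x => h 1 (fun _ => t) (Subsingleton.strictMono _) _ (hupper x)

lemma StochLE.const_tsub [IsProbabilityMeasure P] (h : StochLE P X Y)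
    (hX : ∀ t, Measurable (X t)) (hY : ∀ t, Measurable (Y t)) (a : ℝ≥0 → ℕ) :
    StochLE P (fun t ω => a t - Y t ω) (fun t ω => a t - X t ω) := by
  intro r t ht U hU
  have hV : IsUpperSet {g : Fin r → ℕ | (fun l => a (t l) - g l) ∉ U} := fun g g' hgg' hg hg' =>
    hg (hU (fun l => Nat.sub_le_sub_left (hgg' l) _) hg')
  have hcompl : ∀ Z : ℝ≥0 → Ω → ℕ, (∀ t, Measurable (Z t)) →
      P {ω | (fun l => a (t l) - Z (t l) ω) ∈ U} =
        1 - P {ω | (fun l => Z (t l) ω) ∈ {g : Fin r → ℕ | (fun l => a (t l) - g l) ∉ U}} :=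
    fun Z hZ => by
      have hZt : Measurable fun ω l => Z (t l) ω := measurable_pi_iff.2 fun l => hZ (t l)
      refine Eq.trans ?_ (prob_compl_eq_one_sub (hZt MeasurableSet.of_discrete))
      congr 1
      ext ω
      simp only [Set.mem_ofPred_eq, Set.mem_compl_iff, not_not]
  rw [hcompl Y hY, hcompl X hX]
  exact tsub_le_tsub_left (h r t ht _ hV) 1

end StochasticOrder

section DeliveryProcess

variable {m : ℕ} {I : Input} {Ξ : Type*} [MeasurableSpace Ξ] {Ω : Type*} [MeasurableSpace Ω]
  {P : Measure Ω} {W : Ω → Outcome m Ξ}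

lemma Policy.tendsto_measure_time_le [IsFiniteMeasure P] (hWm : Measurable W) (π : Policy I m Ξ)
    (hπ : π.Admissible P W) (T : ℝ≥0) :
    Tendsto (fun K => P {ω | π.time (W ω) K ≤ T}) atTop (𝓝 0) := by
  have hzero : P (⋂ K, {ω | π.time (W ω) K ≤ T}) = 0 := by
    refine measure_mono_null ?_ (ae_iff.1 hπ)
    intro ω hω hlim
    obtain ⟨K, hK⟩ := (hlim.eventually (lt_mem_nhds (ENNReal.coe_lt_top (r := T)))).exists
    exact (Set.mem_iInter.1 hω K).not_gt hK
  rw [← hzero]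
  refine tendsto_measure_iInter_atTop (fun K => ?_) ?_ ⟨0, measure_ne_top _ _⟩
  · exact (((π.measurable_time K).comp hWm) measurableSet_Iic).nullMeasurableSet
  · exact fun K K' h ω hω => (π.time_mono (W ω) h).trans hω

variable [IsProbabilityMeasure P] {ρ : Measure ℝ≥0∞} [IsProbabilityMeasure ρ] [NullSingletonClass ρ]

lemma Policy.measure_combine_preimage (hρ : Memoryless ρ) (hW : IsDriven P W ρ)
    (π : Policy I m Ξ) (K : ℕ) {A : Set (ℕ → ℝ≥0∞)} (hA : MeasurableSet A) :
    (P.prod (Measure.infinitePi fun _ : ℕ => ρ))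
        {p | combine (π.record K (π.visible (W p.1) K)) p.2 ∈ A} =
      (Measure.infinitePi fun _ : ℕ => ρ) A := by
  have hm : Measurable fun p : Ω × (ℕ → ℝ≥0∞) =>
      combine (π.record K (π.visible (W p.1) K)) p.2 :=
    measurable_combine.comp (((π.measurable_record K).comp ((π.measurable_visible K).comp
      (hW.measurable.comp measurable_fst))).prodMk measurable_snd)
  conv_rhs => rw [← π.map_combine_record hρ hW K]
  rw [Measure.map_apply hm hA]
  rfl

variable {ι : Type*} [Finite ι]

lemma measurableSet_idealCount_mem (t : ι → ℝ≥0) (U : Set (ι → ℕ)) :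
    MeasurableSet {E : ℕ → ℝ≥0∞ | (fun l => idealCount I m E (t l)) ∈ U} :=
  (measurable_pi_iff.2 fun l => measurable_idealCount I m (t l)) MeasurableSet.of_discrete

theorem Policy.measure_deliveredCount_le (hρ : Memoryless ρ) (hW : IsDriven P W ρ)
    (π : Policy I m Ξ) (hπ : π.Admissible P W) (t : ι → ℝ≥0) {U : Set (ι → ℕ)}
    (hU : IsUpperSet U) :
    P {ω | (fun l => π.deliveredCount (W ω) (t l)) ∈ U} ≤
      (Measure.infinitePi fun _ : ℕ => ρ) {E | (fun l => idealCount I m E (t l)) ∈ U} := by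
  obtain ⟨T, hT⟩ := (Set.finite_range t).bddAbove
  refine le_of_tendsto_add_zero (π.tendsto_measure_time_le hW.measurable hπ T) fun K => ?_
  rw [← π.measure_combine_preimage hρ hW K (measurableSet_idealCount_mem t U),
    ← measure_prod_preimage_fst P (Measure.infinitePi fun _ : ℕ => ρ),
    ← measure_prod_preimage_fst P (Measure.infinitePi fun _ : ℕ => ρ) {ω | π.time (W ω) K ≤ T}]
  refine measure_le_add_of_ae ?_
  filter_upwards [Measure.quasiMeasurePreserving_fst.ae (π.ae_completing_card_le_one hρ hW)]
    with p hc hT' hp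
  exact hU (fun l => Policy.deliveredCount_le_idealCount hc
    ((ENNReal.coe_le_coe.2 (hT ⟨l, rfl⟩)).trans_lt (not_le.1 hT')) p.2) hp

theorem Policy.le_measure_deliveredCount (hρ : Memoryless ρ) (hW : IsDriven P W ρ)
    (π : Policy I m Ξ) (hπ : π.Admissible P W) (hwc : π.WorkConserving P W) (t : ι → ℝ≥0)
    {U : Set (ι → ℕ)} (hU : IsUpperSet U) :
    (Measure.infinitePi fun _ : ℕ => ρ) {E | (fun l => idealCount I m E (t l)) ∈ U} ≤
      P {ω | (fun l => π.deliveredCount (W ω) (t l)) ∈ U} := by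
  obtain ⟨T, hT⟩ := (Set.finite_range t).bddAbove
  refine le_of_tendsto_add_zero (π.tendsto_measure_time_le hW.measurable hπ T) fun K => ?_
  rw [← π.measure_combine_preimage hρ hW K (measurableSet_idealCount_mem t U),
    ← measure_prod_preimage_fst P (Measure.infinitePi fun _ : ℕ => ρ),
    ← measure_prod_preimage_fst P (Measure.infinitePi fun _ : ℕ => ρ) {ω | π.time (W ω) K ≤ T}]
  refine measure_le_add_of_ae ?_
  filter_upwards [Measure.quasiMeasurePreserving_fst.ae (π.ae_completing_card_le_one hρ hW),
    Measure.quasiMeasurePreserving_fst.ae hwc] with p hc hwcp hT' hp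
  exact hU (fun l => Policy.idealCount_le_deliveredCount hc hwcp
    ((ENNReal.coe_le_coe.2 (hT ⟨l, rfl⟩)).trans_lt (not_le.1 hT')) p.2) hp

theorem Policy.measure_deliveredCount_mono (hρ : Memoryless ρ) (hW : IsDriven P W ρ)
    {π π' : Policy I m Ξ} (hπ : π.Admissible P W) (hwc : π.WorkConserving P W)
    (hπ' : π'.Admissible P W) (t : ι → ℝ≥0) {U : Set (ι → ℕ)} (hU : IsUpperSet U) :
    P {ω | (fun l => π'.deliveredCount (W ω) (t l)) ∈ U} ≤
      P {ω | (fun l => π.deliveredCount (W ω) (t l)) ∈ U} :=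
  (π'.measure_deliveredCount_le hρ hW hπ' t hU).trans
    (π.le_measure_deliveredCount hρ hW hπ hwc t hU)

theorem Policy.identDistrib_deliveredCount (hρ : Memoryless ρ) (hW : IsDriven P W ρ)
    {π π' : Policy I m Ξ} (hπ : π.Admissible P W) (hwc : π.WorkConserving P W)
    (hπ' : π'.Admissible P W) (hwc' : π'.WorkConserving P W) :
    IdentDistrib (fun ω (t : ℝ≥0) => π.deliveredCount (W ω) t)
      (fun ω (t : ℝ≥0) => π'.deliveredCount (W ω) t) P P := by
  have hm : ∀ (σ : Policy I m Ξ) {J : Type} (t : J → ℝ≥0),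
      Measurable fun ω l => σ.deliveredCount (W ω) (t l) :=
    fun σ _ t => measurable_pi_iff.2 fun l => (σ.measurable_deliveredCount (t l)).comp hW.measurable
  refine (identDistrib_iff_forall_finset_identDistrib (hm π id).aemeasurable
    (hm π' id).aemeasurable).2 fun J => ?_
  refine ⟨(hm π _).aemeasurable, (hm π' _).aemeasurable, ?_⟩
  change P.map (fun ω (l : J) => π.deliveredCount (W ω) l) =
    P.map (fun ω (l : J) => π'.deliveredCount (W ω) l)
  refine measure_ext_of_isUpperSet fun U hU => ?_
  rw [Measure.map_apply (hm π _) .of_discrete, Measure.map_apply (hm π' _) .of_discrete]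
  exact le_antisymm (Policy.measure_deliveredCount_mono hρ hW hπ' hwc' hπ (fun l : J => l.1) hU)
    (Policy.measure_deliveredCount_mono hρ hW hπ hwc hπ' (fun l : J => l.1) hU)

theorem Policy.identDistrib_queueLength_deliveredCount (hρ : Memoryless ρ) (hW : IsDriven P W ρ)
    {π π' : Policy I m Ξ} (hπ : π.Admissible P W) (hwc : π.WorkConserving P W)
    (hπ' : π'.Admissible P W) (hwc' : π'.WorkConserving P W) :
    IdentDistrib (fun ω (t : ℝ≥0) => (π.queueLength (W ω) t, π.deliveredCount (W ω) t))
      (fun ω (t : ℝ≥0) => (π'.queueLength (W ω) t, π'.deliveredCount (W ω) t)) P P := by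
  have hm : Measurable fun (g : ℝ≥0 → ℕ) (t : ℝ≥0) => (I.arrivalCount t - g t, g t) :=
    measurable_pi_iff.2 fun t => (measurable_from_top (f := fun n : ℕ =>
      (I.arrivalCount t - n, n))).comp (measurable_pi_apply t)
  simp only [Policy.queueLength_eq_sub]
  exact (Policy.identDistrib_deliveredCount hρ hW hπ hwc hπ' hwc').comp hm

theorem Policy.stochLE_deliveredCount (hρ : Memoryless ρ) (hW : IsDriven P W ρ)
    {π π' : Policy I m Ξ} (hπ : π.Admissible P W) (hwc : π.WorkConserving P W)
    (hπ' : π'.Admissible P W) :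
    StochLE P (fun t ω => π'.deliveredCount (W ω) t) (fun t ω => π.deliveredCount (W ω) t) :=
  fun _ t _ _ hU => Policy.measure_deliveredCount_mono hρ hW hπ hwc hπ' t hU

theorem Policy.throughputOptimal_of_workConserving (hρ : Memoryless ρ) (hW : IsDriven P W ρ)
    {π : Policy I m Ξ} (hπ : π.Admissible P W) (hwc : π.WorkConserving P W) :
    π.ThroughputOptimal P W := by
  intro π' hπ'
  have hst := Policy.stochLE_deliveredCount hρ hW hπ hwc hπ'
  have hmean : ∀ T : ℝ≥0, π'.throughput P W T ≤ π.throughput P W T := fun T =>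
    ENNReal.div_le_div_right (hst.lintegral_le ((π'.measurable_deliveredCount T).comp hW.measurable)
      ((π.measurable_deliveredCount T).comp hW.measurable)) _
  exact ⟨hst, fun T _ => hmean T, liminf_le_liminf (Eventually.of_forall hmean),
    limsup_le_limsup (Eventually.of_forall hmean)⟩

end DeliveryProcess

section Delay

variable {m : ℕ} {I : Input} {Ξ : Type*} [MeasurableSpace Ξ] {Ω : Type*} [MeasurableSpace Ω]
  {P : Measure Ω} {W : Ω → Outcome m Ξ}

/-- The times at which packet `i` is in the system. -/
def Policy.sojourn (π : Policy I m Ξ) (w : Outcome m Ξ) (i : ℕ) : Set ℝ≥0 :=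
  {s | (i : ℕ∞) < I.n ∧ I.arr i ≤ s ∧ (s : ℝ≥0∞) < π.completion w i}

lemma Policy.queueLength_eq_tsum (π : Policy I m Ξ) (w : Outcome m Ξ) (s : ℝ≥0) :
    (π.queueLength w s : ℝ≥0∞) = ∑' i, (π.sojourn w i).indicator 1 s := by
  have hfin : {i | s ∈ π.sojourn w i}.Finite :=
    (I.finite_arrivals s).subset fun i hi => ⟨hi.1, hi.2.1⟩
  calc (π.queueLength w s : ℝ≥0∞) = ({i | s ∈ π.sojourn w i}.encard : ℝ≥0∞) := by
        rw [← hfin.cast_ncard_eq]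
        rfl
    _ = ∑' _ : {i | s ∈ π.sojourn w i}, 1 := (ENNReal.tsum_set_one _).symm
    _ = ∑' i, (π.sojourn w i).indicator 1 s := tsum_subtype {i | s ∈ π.sojourn w i} fun _ => 1

section Measurability

variable {α : Type*} [MeasurableSpace α] {f : α → Outcome m Ξ} {g : α → ℝ≥0}

lemma Policy.measurableSet_sojourn (π : Policy I m Ξ) (i : ℕ) (hf : Measurable f)
    (hg : Measurable g) : MeasurableSet {a | g a ∈ π.sojourn (f a) i} :=
  (MeasurableSet.const _).inter ((hg measurableSet_Ici).inter (measurableSet_lt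
    hg.coe_nnreal_ennreal ((π.measurable_completion i).comp hf)))

lemma Policy.measurable_indicator_sojourn (π : Policy I m Ξ) (i : ℕ) (hf : Measurable f)
    (hg : Measurable g) :
    Measurable fun a => (π.sojourn (f a) i).indicator (1 : ℝ≥0 → ℝ≥0∞) (g a) :=
  Measurable.indicator (f := fun _ => (1 : ℝ≥0∞)) measurable_const
    (π.measurableSet_sojourn i hf hg)

lemma Policy.measurable_queueLength (π : Policy I m Ξ) (hf : Measurable f) (hg : Measurable g) :
    Measurable fun a => (π.queueLength (f a) (g a) : ℝ≥0∞) := by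
  simp only [π.queueLength_eq_tsum]
  exact Measurable.tsum fun i => π.measurable_indicator_sojourn i hf hg

end Measurability

open Classical in
lemma Policy.setLIntegral_sojourn (π : Policy I m Ξ) (w : Outcome m Ξ) (T : ℝ≥0∞) (i : ℕ) :
    ∫⁻ s in timesBetween 0 T, (π.sojourn w i).indicator 1 s.toNNReal =
      if (i : ℕ∞) < I.n then min (π.completion w i) T - I.arr i else 0 := by
  split_ifs with hi
  · have hinter : Real.toNNReal ⁻¹' π.sojourn w i ∩ timesBetween 0 T =
        timesBetween (I.arr i) (min (π.completion w i) T) := by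
      ext s
      simp only [Policy.sojourn, hi, true_and, timesBetween, Set.mem_inter_iff, Set.mem_preimage,
        Set.mem_ofPred_eq, lt_min_iff, NNReal.coe_zero]
      constructor
      · rintro ⟨⟨harr, hlt⟩, hs0, hT⟩
        exact ⟨(Real.le_toNNReal_iff_coe_le hs0).1 harr, hlt, hT⟩
      · rintro ⟨harr, hlt, hT⟩
        exact ⟨⟨NNReal.le_toNNReal_of_coe_le harr, hlt⟩, (I.arr i).2.trans harr, hT⟩
    have hm : MeasurableSet (Real.toNNReal ⁻¹' π.sojourn w i) :=
      π.measurableSet_sojourn i measurable_const measurable_real_toNNReal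
    rw [← volume_timesBetween, ← hinter, ← Measure.restrict_apply hm, ← lintegral_indicator_one hm]
    rfl
  · simp [Policy.sojourn, hi]

/-- The expected total time that the packets spend in the system before time `T`. -/
noncomputable def Policy.delayUpTo (π : Policy I m Ξ) (P : Measure Ω) (W : Ω → Outcome m Ξ)
    (T : ℝ≥0∞) : ℝ≥0∞ :=
  open Classical in
  ∑' i : ℕ, if (i : ℕ∞) < I.n then ∫⁻ ω, (min (π.completion (W ω) i) T - I.arr i) ∂P else 0

theorem Policy.delayUpTo_eq_setLIntegral [SFinite P] (hWm : Measurable W) (π : Policy I m Ξ)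
    (T : ℝ≥0∞) :
    π.delayUpTo P W T =
      ∫⁻ s in timesBetween 0 T, ∫⁻ ω, (π.queueLength (W ω) s.toNNReal : ℝ≥0∞) ∂P := by
  have hW' : Measurable fun p : Ω × ℝ => W p.1 := hWm.comp measurable_fst
  have htime : Measurable fun p : Ω × ℝ => p.2.toNNReal :=
    measurable_real_toNNReal.comp measurable_snd
  calc π.delayUpTo P W T
      = ∑' i, ∫⁻ ω, (∫⁻ s in timesBetween 0 T,
          (π.sojourn (W ω) i).indicator (1 : ℝ≥0 → ℝ≥0∞) s.toNNReal) ∂P := by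
        refine tsum_congr fun i => ?_
        simp only [π.setLIntegral_sojourn]
        split_ifs
        · rfl
        · exact lintegral_zero.symm
    _ = ∫⁻ ω, (∫⁻ s in timesBetween 0 T, (π.queueLength (W ω) s.toNNReal : ℝ≥0∞)) ∂P := by
        rw [← lintegral_tsum fun i =>
          (π.measurable_indicator_sojourn i hW' htime).lintegral_prod_right'.aemeasurable]
        refine lintegral_congr fun ω => ?_
        dsimp only
        rw [← lintegral_tsum fun i => (π.measurable_indicator_sojourn i
          (measurable_const (a := W ω)) measurable_real_toNNReal).aemeasurable]
        simp only [π.queueLength_eq_tsum]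
    _ = ∫⁻ s in timesBetween 0 T, ∫⁻ ω, (π.queueLength (W ω) s.toNNReal : ℝ≥0∞) ∂P :=
        lintegral_lintegral_swap (π.measurable_queueLength hW' htime).aemeasurable

lemma Policy.totalDelay_eq (π : Policy I m Ξ) : π.totalDelay P W = π.delayUpTo P W ⊤ := by
  simp only [Policy.totalDelay, Policy.delayUpTo, min_top_right]

lemma Policy.meanDelayUpTo_eq (π : Policy I m Ξ) (T : ℝ≥0) :
    π.meanDelayUpTo P W T = π.delayUpTo P W T / I.arrivalCount T := by
  classical
  rw [Policy.meanDelayUpTo, Policy.delayUpTo]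
  congr 1
  refine tsum_congr fun i => ?_
  by_cases harr : I.arr i ≤ T
  · simp only [harr, and_true]
  · have hzero : ∀ ω, min (π.completion (W ω) i) (T : ℝ≥0∞) - I.arr i = 0 := fun ω =>
      tsub_eq_zero_of_le ((min_le_right _ _).trans (ENNReal.coe_le_coe.2 (not_le.1 harr).le))
    simp only [hzero, lintegral_zero, ite_self]

variable [IsProbabilityMeasure P] {ρ : Measure ℝ≥0∞} [IsProbabilityMeasure ρ] [NullSingletonClass ρ]

theorem Policy.stochLE_queueLength (hρ : Memoryless ρ) (hW : IsDriven P W ρ)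
    {π π' : Policy I m Ξ} (hπ : π.Admissible P W) (hwc : π.WorkConserving P W)
    (hπ' : π'.Admissible P W) :
    StochLE P (fun t ω => π.queueLength (W ω) t) (fun t ω => π'.queueLength (W ω) t) := by
  simp only [Policy.queueLength_eq_sub]
  exact (Policy.stochLE_deliveredCount hρ hW hπ hwc hπ').const_tsub
    (fun t => (π'.measurable_deliveredCount t).comp hW.measurable)
    (fun t => (π.measurable_deliveredCount t).comp hW.measurable) I.arrivalCount

theorem Policy.delayUpTo_mono (hρ : Memoryless ρ) (hW : IsDriven P W ρ)
    {π π' : Policy I m Ξ} (hπ : π.Admissible P W) (hwc : π.WorkConserving P W)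
    (hπ' : π'.Admissible P W) (T : ℝ≥0∞) : π.delayUpTo P W T ≤ π'.delayUpTo P W T := by
  have hm : ∀ (σ : Policy I m Ξ) (t : ℝ≥0), Measurable fun ω => σ.queueLength (W ω) t :=
    fun σ t => by
      simp only [Policy.queueLength_eq_sub]
      exact (measurable_from_top (f := fun n : ℕ => I.arrivalCount t - n)).comp
        ((σ.measurable_deliveredCount t).comp hW.measurable)
  rw [π.delayUpTo_eq_setLIntegral hW.measurable, π'.delayUpTo_eq_setLIntegral hW.measurable]
  exact lintegral_mono fun s =>
    (Policy.stochLE_queueLength hρ hW hπ hwc hπ').lintegral_le (hm π _) (hm π' _)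

theorem Policy.meanDelayOptimal_of_workConserving (hρ : Memoryless ρ) (hW : IsDriven P W ρ)
    {π : Policy I m Ξ} (hπ : π.Admissible P W) (hwc : π.WorkConserving P W) :
    π.MeanDelayOptimal P W := by
  intro π' hπ'
  have hdelay := Policy.delayUpTo_mono hρ hW hπ hwc hπ'
  have hmean : ∀ T : ℝ≥0, π.meanDelayUpTo P W T ≤ π'.meanDelayUpTo P W T := fun T => by
    rw [π.meanDelayUpTo_eq, π'.meanDelayUpTo_eq]
    exact ENNReal.div_le_div_right (hdelay T) _
  have htotal : π.totalDelay P W ≤ π'.totalDelay P W := by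
    rw [π.totalDelay_eq, π'.totalDelay_eq]
    exact hdelay ⊤
  exact ⟨Policy.stochLE_queueLength hρ hW hπ hwc hπ', hmean,
    liminf_le_liminf (Eventually.of_forall hmean), limsup_le_limsup (Eventually.of_forall hmean),
    htotal, fun n _ => ENNReal.div_le_div_right htotal _⟩

end Delay

section Admissibility

variable {m : ℕ} {I : Input} {Ξ : Type*} [MeasurableSpace Ξ]

lemma Input.exists_arr_eq_nextArrival (I : Input) {T : ℝ≥0∞} (h : I.nextArrival T ≠ ⊤) :
    ∃ i : ℕ, (i : ℕ∞) < I.n ∧ T < I.arr i ∧ I.nextArrival T = I.arr i := by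
  set v := I.nextArrival T
  have hlt : sInf {t : ℝ≥0∞ | ∃ i : ℕ, (i : ℕ∞) < I.n ∧ t = I.arr i ∧ T < t} < v + 1 :=
    ENNReal.lt_add_right h one_ne_zero
  obtain ⟨_, ⟨i₀, hi₀, rfl, hT⟩, hi₀v⟩ := sInf_lt_iff.1 hlt
  have hfin : {i ∈ I.arrived (v + 1) | T < I.arr i}.Finite :=
    (I.arrived_finite (ENNReal.add_ne_top.2 ⟨h, ENNReal.one_ne_top⟩)).subset fun i hi => hi.1
  obtain ⟨i, hi, hmin⟩ := Set.exists_min_image _ I.arr hfin ⟨i₀, ⟨hi₀, hi₀v.le⟩, hT⟩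
  refine ⟨i, hi.1.1, hi.2, le_antisymm (sInf_le ⟨i, hi.1.1, rfl, hi.2⟩) (le_sInf ?_)⟩
  rintro _ ⟨i', hi', rfl, hT'⟩
  by_cases hle : (I.arr i' : ℝ≥0∞) ≤ v + 1
  · exact ENNReal.coe_le_coe.2 (hmin i' ⟨⟨hi', hle⟩, hT'⟩)
  · exact hi.1.2.trans (not_le.1 hle).le

lemma Input.ncard_arrived_lt (I : Input) {T : ℝ≥0∞} (h : I.nextArrival T ≠ ⊤) :
    (I.arrived T).ncard < (I.arrived (I.nextArrival T)).ncard := by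
  obtain ⟨i, hi, hlt, heq⟩ := I.exists_arr_eq_nextArrival h
  refine Set.ncard_lt_ncard ?_ (I.arrived_finite h)
  exact (Set.ssubset_iff_of_subset (I.arrived_mono (I.le_nextArrival T))).2
    ⟨i, ⟨hi, heq.ge⟩, fun harr => absurd harr.2 (not_le.2 hlt)⟩

variable {π : Policy I m Ξ} {w : Outcome m Ξ}

lemma Policy.time_succ_eq_nextArrival {k : ℕ} (hc : π.completing w k = ∅)
    (hr : π.review k w.1 (π.run w k).hist = ⊤) :
    π.time w (k + 1) = I.nextArrival (π.time w k) := by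
  have hgap : π.gap w k = I.nextArrival (π.time w k) - π.time w k := by
    have hhorizon : π.gap w k = π.horizon (π.visible w k) := firstTime_of_empty hc
    rw [hhorizon, Policy.horizon]
    exact (congrArg _ hr).trans (min_top_right _)
  rw [π.time_add_gap, hgap, add_tsub_cancel_of_le (I.le_nextArrival _)]

lemma Policy.arrived_add_count_lt {k : ℕ} (ht : π.time w (k + 1) ≠ ⊤)
    (hr : π.review k w.1 (π.run w k).hist = ⊤) :
    (I.arrived (π.time w k)).ncard + π.count w k <
      (I.arrived (π.time w (k + 1))).ncard + π.count w (k + 1) := by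
  have hcount := π.count_succ w k
  by_cases hc : π.completing w k = ∅
  · have htime := Policy.time_succ_eq_nextArrival hc hr
    have harrived := I.ncard_arrived_lt (htime ▸ ht)
    rw [← htime] at harrived
    omega
  · have harrived := Set.ncard_le_ncard (I.arrived_mono (π.time_mono w (Nat.le_add_right k 1)))
      (I.arrived_finite ht)
    have hcompleting := Finset.card_pos.2 (Finset.nonempty_iff_ne_empty.2 hc)
    omega

lemma Policy.count_le_ncard_arrived {k : ℕ} (ht : π.time w k ≠ ⊤) :
    π.count w k ≤ (I.arrived (π.time w k)).ncard := by
  rw [← π.ncard_deliveredSet]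
  exact Set.ncard_le_ncard (π.deliveredSet_subset_arrived w k) (I.arrived_finite ht)

theorem Policy.tendsto_time_of_review_eq_top
    (hr : ∀ k, π.time w k ≠ ⊤ → π.review k w.1 (π.run w k).hist = ⊤) :
    Tendsto (π.time w) atTop (𝓝 ⊤) := by
  rw [ENNReal.tendsto_nhds_top_iff_nnreal]
  intro T
  suffices h : ∃ K, (T : ℝ≥0∞) < π.time w K by
    obtain ⟨K, hK⟩ := h
    filter_upwards [eventually_ge_atTop K] with k hk
    exact hK.trans_le (π.time_mono w hk)
  by_contra! hle
  have ht : ∀ k, π.time w k ≠ ⊤ := fun k => ne_top_of_le_ne_top ENNReal.coe_ne_top (hle k)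
  have hgrow : ∀ k, k ≤ (I.arrived (π.time w k)).ncard + π.count w k := by
    intro k
    induction k with
    | zero => exact Nat.zero_le _
    | succ k ih => exact ih.trans_lt (Policy.arrived_add_count_lt (ht (k + 1)) (hr k (ht k)))
  have hbound : ∀ k, (I.arrived (π.time w k)).ncard ≤ (I.arrived T).ncard := fun k =>
    Set.ncard_le_ncard (I.arrived_mono (hle k)) (I.arrived_finite ENNReal.coe_ne_top)
  set K := 2 * (I.arrived T).ncard + 1
  have hcount := Policy.count_le_ncard_arrived (ht K)
  have := hgrow K
  have := hbound K
  omega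

variable {Ω : Type*} [MeasurableSpace Ω] {P : Measure Ω} {W : Ω → Outcome m Ξ}

lemma Policy.IsPrmpLGFS.admissible (h : π.IsPrmpLGFS P W) : π.Admissible P W := by
  filter_upwards [h] with ω hω
  exact Policy.tendsto_time_of_review_eq_top fun k hk => (hω k hk).1

lemma Policy.IsPrmpLGFS.workConserving (h : π.IsPrmpLGFS P W) : π.WorkConserving P W := by
  filter_upwards [h] with ω hω k hk
  exact (hω k hk).2.1

end Admissibility

section GreedyAssignment

variable {m : ℕ}

lemma exists_subset_card_eq_forall_le {α κ : Type*} [LinearOrder κ] (f : α → κ) (S : Finset α)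
    {n : ℕ} (hn : n ≤ S.card) :
    ∃ T ⊆ S, T.card = n ∧ ∀ x ∈ T, ∀ y ∈ S, y ∉ T → f y ≤ f x := by
  classical
  induction n with
  | zero => exact ⟨∅, Finset.empty_subset _, rfl, fun x hx => absurd hx (Finset.notMem_empty x)⟩
  | succ n ih =>
    obtain ⟨T, hTS, hT, hmax⟩ := ih (Nat.le_of_succ_le hn)
    have hne : (S \ T).Nonempty := Finset.sdiff_nonempty.2 fun h => by
      have := Finset.card_le_card h
      omega
    obtain ⟨y₀, hy₀, hy₀max⟩ := Finset.exists_max_image (S \ T) f hne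
    rw [Finset.mem_sdiff] at hy₀
    refine ⟨insert y₀ T, Finset.insert_subset hy₀.1 hTS, ?_, ?_⟩
    · rw [Finset.card_insert_of_notMem hy₀.2, hT]
    · intro x hx y hy hyT
      rw [Finset.mem_insert, not_or] at hyT
      rcases Finset.mem_insert.1 hx with rfl | hx
      · exact hy₀max y (Finset.mem_sdiff.2 ⟨hy, hyT.2⟩)
      · exact hmax x hx y hy hyT.2

/-- No packet is served by two servers in the assignment `s` of packets to servers. -/
def NoDoubleService (s : Fin m → Option ℕ) : Prop :=
  ∀ j l i, s j = some i → s l = some i → j = l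

/-- The assignment `a` puts exactly the packets in `T` in service, without moving those that are in
service under `s`, and idles a server only if there are more servers than packets. -/
structure IsAssignmentOf (T : Finset ℕ) (s a : Fin m → Option ℕ) : Prop where
  mem : ∀ j i, a j = some i → i ∈ T
  noDoubleService : NoDoubleService a
  exists_server : ∀ i ∈ T, ∃ j, a j = some i
  keep : ∀ j, ∀ i ∈ T, s j = some i → a j = some i
  card_lt_of_idle : ∀ j, a j = none → T.card < m

-- The summand `Finset.range (m - T.card)` stands for the idle servers.
lemma exists_equiv_disjSum_of_noDoubleService {T : Finset ℕ} (hT : T.card ≤ m)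
    {s : Fin m → Option ℕ} (hs : NoDoubleService s) :
    ∃ g : Fin m ≃ T.disjSum (Finset.range (m - T.card)),
      ∀ j, ∀ i ∈ T, s j = some i → (g j : ℕ ⊕ ℕ) = Sum.inl i := by
  have hcard : Fintype.card (Fin m) = (T.disjSum (Finset.range (m - T.card))).card := by
    rw [Finset.card_disjSum, Finset.card_range, Fintype.card_fin]
    omega
  set f : Fin m → ℕ ⊕ ℕ := fun j => (s j).elim (Sum.inr 0) Sum.inl
  have hf {j : Fin m} {i : ℕ} (hji : s j = some i) : f j = Sum.inl i := by simp [f, hji]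
  have hmaps : Set.MapsTo f {j | ∃ i ∈ T, s j = some i}
      (T.disjSum (Finset.range (m - T.card))) := by
    rintro j ⟨i, hi, hji⟩
    rw [hf hji]
    exact Finset.inl_mem_disjSum.2 hi
  have hinj : Set.InjOn f {j | ∃ i ∈ T, s j = some i} := by
    rintro j ⟨i, -, hji⟩ j' ⟨i', -, hji'⟩ hjj'
    rw [hf hji, hf hji'] at hjj'
    obtain rfl := Sum.inl_injective hjj'
    exact hs j j' i hji hji'
  obtain ⟨g, hg⟩ := hmaps.exists_equiv_extend_of_card_eq hcard hinj
  exact ⟨g, fun j i hi hji => (hg j ⟨i, hi, hji⟩).trans (hf hji)⟩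

lemma exists_isAssignmentOf {T : Finset ℕ} (hT : T.card ≤ m) {s : Fin m → Option ℕ}
    (hs : NoDoubleService s) : ∃ a : Fin m → Option ℕ, IsAssignmentOf T s a := by
  obtain ⟨g, hg⟩ := exists_equiv_disjSum_of_noDoubleService hT hs
  have hsome {j : Fin m} {i : ℕ} :
      (g j : ℕ ⊕ ℕ).getLeft? = some i ↔ (g j : ℕ ⊕ ℕ) = Sum.inl i := Sum.getLeft?_eq_some_iff
  refine ⟨fun j => (g j : ℕ ⊕ ℕ).getLeft?, fun j i h => ?_, fun j j' i h h' => ?_, fun i hi => ?_,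
    fun j i hi hji => hsome.2 (hg j i hi hji), fun j h => ?_⟩
  · exact Finset.inl_mem_disjSum.1 (hsome.1 h ▸ (g j).2)
  · exact g.injective (Subtype.ext ((hsome.1 h).trans (hsome.1 h').symm))
  · refine ⟨g.symm ⟨Sum.inl i, Finset.inl_mem_disjSum.2 hi⟩, hsome.2 ?_⟩
    rw [Equiv.apply_symm_apply]
  · obtain ⟨l, hl⟩ := Sum.isRight_iff.1 (Sum.getLeft?_eq_none_iff.1 h)
    have hlt := Finset.mem_range.1 (Finset.inr_mem_disjSum.1 (hl ▸ (g j).2))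
    omega

/-- The requirements of the preemptive Last Generated First Served rule on the assignment `a`, when
`S` is the set of packets in the system and `s` the packets under service. -/
structure IsLGFSAssignment (I : Input) (S : Finset ℕ) (s a : Fin m → Option ℕ) : Prop where
  idle : ∀ j, a j = none → ∀ i ∈ S, ∃ j', a j' = some i
  fresh : ∀ j i, a j = some i → ∀ i' ∈ S, (∀ j', a j' ≠ some i') → I.gen i' ≤ I.gen i
  preempt : ∀ j i, s j = some i → a j = some i ∨
    ((∀ j', a j' ≠ some i) ∧ ∃ i', a j = some i' ∧ I.gen i < I.gen i')

open Classical in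
/-- The priority of packet `i` when `s` are the packets under service: by generation time, and among
packets generated at the same time in favour of those under service, so that ties never cause a
preemption. -/
noncomputable def Input.priority (I : Input) (s : Fin m → Option ℕ) (i : ℕ) : ℝ≥0 ×ₗ ℕ :=
  toLex (I.gen i, if ∃ j, s j = some i then 1 else 0)

lemma Input.gen_le_of_priority_le {I : Input} {s : Fin m → Option ℕ} {i i' : ℕ}
    (h : I.priority s i ≤ I.priority s i') : I.gen i ≤ I.gen i' :=
  Prod.Lex.monotone_fst_ofLex h

lemma Input.gen_lt_of_priority_le {I : Input} {s : Fin m → Option ℕ} {i i' : ℕ}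
    (h : I.priority s i ≤ I.priority s i') (hi : ∃ j, s j = some i) (hi' : ¬∃ j, s j = some i') :
    I.gen i < I.gen i' := by
  rcases Prod.Lex.le_iff.1 h with hlt | ⟨-, hle⟩
  · exact hlt
  · simp [Input.priority, hi, hi'] at hle

lemma IsAssignmentOf.isLGFSAssignment {I : Input} {S T : Finset ℕ} {s a : Fin m → Option ℕ}
    (ha : IsAssignmentOf T s a) (hTS : T ⊆ S) (hT : T.card = min m S.card)
    (hmax : ∀ i ∈ T, ∀ i' ∈ S, i' ∉ T → I.priority s i' ≤ I.priority s i)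
    (hsS : ∀ j i, s j = some i → i ∈ S) : IsLGFSAssignment I S s a := by
  have hfull {j : Fin m} (hj : a j = none) : T = S := by
    have := ha.card_lt_of_idle j hj
    exact Finset.eq_of_subset_of_card_le hTS (by omega)
  refine ⟨fun j hj i hi => ha.exists_server i ((hfull hj).symm ▸ hi),
    fun j i hji i' hi' hwait => ?_, fun j i hji => ?_⟩
  · have hi'T : i' ∉ T := fun h => (ha.exists_server i' h).elim hwait
    exact Input.gen_le_of_priority_le (hmax i (ha.mem j i hji) i' hi' hi'T)
  · by_cases hiT : i ∈ T
    · exact Or.inl (ha.keep j i hiT hji)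
    obtain ⟨i', hi'⟩ : ∃ i', a j = some i' :=
      Option.ne_none_iff_exists'.1 fun hnone => hiT (hfull hnone ▸ hsS j i hji)
    have hi'T := ha.mem j i' hi'
    have hnew : ¬∃ j', s j' = some i' := by
      rintro ⟨j', hj'⟩
      obtain rfl := ha.noDoubleService j j' i' hi' (ha.keep j' i' hi'T hj')
      obtain rfl := Option.some_injective _ (hji.symm.trans hj')
      exact hiT hi'T
    exact Or.inr ⟨fun j' hj' => hiT (ha.mem j' i hj'), i', hi',
      Input.gen_lt_of_priority_le (hmax i' hi'T i (hsS j i hji) hiT) ⟨j, hji⟩ hnew⟩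

lemma exists_isLGFSAssignment (I : Input) (S : Finset ℕ) (s : Fin m → Option ℕ) :
    ∃ a : Fin m → Option ℕ, (∀ j i, a j = some i → i ∈ S) ∧ NoDoubleService a ∧
      (NoDoubleService s → (∀ j i, s j = some i → i ∈ S) → IsLGFSAssignment I S s a) := by
  by_cases hs : NoDoubleService s
  · obtain ⟨T, hTS, hT, hmax⟩ := exists_subset_card_eq_forall_le (I.priority s) S
      (min_le_right m S.card)
    obtain ⟨a, ha⟩ := exists_isAssignmentOf (hT ▸ min_le_left m S.card) hs
    exact ⟨a, fun j i h => hTS (ha.mem j i h), ha.noDoubleService,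
      fun _ => ha.isLGFSAssignment hTS hT hmax⟩
  · exact ⟨fun _ => none, fun _ _ h => absurd h (Option.some_ne_none _).symm,
      fun _ _ _ h => absurd h (Option.some_ne_none _).symm, fun h => absurd h hs⟩

end GreedyAssignment

section LGFSPolicy

variable {m : ℕ} {I : Input} {Ξ : Type*} [MeasurableSpace Ξ]

open Classical in
/-- The packets in the system as a finite set; a history with current time `⊤` gets the empty set,
since infinitely many packets may have arrived by then. -/
noncomputable def Input.systemFinset (I : Input) {k : ℕ} (h : Hist m k) : Finset ℕ :=
  if ht : h.now.time ≠ ⊤ then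
    ((I.arrived_finite ht).subset
      (fun _ hi => ⟨hi.1, hi.2.1⟩ : I.inSystem h ⊆ I.arrived h.now.time)).toFinset
  else ∅

lemma Input.mem_systemFinset {k : ℕ} {h : Hist m k} {i : ℕ} :
    i ∈ I.systemFinset h ↔ h.now.time ≠ ⊤ ∧ i ∈ I.inSystem h := by
  rw [Input.systemFinset]
  split_ifs with ht <;> simp [ht]

lemma Input.measurable_systemFinset (I : Input) (k : ℕ) :
    Measurable (I.systemFinset : Hist m k → Finset ℕ) := by
  refine measurable_finset_iff.2 fun i => ?_
  have hundelivered : MeasurableSet {h : Hist m k | ∀ l j, (h l).delivered j ≠ some i} := by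
    simp only [Set.ofPred_forall]
    exact MeasurableSet.iInter fun l => MeasurableSet.iInter fun j =>
      measurable_delivered l j (MeasurableSet.of_discrete (s := {some i}ᶜ))
  simp only [Input.mem_systemFinset]
  exact (measurable_now_time (measurableSet_singleton ⊤).compl).inter
    ((MeasurableSet.const _).inter ((measurable_now_time measurableSet_Ici).inter hundelivered))

/-- A preemptive Last Generated First Served policy. -/
noncomputable def lgfsPolicy (I : Input) (m : ℕ) (Ξ : Type*) [MeasurableSpace Ξ] :
    Policy I m Ξ where
  assign _ _ h := (exists_isLGFSAssignment I (I.systemFinset h) h.now.serving).choose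
  review _ _ _ := ⊤
  measurable_assign k := by
    have hstate : Measurable fun p : Ξ × Hist m k => (I.systemFinset p.2, p.2.now.serving) :=
      ((I.measurable_systemFinset k).comp measurable_snd).prodMk
        (measurable_pi_iff.2 fun j => (measurable_now_serving j).comp measurable_snd)
    exact (measurable_of_countable fun q : Finset ℕ × (Fin m → Option ℕ) =>
      (exists_isLGFSAssignment I q.1 q.2).choose).comp hstate
  measurable_review _ := measurable_const
  review_pos _ _ _ := ENNReal.zero_lt_top
  assign_mem _ _ h _ j i hji := (Input.mem_systemFinset.1
    ((exists_isLGFSAssignment I (I.systemFinset h) h.now.serving).choose_spec.1 j i hji)).2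
  assign_inj _ _ h _ :=
    (exists_isLGFSAssignment I (I.systemFinset h) h.now.serving).choose_spec.2.1

variable {π : Policy I m Ξ} {w : Outcome m Ξ} {k : ℕ}

lemma Policy.serving_mem_inSystem (ht : π.time w k ≠ ⊤) {j : Fin m} {i : ℕ}
    (h : (π.run w k).hist.now.serving j = some i) : i ∈ I.inSystem (π.run w k).hist := by
  cases k with
  | zero => exact absurd h (Option.some_ne_none i).symm
  | succ k =>
    have ht' := π.time_ne_top_of_le w (Nat.le_succ k) ht
    rw [π.serving_succ] at h
    split_ifs at h with hj
    have hi := π.served_subset_inSystem w ht' ⟨j, h⟩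
    rw [π.inSystem_run] at hi ⊢
    refine ⟨I.arrived_mono (π.time_mono w (Nat.le_succ k)) hi.1, ?_⟩
    rw [π.deliveredSet_succ]
    rintro (hd | ⟨j', hj', hd⟩)
    · exact hi.2 hd
    · exact hj ((π.assign_inj k w.1 _ ht' j j' i h hd) ▸ hj')

lemma Policy.noDoubleService_serving (ht : π.time w k ≠ ⊤) :
    NoDoubleService (π.run w k).hist.now.serving := by
  intro j j' i h h'
  cases k with
  | zero => exact absurd h (Option.some_ne_none i).symm
  | succ k =>
    rw [π.serving_succ] at h h'
    split_ifs at h h'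
    exact π.assign_inj k w.1 _ (π.time_ne_top_of_le w (Nat.le_succ k) ht) j j' i h h'

theorem isPrmpLGFS_lgfsPolicy {Ω : Type*} [MeasurableSpace Ω] (P : Measure Ω)
    (W : Ω → Outcome m Ξ) : (lgfsPolicy I m Ξ).IsPrmpLGFS P W := by
  refine Eventually.of_forall fun ω k ht => ⟨rfl, ?_⟩
  set π := lgfsPolicy I m Ξ
  set h := (π.run (W ω) k).hist
  have hmem {i : ℕ} : i ∈ I.systemFinset h ↔ i ∈ I.inSystem h :=
    Input.mem_systemFinset.trans (and_iff_right ht)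
  have hlgfs : IsLGFSAssignment I (I.systemFinset h) h.now.serving (π.decision (W ω) k) :=
    (exists_isLGFSAssignment I (I.systemFinset h) h.now.serving).choose_spec.2.2
      (Policy.noDoubleService_serving ht)
      fun _ _ hji => hmem.2 (Policy.serving_mem_inSystem ht hji)
  refine ⟨fun j hj => ?_, fun j i hj i' hi' => ?_, fun j i hj => ?_⟩
  · refine Set.eq_empty_iff_forall_notMem.2 fun i hi => ?_
    obtain ⟨j', hj'⟩ := hlgfs.idle j hj i (hmem.2 hi.1)
    exact hi.2 j' hj'
  · exact hlgfs.fresh j i hj i' (hmem.2 hi'.1) hi'.2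
  · exact (hlgfs.preempt j i hj).imp_right fun ⟨hwait, hfresher⟩ =>
      ⟨⟨Policy.serving_mem_inSystem ht hj, hwait⟩, hfresher⟩

end LGFSPolicy

end UpdateSystem

theorem theorem2 {Ω Ξ : Type*} [MeasurableSpace Ω] [MeasurableSpace Ξ]
    (P : Measure Ω) [IsProbabilityMeasure P]
    (m : ℕ) (I : UpdateSystem.Input) (μ : ℝ) (hμ : 0 < μ)
    (seed : Ω → Ξ) (hseed : Measurable seed)
    (X : ℕ → Fin m → Ω → ℝ) (hX : ∀ k j, Measurable (X k j))
    (hX_exp : ∀ k j, P.map (X k j) = expMeasure μ)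
    (hX_indep : iIndepFun (fun p : ℕ × Fin m => X p.1 p.2) P)
    (hX_seed : IndepFun seed (fun ω k j => X k j ω) P)
    (W : Ω → UpdateSystem.Outcome m Ξ) (hW : ∀ ω, W ω = (seed ω, fun k j => X k j ω)) :
    (∃ π : UpdateSystem.Policy I m Ξ, π.IsPrmpLGFS P W) ∧
    (∀ π : UpdateSystem.Policy I m Ξ, π.IsPrmpLGFS P W →
      π.Admissible P W ∧ π.WorkConserving P W ∧
      π.ThroughputOptimal P W ∧ π.MeanDelayOptimal P W) ∧
    (∀ π π' : UpdateSystem.Policy I m Ξ,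
      π.Admissible P W → π.WorkConserving P W → π'.Admissible P W → π'.WorkConserving P W →
      IdentDistrib
        (fun ω (t : ℝ≥0) => (π.queueLength (W ω) t, π.deliveredCount (W ω) t))
        (fun ω (t : ℝ≥0) => (π'.queueLength (W ω) t, π'.deliveredCount (W ω) t)) P P) ∧
    (∀ π : UpdateSystem.Policy I m Ξ, π.Admissible P W → π.WorkConserving P W →
      π.ThroughputOptimal P W ∧ π.MeanDelayOptimal P W) := by
  have hprob := UpdateSystem.isProbabilityMeasure_serviceLaw hμ
  have hnull := UpdateSystem.nullSingletonClass_serviceLaw hμ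
  have hρ := UpdateSystem.memoryless_serviceLaw hμ
  have hdriven := UpdateSystem.isDriven_of_iIndepFun hseed hX hX_exp hX_indep hX_seed hW
  have hopt : ∀ π : UpdateSystem.Policy I m Ξ, π.Admissible P W → π.WorkConserving P W →
      π.ThroughputOptimal P W ∧ π.MeanDelayOptimal P W := fun π hπ hwc =>
    ⟨UpdateSystem.Policy.throughputOptimal_of_workConserving hρ hdriven hπ hwc,
      UpdateSystem.Policy.meanDelayOptimal_of_workConserving hρ hdriven hπ hwc⟩
  refine ⟨⟨_, UpdateSystem.isPrmpLGFS_lgfsPolicy P W⟩, fun π h => ?_,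
    fun π π' hπ hwc hπ' hwc' => ?_, hopt⟩
  · exact ⟨h.admissible, h.workConserving, hopt π h.admissible h.workConserving⟩
  · exact UpdateSystem.Policy.identDistrib_queueLength_deliveredCount hρ hdriven hπ hwc hπ' hwc'
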